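/- **Setting.** Fix an integer $k\ge 1$ and reals $K>0$, $\theta_M>0$, $\beta\ge \frac72$, $0<m<\frac12$ and $M$. For $\rho,\theta>0$ and $u\in\mathbb R^3$ let $$\mathcal M_{[\rho,u,\theta]}(v)=\frac{\rho}{(2\pi\theta)^{3/2}}\exp\Big\{-\frac{|v-u|^2}{2\theta}\Big\},\qquad \mu_M=\mathcal M_{[1,0,\theta_M]},\qquad w(v)=(1+|v|^2)^\beta .$$ For $\varepsilon>0$ and $T\ge 0$ consider the following data. * Coefficients $F_0,\dots,F_{2k-1}$, functions of $(t,x,v)\in[0,T]\times\mathbb R^3\times\mathbb R^3$ integrable in $v$, with densities $\rho_i(t,x)=\int_{\mathbb R^3}F_i(t,x,v)\,dv$. The leading one is a local Maxwellian, $F_0=\mathcal M_{[\rho_0,u_0,\theta_0]}$ with $\rho_0>0$, $\theta_0=K\rho_0^{2/3}$ and $\theta_M\le\theta_0\le 2\theta_M$. The densities are bounded in $W^{1,\infty}(\mathbb R^3)$ on $[0,T]$. The constants below depend on the coefficients only through a bound $M$ for the weighted size $$\max_{0\le i\le 2k-1}\ \sup_{0\le t\le T}\ (1+t)^{-2i}\,\|\rho_i(t)\|_{W^{1,\infty}(\mathbb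 R^3)}\le M .$$ * A remainder $R(t,x,v)$ such that $h=wR/\sqrt{\mu_M}$ satisfies $$\sup_{0\le\tau\le T}\varepsilon^k\|h(\tau)\|_{W^{1,\infty}(\mathbb R^3_x\times\mathbb R^3_v)}\le\varepsilon^{1/2}.$$ * A potential $\phi\in L^\infty([0,T];C^{2,\alpha}(\mathbb R^3))$, for some $\alpha\in(0,1)$, which solves at each time $t\in[0,T]$ $$\Delta\phi=e^{\phi}-\int_{\mathbb R^3}F\,dv,\qquad F=F_0+\varepsilon F_1+\dots+\varepsilon^{2k-1}F_{2k-1}+\varepsilon^kR .$$ For $t,\tau\in[0,T]$ let $[X(\tau),V(\tau)]=[X(\tau;t,x,v),V(\tau;t,x,v)]$ be the characteristics $$\frac{dX}{d\tau}=V,\qquad \frac{dV}{d\tau}=-\nabla_x\phi(\tau,X),\qquad X(t)=x,\quad V(t)=v$$ (in integrated form, since $\phi$ need not be continuous in time). **Lemma.** There are $\varepsilon_0>0$, $T_*>0$, $C>0$ and $C_N$ $(N\ge1)$, depending only on $k,K,\theta_M,\beta,m,M$ (and $C_N$ on $N$), such that for all $0<\varepsilon<\varepsilon_0$, all $0\le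 T\le\varepsilon^{-m}$ and all data as above, the following holds with $T_0=\min\{T,T_*\}$. 1. For $t,\tau\in[0,T]$ the maps $(x,v)\mapsto X(\tau;t,x,v)$ and $(x,v)\mapsto V(\tau;t,x,v)$ are of class $C^1$, and $$\sup_{0\le\tau\le T}\|\partial_xX(\tau)\|_\infty\le C_T,\qquad \sup_{0\le\tau\le T}\|\partial_vV(\tau)\|_\infty\le C_T,\qquad C_T=Ce^{CT}.$$ 2. For $0\le\tau\le t\le T_0$ and all $x,v\in\mathbb R^3$, $$\tfrac12|t-\tau|^3\le\Big|\det\frac{\partial X(\tau)}{\partial v}\Big|\le2|t-\tau|^3,\qquad |\partial_vX(\tau)|\le2|t-\tau|,$$ $$\tfrac12\le\Big|\det\frac{\partial V(\tau)}{\partial v}\Big|\le2,\qquad \tfrac12\le\Big|\det\frac{\partial X(\tau)}{\partial x}\Big|\le2,$$ where $|\partial_vX|$ is the Euclidean (Frobenius) norm of the matrix. 3. For $t,\tau\in[0,T_0]$ the weak derivatives $\partial_{xv}X(\tau)$ and $\partial_{vv}X(\tau)$ of $(x,v)\mapsto\partial_vX(\tau;t,x,v)$ exist as locally integrable functions on $\mathbb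 R^3\times\mathbb R^3$ and, for suitable representatives, $$\sup_{x_0\in\mathbb R^3,\ |v|\le N}\Big(\int_{\{|x-x_0|\le N\}}\big(|\partial_{xv}X(\tau)|^2+|\partial_{vv}X(\tau)|^2\big)\,dx\Big)^{1/2}\le C_N\qquad\text{for every }N\ge1 .$$ In particular, for coefficients that do not depend on $\varepsilon$ and have densities bounded in $W^{1,\infty}(\mathbb R^3)$ on $[0,T]$, all constants are independent of $\varepsilon$; if the weighted size is bounded uniformly in $T$, then $\varepsilon_0,T_*,C,C_N$ are also independent of $T\le\varepsilon^{-m}$. -/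

import Mathlib

open Set MeasureTheory
open scoped ENNReal ContDiff Gradient Laplacian

/-- Physical space `ℝ³` (also velocity space), with its Euclidean norm. -/
abbrev E3 : Type := EuclideanSpace ℝ (Fin 3)

/-! ### Weak derivatives and the space `W^{1,∞}` -/

/-- `G` is the weak derivative of `f` on the whole space `U`: both are locally integrable and
`∫ ∂ₑψ f = - ∫ ψ (G e)` for every test function `ψ ∈ C_c^∞(U)` and every direction `e`. -/
def HasWeakDeriv {U W : Type*} [NormedAddCommGroup U] [NormedSpace ℝ U] [MeasureSpace U]
    [NormedAddCommGroup W] [NormedSpace ℝ W] (f : U → W) (G : U → (U →L[ℝ] W)) : Prop :=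
  LocallyIntegrable f volume ∧ LocallyIntegrable G volume ∧
    ∀ ψ : U → ℝ, ContDiff ℝ ∞ ψ → HasCompactSupport ψ → ∀ e : U,
      ∫ p, (fderiv ℝ ψ p e) • f p = - ∫ p, ψ p • (G p e)

/-- The norm `‖f‖_{W^{1,∞}} = ‖f‖_{L^∞} + ‖Df‖_{L^∞}`, with `Df` the weak derivative; it is `∞` if
`f` has no weak derivative. (The weak derivative is unique almost everywhere, so the infimum is
over functions with the same norm.) -/
noncomputable def w1InfNorm {U : Type*} [NormedAddCommGroup U] [NormedSpace ℝ U] [MeasureSpace U]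
    (f : U → ℝ) : ℝ≥0∞ :=
  ⨅ (G : U → (U →L[ℝ] ℝ)) (_ : HasWeakDeriv f G), eLpNorm f ∞ volume + eLpNorm G ∞ volume

/-- `g ∈ C^{2,α}(ℝ³)`, with every constituent of its norm (`sup |g|`, `sup |Dg|`, `sup |D²g|` and
the `α`-Hölder seminorm of `D²g`) bounded by `A`. -/
def C2HolderBound (α A : ℝ) (g : E3 → ℝ) : Prop :=
  ContDiff ℝ 2 g ∧ (∀ x, |g x| ≤ A) ∧ (∀ x, ‖fderiv ℝ g x‖ ≤ A) ∧
    (∀ x, ‖fderiv ℝ (fderiv ℝ g) x‖ ≤ A) ∧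
    ∀ x y, ‖fderiv ℝ (fderiv ℝ g) x - fderiv ℝ (fderiv ℝ g) y‖ ≤ A * ‖x - y‖ ^ α

/-! ### Maxwellians, the weight, the truncated expansion -/

/-- The Maxwellian with density `ρ`, bulk velocity `u` and temperature `θ`. -/
noncomputable def maxwellian (ρ θ : ℝ) (u v : E3) : ℝ :=
  ρ / (2 * Real.pi * θ) ^ (3 / 2 : ℝ) * Real.exp (-‖v - u‖ ^ 2 / (2 * θ))

/-- The velocity weight `w(v) = (1 + |v|²)^β`. -/
noncomputable def velWeight (β : ℝ) (v : E3) : ℝ := (1 + ‖v‖ ^ 2) ^ β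

/-- `h = w R / √μ_M` as a function on phase space, for a fixed time; `μ_M` is the global Maxwellian
with density `1`, velocity `0` and temperature `θM`. -/
noncomputable def weightedRemainder (β θM : ℝ) (R : E3 → E3 → ℝ) (p : E3 × E3) : ℝ :=
  velWeight β p.2 * R p.1 p.2 / Real.sqrt (maxwellian 1 θM 0 p.2)

/-- The truncated expansion `F = F₀ + ε F₁ + ⋯ + ε^{2k-1} F_{2k-1} + ε^k R`. -/
noncomputable def truncatedExpansion (k : ℕ) (ε : ℝ) (F : ℕ → ℝ → E3 → E3 → ℝ)
    (R : ℝ → E3 → E3 → ℝ) (t : ℝ) (x v : E3) : ℝ :=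
  (∑ i ∈ Finset.range (2 * k), ε ^ i * F i t x v) + ε ^ k * R t x v

/-- The size on `[0,T]` of the coefficients `F₀, …, F_{2k-1}`, seen through their densities
`ρᵢ(t,x) = ∫ Fᵢ(t,x,v) dv`:
`sup_{i < 2k} sup_{0 ≤ t ≤ T} (1+t)^{-2i} ‖ρᵢ(t)‖_{W^{1,∞}(ℝ³)}`.
It is finite as soon as the densities are bounded in `W^{1,∞}(ℝ³)` on `[0,T]`; it serves to say on
which feature of the coefficients the constants are allowed to depend. -/
noncomputable def coeffSize (k : ℕ) (F : ℕ → ℝ → E3 → E3 → ℝ) (T : ℝ) : ℝ≥0∞ :=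
  ⨆ i ∈ Finset.range (2 * k), ⨆ t ∈ Icc (0 : ℝ) T,
    w1InfNorm (fun x : E3 => ∫ v, F i t x v) / ENNReal.ofReal ((1 + t) ^ (2 * i))

/-! ### Characteristics -/

/-- `[X(τ;t,x,v), V(τ;t,x,v)]`, written `X τ t x v` and `V τ t x v`, are for `τ, t ∈ [0,T]` the
characteristics of the field with potential `φ`:
`dX/dτ = V`, `dV/dτ = -∇φ(τ,X)`, `X(t) = x`, `V(t) = v`. As `φ` is only measurable and bounded in
time, the equations are meant, as usual, in integrated form, for curves continuous in `τ`. -/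
def IsCharacteristics (T : ℝ) (φ : ℝ → E3 → ℝ) (X V : ℝ → ℝ → E3 → E3 → E3) : Prop :=
  ∀ t ∈ Icc (0 : ℝ) T, ∀ x v : E3,
    ContinuousOn (fun τ => X τ t x v) (Icc 0 T) ∧
    ContinuousOn (fun τ => V τ t x v) (Icc 0 T) ∧
    ∀ τ ∈ Icc (0 : ℝ) T,
      X τ t x v = x + ∫ s in t..τ, V s t x v ∧
      V τ t x v = v - ∫ s in t..τ, ∇ (φ s) (X s t x v)

/-- The Jacobian matrix `∂Z(τ;t,x,v)/∂x`, as a linear map. -/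
noncomputable def derivX (Z : ℝ → ℝ → E3 → E3 → E3) (τ t : ℝ) (x v : E3) : E3 →L[ℝ] E3 :=
  fderiv ℝ (fun y => Z τ t y v) x

/-- The Jacobian matrix `∂Z(τ;t,x,v)/∂v`, as a linear map. -/
noncomputable def derivV (Z : ℝ → ℝ → E3 → E3 → E3) (τ t : ℝ) (x v : E3) : E3 →L[ℝ] E3 :=
  fderiv ℝ (fun w => Z τ t x w) v

/-- The Euclidean (Frobenius) norm of a `3 × 3` matrix; it dominates the operator norm. -/
noncomputable def matNorm (A : E3 →L[ℝ] E3) : ℝ :=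
  Real.sqrt (∑ j : Fin 3, ‖A (EuclideanSpace.single j 1)‖ ^ 2)

/-!
# Characteristics of the truncated Hilbert expansion

The potential enters the characteristic system only through `∇φ`, so everything follows from
estimates on `φ` that do not see `ε` or `T`.

*The density.* The density of the local Maxwellian is `ρ₀ ≥ (θ_M / K)^{3/2}`. As `2m < 1`, the
quantity `ε (1 + t)²` is at most `4 ε^{1 - 2m}` on `[0, ε^{-m}]`, so that the higher coefficients
and the remainder are a small perturbation in `W^{1,∞}`. Hence `∫ F dv` is bounded, bounded away
from zero and Lipschitz continuous, uniformly in the data (`exists_density_bounds`).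

*The potential.* In `Δφ = e^φ - ρ` the maximum principle bounds `φ` above and below. A bounded
function with bounded Laplacian has a bounded gradient: compare it, across a hyperplane, with its
reflection by means of an explicit barrier (`symm_difference_le`). So `∇φ` is bounded, `Δφ` is
therefore Lipschitz, and the gradient estimate for the difference quotients of `φ` bounds `D²φ`
(`exists_potential_bound`). All this uses only second differences at a maximum point. No singular
integral appears, because a *Lipschitz* right-hand side is available. The Hölder continuity of
`D²φ`, for which there is no uniform bound, matters only qualitatively: it makes the difference
quotients of the flow converge.

*The flow.* The field `(x, v) ↦ (v, -∇φ)` is measurable in time and Lipschitz in phase space with a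
uniform constant `L`. Grönwall's inequality shows that the flow is `C¹`, with Jacobian bounded by
`e^{LT}` (`IsCaratheodoryFlow.exists_jacobian`). When `L T e^{LT}` is small, the Jacobian is close to
the identity, and `∂ᵥX = ∫ ∂ᵥV` is `τ - t` times a matrix close to the identity. The determinant and
norm bounds hold in a neighbourhood of the identity (`exists_radius_near_id`).

*Second derivatives of the characteristics.* Since `Δφ` is Lipschitz, the energy identity for
`∂ₖφ` with a cutoff bounds `D³φ` in `L²` on balls of fixed radius (`exists_hessian_approx`). For
short times the map `x ↦ X(τ; t, x, v)` is a small Lipschitz perturbation of the identity, so that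
`D²φ(X(x, v))` and `D²φ(X((x, v) + e))` differ by `O(|e|)` in `L²` on balls in `x`
(`exists_lintegral_hessian_comp_le`). Grönwall's inequality for the linearised equation transfers
this bound to the increments of `∂ᵥX` (`exists_lintegral_derivV_sub_le`). Finally, difference
quotients that are bounded in `L²` on every slice `{v = const}` have weak limits, which are the weak
derivatives of `∂ᵥX` and obey the same bound on almost every slice. Setting them to zero on the
remaining slices gives the required representative (`exists_hasWeakDeriv_slices`).
-/

open Filter Topology
open scoped Convolution

set_option linter.unusedSectionVars false

/-! ### The maximum principle and interior derivative bounds -/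

/-- The `j`-th vector of the standard basis of `ℝ³`. -/
noncomputable abbrev stdVec (j : Fin 3) : E3 := EuclideanSpace.single j 1

/-- The symmetric second difference quotient of `u` at `y` with step `t`, summed over the three
coordinate directions. It converges to the Laplacian as `t → 0`, and is non-positive at a local
maximum. -/
noncomputable def symDiffLaplacian (u : E3 → ℝ) (t : ℝ) (y : E3) : ℝ :=
  ∑ j, (u (y + t • stdVec j) + u (y - t • stdVec j) - 2 * u y) / t ^ 2

/-- `f` is the Laplacian of `u` in the sense of symmetric second differences. This weak form is
stable under translations and reflections by direct inspection. -/
def HasSymLaplacian (u f : E3 → ℝ) : Prop :=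
  ∀ y, Tendsto (fun t => symDiffLaplacian u t y) (𝓝[≠] 0) (𝓝 (f y))

lemma tendsto_symm_second_difference {a : ℝ → ℝ} (ha : ContDiff ℝ 2 a) :
    Tendsto (fun t => (a t + a (-t) - 2 * a 0) / t ^ 2) (𝓝[≠] 0) (𝓝 (deriv (deriv a) 0)) := by
  have hd : Differentiable ℝ a := ha.differentiable (by norm_num)
  have hd1 : ContDiff ℝ 1 (deriv a) := ha.deriv' (n := 1)
  have hd2 : HasDerivAt (deriv a) (deriv (deriv a) 0) 0 :=
    (hd1.differentiable (by norm_num) 0).hasDerivAt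
  have h1 : ∀ t, HasDerivAt (fun t => a t + a (-t) - 2 * a 0) (deriv a t - deriv a (-t)) t := by
    intro t
    have := ((hd t).hasDerivAt.add ((hd (-t)).hasDerivAt.comp t (hasDerivAt_neg t))).sub_const
      (2 * a 0)
    refine this.congr_deriv ?_
    ring
  have h2 : ∀ t : ℝ, HasDerivAt (fun t : ℝ => t ^ 2) (2 * t) t := by
    intro t
    simpa using hasDerivAt_pow 2 t
  refine HasDerivAt.lhopital_zero_nhdsNE (f' := fun t => deriv a t - deriv a (-t))
    (g' := fun t => 2 * t) (Eventually.of_forall h1) (Eventually.of_forall h2) ?_ ?_ ?_ ?_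
  · filter_upwards [self_mem_nhdsWithin] with t ht
    simpa using ht
  · have : ContinuousAt (fun t => a t + a (-t) - 2 * a 0) 0 := (h1 0).continuousAt
    have := this.tendsto
    simp only [neg_zero] at this
    rw [show a 0 + a 0 - 2 * a 0 = 0 by ring] at this
    exact this.mono_left nhdsWithin_le_nhds
  · have := (h2 0).continuousAt.tendsto
    simp only [ne_eq, OfNat.ofNat_ne_zero, not_false_eq_true, zero_pow] at this
    exact this.mono_left nhdsWithin_le_nhds
  · have h3 := hasDerivAt_iff_tendsto_slope.1 hd2
    have h4 : Tendsto (fun t : ℝ => -t) (𝓝[≠] 0) (𝓝[≠] 0) := by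
      refine tendsto_nhdsWithin_of_tendsto_nhds_of_eventually_within _ ?_ ?_
      · have := (continuous_neg (G := ℝ)).tendsto 0
        simp only [neg_zero] at this
        exact this.mono_left nhdsWithin_le_nhds
      · filter_upwards [self_mem_nhdsWithin] with t ht
        simpa using ht
    have h5 := (h3.add (h3.comp h4)).div_const 2
    rw [show (deriv (deriv a) 0 + deriv (deriv a) 0) / 2 = deriv (deriv a) 0 by ring] at h5
    refine h5.congr' ?_
    filter_upwards [self_mem_nhdsWithin] with t ht
    have ht : t ≠ 0 := ht
    simp only [slope, Function.comp, vsub_eq_sub, sub_zero, smul_eq_mul]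
    field_simp
    ring

lemma hasDerivAt_line {W : Type*} [NormedAddCommGroup W] [NormedSpace ℝ W] {U : Type*}
    [NormedAddCommGroup U] [NormedSpace ℝ U] {u : U → W}
    (hu : Differentiable ℝ u) (y e : U) (t : ℝ) :
    HasDerivAt (fun t : ℝ => u (y + t • e)) (fderiv ℝ u (y + t • e) e) t := by
  have h : HasDerivAt (fun t : ℝ => y + t • e) e t := by
    simpa using ((hasDerivAt_id t).smul_const e).const_add y
  exact (hu _).hasFDerivAt.comp_hasDerivAt t h

lemma tendsto_symm_second_difference_line {u : E3 → ℝ} (hu : ContDiff ℝ 2 u) (y e : E3) :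
    Tendsto (fun t : ℝ => (u (y + t • e) + u (y - t • e) - 2 * u y) / t ^ 2) (𝓝[≠] 0)
      (𝓝 (fderiv ℝ (fderiv ℝ u) y e e)) := by
  have hd : Differentiable ℝ u := hu.differentiable (by norm_num)
  have hd' : Differentiable ℝ (fderiv ℝ u) :=
    (hu.fderiv_right (m := 1) (by norm_num)).differentiable (by norm_num)
  have ha : ContDiff ℝ 2 (fun t : ℝ => u (y + t • e)) := hu.comp (by fun_prop)
  have h := tendsto_symm_second_difference ha
  have h1 : deriv (fun t : ℝ => u (y + t • e)) = fun t => fderiv ℝ u (y + t • e) e :=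
    funext fun t => (hasDerivAt_line hd y e t).deriv
  have h2 : deriv (deriv (fun t : ℝ => u (y + t • e))) 0 = fderiv ℝ (fderiv ℝ u) y e e := by
    rw [h1]
    have := (hasDerivAt_line hd' y e 0).clm_apply (hasDerivAt_const (0 : ℝ) e)
    simpa using this.deriv
  rw [h2] at h
  simpa [sub_eq_add_neg] using h

lemma laplacian_eq_sum_fderiv (u : E3 → ℝ) (y : E3) :
    Laplacian.laplacian u y = ∑ j, fderiv ℝ (fderiv ℝ u) y (stdVec j) (stdVec j) := by
  rw [InnerProductSpace.laplacian_eq_iteratedFDeriv_orthonormalBasis u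
    (EuclideanSpace.basisFun (Fin 3) ℝ)]
  simp [iteratedFDeriv_two_apply]

lemma hasSymLaplacian_of_contDiff {u : E3 → ℝ} (hu : ContDiff ℝ 2 u) :
    HasSymLaplacian u (Laplacian.laplacian u) := by
  intro y
  rw [laplacian_eq_sum_fderiv]
  exact tendsto_finsetSum _ fun j _ => tendsto_symm_second_difference_line hu y (stdVec j)

lemma HasSymLaplacian.neg {u f : E3 → ℝ} (h : HasSymLaplacian u f) :
    HasSymLaplacian (fun x => - u x) (fun x => - f x) := by
  intro y
  refine (h y).neg.congr fun t => ?_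
  simp only [symDiffLaplacian, ← Finset.sum_neg_distrib]
  exact Finset.sum_congr rfl fun j _ => by ring

lemma HasSymLaplacian.difference_quotient {u f : E3 → ℝ} (h : HasSymLaplacian u f) (a : E3)
    (c : ℝ) : HasSymLaplacian (fun x => c * (u (x + a) - u x)) (fun x => c * (f (x + a) - f x)) := by
  intro y
  refine (((h (y + a)).sub (h y)).const_mul c).congr fun t => ?_
  simp only [symDiffLaplacian, ← Finset.sum_sub_distrib, Finset.mul_sum]
  refine Finset.sum_congr rfl fun j _ => ?_
  rw [show y + t • stdVec j + a = y + a + t • stdVec j by abel,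
    show y - t • stdVec j + a = y + a - t • stdVec j by abel]
  ring

lemma symm_second_difference_norm_sq (a : E3) (t : ℝ) (j : Fin 3) :
    ‖a + t • stdVec j‖ ^ 2 + ‖a - t • stdVec j‖ ^ 2 - 2 * ‖a‖ ^ 2 = 2 * t ^ 2 := by
  have h := parallelogram_law_with_norm ℝ a (t • stdVec j)
  have h2 : ‖t • stdVec j‖ = |t| := by simp [norm_smul]
  rw [h2] at h
  nlinarith [sq_abs t]

/-- A function on `ℝ³` that is bounded above almost attains its supremum, up to a small
quadratic, at a point where its Laplacian is almost non-positive. -/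
lemma exists_almost_max {u f : E3 → ℝ} (hu : Continuous u) {A : ℝ} (hA : ∀ x, u x ≤ A)
    (h : HasSymLaplacian u f) {δ : ℝ} (hδ : 0 < δ) :
    ∃ y, f y ≤ 6 * δ ∧ ∀ x, u x ≤ u y + δ * ‖x‖ ^ 2 := by
  obtain ⟨y, hy⟩ : ∃ y, ∀ x, u x - δ * ‖x‖ ^ 2 ≤ u y - δ * ‖y‖ ^ 2 := by
    refine Continuous.exists_forall_ge (by fun_prop) ?_
    have h1 : Tendsto (fun x : E3 => δ * ‖x‖ ^ 2) (cocompact E3) atTop :=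
      Tendsto.const_mul_atTop hδ ((tendsto_pow_atTop two_ne_zero).comp tendsto_norm_cocompact_atTop)
    refine tendsto_atBot_mono (fun x => ?_)
      (tendsto_atBot_add_const_left _ A (tendsto_neg_atTop_atBot.comp h1))
    simp only [Function.comp]
    linarith [hA x]
  refine ⟨y, ?_, fun x => ?_⟩
  · refine le_of_tendsto (h y) ?_
    filter_upwards [self_mem_nhdsWithin] with t ht
    have ht : 0 < t ^ 2 := by
      have ht : t ≠ 0 := ht
      positivity
    have hj : ∀ j, (u (y + t • stdVec j) + u (y - t • stdVec j) - 2 * u y) / t ^ 2 ≤ 2 * δ := by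
      intro j
      rw [div_le_iff₀ ht]
      have := symm_second_difference_norm_sq y t j
      nlinarith [hy (y + t • stdVec j), hy (y - t • stdVec j)]
    calc symDiffLaplacian u t y ≤ ∑ _j : Fin 3, 2 * δ := Finset.sum_le_sum fun j _ => hj j
      _ = 6 * δ := by simp; ring
  · have := hy x
    have := mul_nonneg hδ.le (sq_nonneg ‖y‖)
    linarith

/-- Upper bound from the maximum principle for `Δφ = e^φ - g`. -/
lemma exp_le_of_hasSymLaplacian {φ g : E3 → ℝ} (hφ : Continuous φ) {A c : ℝ} (hA : ∀ x, φ x ≤ A)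
    (h : HasSymLaplacian φ fun x => Real.exp (φ x) - g x) (hg : ∀ x, g x ≤ c) (x : E3) :
    Real.exp (φ x) ≤ c := by
  have key : ∀ δ > 0, Real.exp (φ x - δ * ‖x‖ ^ 2) ≤ c + 6 * δ := by
    intro δ hδ
    obtain ⟨y, hy, hx⟩ := exists_almost_max hφ hA h hδ
    calc Real.exp (φ x - δ * ‖x‖ ^ 2) ≤ Real.exp (φ y) := by
          gcongr
          linarith [hx x]
      _ ≤ c + 6 * δ := by linarith [hg y]
  have h1 : Tendsto (fun δ : ℝ => Real.exp (φ x - δ * ‖x‖ ^ 2)) (𝓝[>] 0) (𝓝 (Real.exp (φ x))) := by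
    have : Continuous fun δ : ℝ => Real.exp (φ x - δ * ‖x‖ ^ 2) := by fun_prop
    have := this.tendsto 0
    simp only [zero_mul, sub_zero] at this
    exact this.mono_left nhdsWithin_le_nhds
  have h2 : Tendsto (fun δ : ℝ => c + 6 * δ) (𝓝[>] 0) (𝓝 c) := by
    have : Continuous fun δ : ℝ => c + 6 * δ := by fun_prop
    have := this.tendsto 0
    simp only [mul_zero, add_zero] at this
    exact this.mono_left nhdsWithin_le_nhds
  exact le_of_tendsto_of_tendsto h1 h2 (by filter_upwards [self_mem_nhdsWithin] with δ hδ using key δ hδ)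

/-- Lower bound from the maximum principle for `Δφ = e^φ - g`. -/
lemma le_exp_of_hasSymLaplacian {φ g : E3 → ℝ} (hφ : Continuous φ) {A c : ℝ} (hA : ∀ x, -A ≤ φ x)
    (h : HasSymLaplacian φ fun x => Real.exp (φ x) - g x) (hg : ∀ x, c ≤ g x) (x : E3) :
    c ≤ Real.exp (φ x) := by
  have key : ∀ δ > 0, c - 6 * δ ≤ Real.exp (φ x + δ * ‖x‖ ^ 2) := by
    intro δ hδ
    obtain ⟨y, hy, hx⟩ := exists_almost_max (u := fun x => - φ x) hφ.neg
      (A := A) (fun x => by linarith [hA x]) h.neg hδ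
    calc c - 6 * δ ≤ Real.exp (φ y) := by linarith [hg y]
      _ ≤ Real.exp (φ x + δ * ‖x‖ ^ 2) := by
          gcongr
          linarith [hx x]
  have h1 : Tendsto (fun δ : ℝ => Real.exp (φ x + δ * ‖x‖ ^ 2)) (𝓝[>] 0) (𝓝 (Real.exp (φ x))) := by
    have : Continuous fun δ : ℝ => Real.exp (φ x + δ * ‖x‖ ^ 2) := by fun_prop
    have := this.tendsto 0
    simp only [zero_mul, add_zero] at this
    exact this.mono_left nhdsWithin_le_nhds
  have h2 : Tendsto (fun δ : ℝ => c - 6 * δ) (𝓝[>] 0) (𝓝 c) := by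
    have : Continuous fun δ : ℝ => c - 6 * δ := by fun_prop
    have := this.tendsto 0
    simp only [mul_zero, sub_zero] at this
    exact this.mono_left nhdsWithin_le_nhds
  exact le_of_tendsto_of_tendsto h2 h1 (by filter_upwards [self_mem_nhdsWithin] with δ hδ using key δ hδ)

/-- The reflection of `ℝ³` in the plane through `x` orthogonal to the `i`-th axis. -/
noncomputable def reflectAt (x : E3) (i : Fin 3) (y : E3) : E3 := y - (2 * (y i - x i)) • stdVec i

lemma reflectAt_add_same (x y : E3) (i : Fin 3) (t : ℝ) :
    reflectAt x i (y + t • stdVec i) = reflectAt x i y - t • stdVec i := by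
  simp only [reflectAt, PiLp.add_apply, PiLp.smul_apply, PiLp.single_apply, if_true,
    smul_eq_mul, mul_one]
  module

lemma reflectAt_add_of_ne (x y : E3) {i j : Fin 3} (hij : i ≠ j) (t : ℝ) :
    reflectAt x i (y + t • stdVec j) = reflectAt x i y + t • stdVec j := by
  simp only [reflectAt, PiLp.add_apply, PiLp.smul_apply, PiLp.single_apply, if_neg hij,
    smul_eq_mul, mul_zero, add_zero]
  module

lemma symDiff_comp_reflectAt (u : E3 → ℝ) (x y : E3) (i j : Fin 3) (t : ℝ) :
    u (reflectAt x i (y + t • stdVec j)) + u (reflectAt x i (y - t • stdVec j)) =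
      u (reflectAt x i y + t • stdVec j) + u (reflectAt x i y - t • stdVec j) := by
  have hn : y - t • stdVec j = y + (-t) • stdVec j := by module
  rw [hn]
  rcases eq_or_ne i j with rfl | hij
  · rw [reflectAt_add_same, reflectAt_add_same, neg_smul, sub_neg_eq_add, add_comm]
  · rw [reflectAt_add_of_ne _ _ hij, reflectAt_add_of_ne _ _ hij, neg_smul, sub_eq_add_neg]

/-- Brandt's maximum principle argument: on the strip `0 ≤ yᵢ - xᵢ ≤ 1` the odd part of `u` under
reflection in `{yᵢ = xᵢ}` vanishes at `yᵢ = xᵢ` and stays below the barrier `4As - 2As²`,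
`s = yᵢ - xᵢ`. -/
lemma symm_difference_le {u f : E3 → ℝ} (hu : Continuous u) {A : ℝ} (hA0 : 0 < A)
    (hA : ∀ x, |u x| ≤ A) (h : HasSymLaplacian u f) (hf : ∀ x, |f x| ≤ A) (x : E3) (i : Fin 3)
    {s : ℝ} (hs0 : 0 ≤ s) (hs1 : s ≤ 1) :
    u (x + s • stdVec i) - u (x - s • stdVec i) ≤ 4 * A * s := by
  have hrefl : Continuous (reflectAt x i) := by
    unfold reflectAt
    fun_prop
  have hpen : ∀ δ > 0, δ < A / 3 → ∀ y : E3, 0 ≤ y i - x i → y i - x i ≤ 1 →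
      u y - u (reflectAt x i y) - (4 * A * (y i - x i) - 2 * A * (y i - x i) ^ 2) -
        δ * ‖y - x‖ ^ 2 ≤ 0 := by
    intro δ hδ hδA y₀ hy₀ hy₀'
    by_contra! hpos
    set Ψ : E3 → ℝ := fun y => u y - u (reflectAt x i y) -
      (4 * A * (y i - x i) - 2 * A * (y i - x i) ^ 2) - δ * ‖y - x‖ ^ 2 with hΨ
    set S : Set E3 := {y | 0 ≤ y i - x i ∧ y i - x i ≤ 1} with hS
    have hci : Continuous fun y : E3 => y i - x i := by fun_prop
    have hSc : IsClosed S := (isClosed_le continuous_const hci).inter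
      (isClosed_le hci continuous_const)
    have hΨc : Continuous Ψ := by fun_prop
    have hcoer : Tendsto (fun y : E3 => 2 * A - δ * ‖y - x‖ ^ 2) (cocompact E3) atBot := by
      have h0 : Tendsto (fun y : E3 => ‖y - x‖) (cocompact E3) atTop :=
        tendsto_norm_cocompact_atTop.comp (Homeomorph.subRight x).isClosedEmbedding.tendsto_cocompact
      have h1 : Tendsto (fun y : E3 => δ * ‖y - x‖ ^ 2) (cocompact E3) atTop :=
        Tendsto.const_mul_atTop hδ ((tendsto_pow_atTop two_ne_zero).comp h0)
      exact tendsto_atBot_add_const_left _ (2 * A) (tendsto_neg_atTop_atBot.comp h1)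
    obtain ⟨y, hyS, hy⟩ := hΨc.continuousOn.exists_isMaxOn' hSc (x₀ := y₀) ⟨hy₀, hy₀'⟩ (by
      rw [eventually_inf_principal]
      filter_upwards [hcoer.eventually_le_atBot (Ψ y₀)] with y hy hyS
      refine le_trans ?_ hy
      simp only [hΨ]
      have h1 := (abs_le.1 (hA y)).2
      have h2 := (abs_le.1 (hA (reflectAt x i y))).1
      have h3 : 0 ≤ 4 * A * (y i - x i) - 2 * A * (y i - x i) ^ 2 := by
        have : 0 ≤ A * (y i - x i) * (2 - (y i - x i)) :=
          mul_nonneg (mul_nonneg hA0.le hyS.1) (by linarith [hyS.2])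
        nlinarith
      linarith)
    have hypos : 0 < Ψ y := lt_of_lt_of_le hpos (hy ⟨hy₀, hy₀'⟩)
    -- the maximum is interior to the strip, as `Ψ ≤ 0` on both of its faces
    have hlt0 : 0 < y i - x i := by
      refine lt_of_le_of_ne hyS.1 fun h0 => ?_
      have : reflectAt x i y = y := by simp [reflectAt, ← h0]
      simp only [hΨ, this, ← h0] at hypos
      nlinarith [mul_nonneg hδ.le (sq_nonneg ‖y - x‖)]
    have hlt1 : y i - x i < 1 := by
      refine lt_of_le_of_ne hyS.2 fun h0 => ?_
      have h1 := (abs_le.1 (hA y)).2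
      have h2 := (abs_le.1 (hA (reflectAt x i y))).1
      simp only [hΨ, h0] at hypos
      nlinarith [mul_nonneg hδ.le (sq_nonneg ‖y - x‖)]
    have hlim : Tendsto (fun t => symDiffLaplacian u t y - symDiffLaplacian u t (reflectAt x i y) +
        (4 * A - 6 * δ)) (𝓝[≠] 0) (𝓝 (f y - f (reflectAt x i y) + (4 * A - 6 * δ))) :=
      ((h y).sub (h _)).add_const _
    -- The second difference of the barrier is `4 * A * t ^ 2` in direction `i`. At an interior
    -- maximum this forces `4 * A - 6 * δ ≤ 2 * A`, which contradicts `δ < A / 3`.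
    have hle : f y - f (reflectAt x i y) + (4 * A - 6 * δ) ≤ 0 := by
      refine le_of_tendsto hlim ?_
      have hint : ∀ᶠ t : ℝ in 𝓝[≠] 0, ∀ j, y + t • stdVec j ∈ S ∧ y - t • stdVec j ∈ S := by
        have hopen : IsOpen {y : E3 | 0 < y i - x i ∧ y i - x i < 1} :=
          (isOpen_lt continuous_const hci).inter (isOpen_lt hci continuous_const)
        have hsub : {y : E3 | 0 < y i - x i ∧ y i - x i < 1} ⊆ S := fun z hz => ⟨hz.1.le, hz.2.le⟩
        refine eventually_all.2 fun j => ?_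
        have c1 : Tendsto (fun t : ℝ => y + t • stdVec j) (𝓝[≠] 0) (𝓝 y) := by
          have : Continuous fun t : ℝ => y + t • stdVec j := by fun_prop
          simpa using (this.tendsto 0).mono_left nhdsWithin_le_nhds
        have c2 : Tendsto (fun t : ℝ => y - t • stdVec j) (𝓝[≠] 0) (𝓝 y) := by
          have : Continuous fun t : ℝ => y - t • stdVec j := by fun_prop
          simpa using (this.tendsto 0).mono_left nhdsWithin_le_nhds
        filter_upwards [c1.eventually (hopen.mem_nhds ⟨hlt0, hlt1⟩),
          c2.eventually (hopen.mem_nhds ⟨hlt0, hlt1⟩)] with t h1 h2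
        exact ⟨hsub h1, hsub h2⟩
      filter_upwards [self_mem_nhdsWithin, hint] with t ht hint
      have ht2 : 0 < t ^ 2 := by
        have ht : t ≠ 0 := ht
        positivity
      have hj : ∀ j, (u (y + t • stdVec j) + u (y - t • stdVec j) - 2 * u y) / t ^ 2 -
          (u (reflectAt x i y + t • stdVec j) + u (reflectAt x i y - t • stdVec j) -
            2 * u (reflectAt x i y)) / t ^ 2 + ((if j = i then 4 * A else 0) - 2 * δ) ≤ 0 := by
        intro j
        have hp := hy (hint j).1
        have hm := hy (hint j).2
        simp only [mem_ofPred_eq, hΨ] at hp hm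
        have hr := symDiff_comp_reflectAt u x y i j t
        have hn := symm_second_difference_norm_sq (y - x) t j
        rw [show y - x + t • stdVec j = y + t • stdVec j - x by abel,
          show y - x - t • stdVec j = y - t • stdVec j - x by abel] at hn
        have hq : (u (y + t • stdVec j) + u (y - t • stdVec j) - 2 * u y) -
          (u (reflectAt x i y + t • stdVec j) + u (reflectAt x i y - t • stdVec j) -
            2 * u (reflectAt x i y)) + ((if j = i then 4 * A else 0) - 2 * δ) * t ^ 2 ≤ 0 := by
          rcases eq_or_ne j i with rfl | hji
          · simp only [PiLp.add_apply, PiLp.sub_apply, PiLp.smul_apply, PiLp.single_apply, if_true,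
              smul_eq_mul, mul_one] at hp hm ⊢
            nlinarith
          · simp only [PiLp.add_apply, PiLp.sub_apply, PiLp.smul_apply, PiLp.single_apply,
              if_neg hji, if_neg hji.symm, smul_eq_mul, mul_zero, add_zero, sub_zero] at hp hm ⊢
            nlinarith
        have := div_nonpos_of_nonpos_of_nonneg hq ht2.le
        rw [add_div, sub_div, mul_div_assoc, div_self ht2.ne', mul_one] at this
        exact this
      calc symDiffLaplacian u t y - symDiffLaplacian u t (reflectAt x i y) + (4 * A - 6 * δ)
          = ∑ j, ((u (y + t • stdVec j) + u (y - t • stdVec j) - 2 * u y) / t ^ 2 -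
          (u (reflectAt x i y + t • stdVec j) + u (reflectAt x i y - t • stdVec j) -
            2 * u (reflectAt x i y)) / t ^ 2 + ((if j = i then 4 * A else 0) - 2 * δ)) := by
            simp only [symDiffLaplacian, Finset.sum_add_distrib, Finset.sum_sub_distrib,
              Finset.sum_ite_eq', Finset.mem_univ, if_true, Finset.sum_const, Finset.card_univ,
              Fintype.card_fin, nsmul_eq_mul]
            norm_num
            ring
        _ ≤ 0 := Finset.sum_nonpos fun j _ => hj j
    have h1 := (abs_le.1 (hf y)).1
    have h2 := (abs_le.1 (hf (reflectAt x i y))).2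
    linarith
  have hi : (x + s • stdVec i) i - x i = s := by simp
  have hr : reflectAt x i (x + s • stdVec i) = x - s • stdVec i := by
    rw [reflectAt_add_same]
    simp [reflectAt]
  have hlim : Tendsto (fun δ : ℝ => u (x + s • stdVec i) - u (x - s • stdVec i) -
      (4 * A * s - 2 * A * s ^ 2) - δ * ‖s • stdVec i‖ ^ 2) (𝓝[>] 0)
      (𝓝 (u (x + s • stdVec i) - u (x - s • stdVec i) - (4 * A * s - 2 * A * s ^ 2))) := by
    have : Continuous fun δ : ℝ => u (x + s • stdVec i) - u (x - s • stdVec i) -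
      (4 * A * s - 2 * A * s ^ 2) - δ * ‖s • stdVec i‖ ^ 2 := by fun_prop
    have := this.tendsto 0
    simp only [zero_mul, sub_zero] at this
    exact this.mono_left nhdsWithin_le_nhds
  have := le_of_tendsto hlim (b := 0) (by
    filter_upwards [Ioo_mem_nhdsGT (show (0 : ℝ) < A / 3 by positivity)] with δ hδ
    have := hpen δ hδ.1 hδ.2 (x + s • stdVec i) (by rw [hi]; exact hs0) (by rw [hi]; exact hs1)
    rw [hi, hr] at this
    simpa using this)
  nlinarith [mul_nonneg hA0.le (sq_nonneg s)]

/-- Interior gradient estimate: a bounded function with bounded Laplacian has bounded gradient. -/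
lemma abs_fderiv_stdVec_le {u f : E3 → ℝ} (hu : Differentiable ℝ u) {A : ℝ} (hA0 : 0 < A)
    (hA : ∀ x, |u x| ≤ A) (h : HasSymLaplacian u f) (hf : ∀ x, |f x| ≤ A) (x : E3) (i : Fin 3) :
    |fderiv ℝ u x (stdVec i)| ≤ 2 * A := by
  have key : ∀ (u f : E3 → ℝ), Differentiable ℝ u → (∀ x, |u x| ≤ A) → HasSymLaplacian u f →
      (∀ x, |f x| ≤ A) → fderiv ℝ u x (stdVec i) ≤ 2 * A := by
    intro u f hu hA h hf
    have h1 := hasDerivAt_line hu x (stdVec i) 0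
    have h2 := hasDerivAt_line hu x (-stdVec i) 0
    simp only [zero_smul, add_zero, map_neg] at h1 h2
    have h3 := (hasDerivWithinAt_iff_tendsto_slope' (by simp)).1 ((h1.sub h2).hasDerivWithinAt (s := Ioi 0))
    have := le_of_tendsto h3 (b := 4 * A) (by
      filter_upwards [Ioc_mem_nhdsGT (show (0 : ℝ) < 1 by norm_num)] with s hs
      have := symm_difference_le hu.continuous hA0 hA h hf x i hs.1.le hs.2
      simp only [slope, vsub_eq_sub, sub_zero, smul_eq_mul, Pi.sub_apply, zero_smul, add_zero,
        sub_self, smul_neg, ← sub_eq_add_neg]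
      rw [inv_mul_eq_div, div_le_iff₀ hs.1]
      exact this)
    linarith
  rw [abs_le]
  constructor
  · have := key (fun x => - u x) (fun x => - f x) hu.neg (by simpa using hA) h.neg (by simpa using hf)
    rw [fderiv_fun_neg] at this
    simp only [neg_apply] at this
    linarith
  · exact key u f hu hA h hf

lemma norm_le_of_stdVec {W : Type*} [NormedAddCommGroup W] [NormedSpace ℝ W] (l : E3 →L[ℝ] W) :
    ‖l‖ ≤ ∑ i, ‖l (stdVec i)‖ := by
  refine l.opNorm_le_bound (by positivity) fun x => ?_
  have hx : x = ∑ i, x i • stdVec i := by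
    simpa using ((EuclideanSpace.basisFun (Fin 3) ℝ).sum_repr x).symm
  conv_lhs => rw [hx]
  rw [map_sum, Finset.sum_mul]
  refine (norm_sum_le _ _).trans (Finset.sum_le_sum fun i _ => ?_)
  rw [map_smul, norm_smul, mul_comm]
  gcongr
  exact PiLp.norm_apply_le x i

/-- A bounded function with bounded Laplacian has a bounded gradient. -/
lemma norm_fderiv_le_of_laplacian {u f : E3 → ℝ} (hu : Differentiable ℝ u) {A : ℝ} (hA0 : 0 < A)
    (hA : ∀ x, |u x| ≤ A) (h : HasSymLaplacian u f) (hf : ∀ x, |f x| ≤ A) (x : E3) :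
    ‖fderiv ℝ u x‖ ≤ 6 * A := by
  refine (norm_le_of_stdVec _).trans ?_
  calc ∑ i, ‖fderiv ℝ u x (stdVec i)‖ ≤ ∑ _i : Fin 3, 2 * A :=
        Finset.sum_le_sum fun i _ => abs_fderiv_stdVec_le hu hA0 hA h hf x i
    _ = 6 * A := by simp; ring

/-- A function with bounded gradient and Lipschitz Laplacian has bounded second derivatives: the
gradient estimate applies to its difference quotients. -/
lemma norm_fderiv_fderiv_le_of_laplacian {u f : E3 → ℝ} (hu : ContDiff ℝ 2 u) {A : ℝ}
    (hA0 : 0 < A) (hA : ∀ x, ‖fderiv ℝ u x‖ ≤ A) (h : HasSymLaplacian u f)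
    (hf : ∀ x y, |f x - f y| ≤ A * ‖x - y‖) (x : E3) :
    ‖fderiv ℝ (fderiv ℝ u) x‖ ≤ 18 * A := by
  have hd : Differentiable ℝ u := hu.differentiable (by norm_num)
  have hd' : Differentiable ℝ (fderiv ℝ u) :=
    (hu.fderiv_right (m := 1) (by norm_num)).differentiable (by norm_num)
  have hlip : ∀ x y, |u x - u y| ≤ A * ‖x - y‖ := fun x y => by
    have := Convex.norm_image_sub_le_of_norm_fderiv_le (𝕜 := ℝ) (fun z _ => hd z) (fun z _ => hA z)
      convex_univ (mem_univ y) (mem_univ x)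
    simpa using this
  have hq : ∀ j, ∀ t : ℝ, t ≠ 0 →
      ‖t⁻¹ • (fderiv ℝ u (x + t • stdVec j) - fderiv ℝ u x)‖ ≤ 6 * A := by
    intro j t ht
    have hnorm : ‖t • stdVec j‖ = |t| := by simp [norm_smul]
    have hb : ∀ g : E3 → ℝ, (∀ x y, |g x - g y| ≤ A * ‖x - y‖) →
        ∀ z, |t⁻¹ * (g (z + t • stdVec j) - g z)| ≤ A := by
      intro g hg z
      rw [abs_mul, abs_inv, inv_mul_le_iff₀ (abs_pos.2 ht)]
      refine (hg _ _).trans ?_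
      rw [add_sub_cancel_left, hnorm, mul_comm]
    have hdq : Differentiable ℝ fun z => t⁻¹ * (u (z + t • stdVec j) - u z) := by fun_prop
    have := norm_fderiv_le_of_laplacian hdq hA0 (hb u hlip)
      (h.difference_quotient (t • stdVec j) t⁻¹) (hb f hf) x
    have hfd : HasFDerivAt (fun z => t⁻¹ * (u (z + t • stdVec j) - u z))
        (t⁻¹ • (fderiv ℝ u (x + t • stdVec j) - fderiv ℝ u x)) x := by
      have h1 : HasFDerivAt (fun z => u (z + t • stdVec j)) (fderiv ℝ u (x + t • stdVec j)) x :=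
        (hasFDerivAt_comp_add_right (f := u) (t • stdVec j)).2 (hd _).hasFDerivAt
      exact (h1.sub (hd x).hasFDerivAt).const_mul t⁻¹
    rwa [hfd.fderiv] at this
  refine (norm_le_of_stdVec _).trans ?_
  calc ∑ j, ‖fderiv ℝ (fderiv ℝ u) x (stdVec j)‖ ≤ ∑ _j : Fin 3, 6 * A := by
        refine Finset.sum_le_sum fun j _ => ?_
        have h1 := hasDerivAt_line hd' x (stdVec j) 0
        simp only [zero_smul, add_zero] at h1
        refine le_of_tendsto (hasDerivAt_iff_tendsto_slope.1 h1).norm ?_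
        filter_upwards [self_mem_nhdsWithin] with t ht
        simpa [slope] using hq j t ht
    _ = 18 * A := by simp; ring

/-! ### The energy estimate for third derivatives -/

/-- The partial derivative `∂ᵢu`. -/
noncomputable def partialDeriv (i : Fin 3) (u : E3 → ℝ) : E3 → ℝ := fun x => fderiv ℝ u x (stdVec i)

lemma contDiff_partialDeriv {u : E3 → ℝ} (hu : ContDiff ℝ ∞ u) (i : Fin 3) :
    ContDiff ℝ ∞ (partialDeriv i u) :=
  (hu.fderiv_right (m := ∞) le_rfl).clm_apply contDiff_const

lemma partialDeriv_partialDeriv {u : E3 → ℝ} (hu : ContDiff ℝ 2 u) (i j : Fin 3) (x : E3) :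
    partialDeriv i (partialDeriv j u) x = fderiv ℝ (fderiv ℝ u) x (stdVec i) (stdVec j) := by
  have hd' : DifferentiableAt ℝ (fderiv ℝ u) x :=
    (hu.fderiv_right (m := 1) (by norm_num)).differentiable (by norm_num) x
  have := hd'.hasFDerivAt.clm_apply (hasFDerivAt_const (stdVec j) x)
  unfold partialDeriv
  rw [this.fderiv]
  simp

lemma partialDeriv_comm {u : E3 → ℝ} (hu : ContDiff ℝ ∞ u) (i j : Fin 3) :
    partialDeriv i (partialDeriv j u) = partialDeriv j (partialDeriv i u) := by
  ext x
  have h2 : ContDiff ℝ 2 u := contDiff_infty.1 hu 2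
  rw [partialDeriv_partialDeriv h2, partialDeriv_partialDeriv h2]
  exact (h2.contDiffAt.isSymmSndFDerivAt (by simp)).eq _ _

lemma partialDeriv_mul {f g : E3 → ℝ} (hf : ContDiff ℝ ∞ f) (hg : ContDiff ℝ ∞ g) (i : Fin 3)
    (x : E3) : partialDeriv i (fun x => f x * g x) x =
      partialDeriv i f x * g x + f x * partialDeriv i g x := by
  unfold partialDeriv
  rw [fderiv_fun_mul (hf.differentiable (by simp) x) (hg.differentiable (by simp) x)]
  simp
  ring

lemma partialDeriv_sum {ι : Type*} (s : Finset ι) {f : ι → E3 → ℝ} (hf : ∀ i, ContDiff ℝ ∞ (f i))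
    (k : Fin 3) (x : E3) : partialDeriv k (fun x => ∑ i ∈ s, f i x) x =
      ∑ i ∈ s, partialDeriv k (f i) x := by
  unfold partialDeriv
  rw [fderiv_fun_sum fun i _ => (hf i).differentiable (by simp) x]
  simp

lemma integral_mul_partialDeriv {F G : E3 → ℝ} (hF : ContDiff ℝ ∞ F) (hc : HasCompactSupport F)
    (hG : ContDiff ℝ ∞ G) (i : Fin 3) :
    ∫ x, F x * partialDeriv i G x = - ∫ x, partialDeriv i F x * G x := by
  have hcF : HasCompactSupport (partialDeriv i F) := hc.fderiv_apply (𝕜 := ℝ) (stdVec i)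
  refine integral_mul_fderiv_eq_neg_fderiv_mul_of_integrable ?_ ?_ ?_
    (fun x _ => hF.differentiable (by simp) x) (fun x _ => hG.differentiable (by simp) x)
  · exact ((contDiff_partialDeriv hF i).continuous.mul hG.continuous).integrable_of_hasCompactSupport
      hcF.mul_right
  · exact (hF.continuous.mul (contDiff_partialDeriv hG i).continuous).integrable_of_hasCompactSupport
      hc.mul_right
  · exact (hF.continuous.mul hG.continuous).integrable_of_hasCompactSupport hc.mul_right

/-- Integrating by parts twice exchanges `∂ᵢⱼu ∂ᵢⱼu` for `∂ᵢᵢu ∂ⱼⱼu`, up to terms with only two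
derivatives on one factor. -/
lemma integral_mul_sq_partialDeriv {ζ u : E3 → ℝ} (hζ : ContDiff ℝ ∞ ζ) (hc : HasCompactSupport ζ)
    (hu : ContDiff ℝ ∞ u) (i j : Fin 3) :
    ∫ x, ζ x * partialDeriv i (partialDeriv j u) x ^ 2 =
      ∫ x, (ζ x * partialDeriv i (partialDeriv i u) x * partialDeriv j (partialDeriv j u) x +
        partialDeriv j ζ x * partialDeriv i (partialDeriv i u) x * partialDeriv j u x -
        partialDeriv i ζ x * partialDeriv j u x * partialDeriv i (partialDeriv j u) x) := by
  have s1 := contDiff_partialDeriv hu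
  have s2 := fun i j => contDiff_partialDeriv (s1 j) i
  have s3 := fun i j k => contDiff_partialDeriv (s2 j k) i
  have hζ1 := contDiff_partialDeriv hζ
  have hc1 : ∀ i, HasCompactSupport (partialDeriv i ζ) := fun i =>
    hc.fderiv_apply (𝕜 := ℝ) (stdVec i)
  have e1 := integral_mul_partialDeriv (F := fun x => ζ x * partialDeriv i (partialDeriv j u) x)
    (hζ.mul (s2 i j)) hc.mul_right (s1 j) i
  have e2 := integral_mul_partialDeriv (F := fun x => ζ x * partialDeriv i (partialDeriv i u) x)
    (hζ.mul (s2 i i)) hc.mul_right (s1 j) j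
  have hcomm : partialDeriv j (partialDeriv i (partialDeriv i u)) =
      partialDeriv i (partialDeriv i (partialDeriv j u)) := by
    rw [partialDeriv_comm (s1 i) j i, partialDeriv_comm hu j i]
  simp only [partialDeriv_mul hζ (s2 i j), partialDeriv_mul hζ (s2 i i), hcomm] at e1 e2
  have cint : ∀ {f g h : E3 → ℝ}, ContDiff ℝ ∞ f → HasCompactSupport f → ContDiff ℝ ∞ g →
      ContDiff ℝ ∞ h → Integrable fun x => f x * g x * h x := fun hf hcf hg hh =>
    ((hf.continuous.mul hg.continuous).mul hh.continuous).integrable_of_hasCompactSupport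
      hcf.mul_right.mul_right
  have i1 := cint hζ hc (s2 i i) (s2 j j)
  have i2 := cint (hζ1 j) (hc1 j) (s2 i i) (s1 j)
  have i3 := cint (hζ1 i) (hc1 i) (s1 j) (s2 i j)
  have i3' := cint (hζ1 i) (hc1 i) (s2 i j) (s1 j)
  have i4 := cint hζ hc (s3 i i j) (s1 j)
  have i12 : Integrable fun x =>
      ζ x * partialDeriv i (partialDeriv i u) x * partialDeriv j (partialDeriv j u) x +
        partialDeriv j ζ x * partialDeriv i (partialDeriv i u) x * partialDeriv j u x := i1.add i2
  rw [integral_sub i12 i3, integral_add i1 i2, e2]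
  have e3 : ∫ x, ζ x * partialDeriv i (partialDeriv j u) x ^ 2 =
      ∫ x, ζ x * partialDeriv i (partialDeriv j u) x * partialDeriv i (partialDeriv j u) x := by
    congr 1 with x
    ring
  rw [e3, e1]
  simp only [add_mul]
  rw [integral_add i2 i4, integral_add i3' i4]
  have e4 : ∫ x, partialDeriv i ζ x * partialDeriv j u x * partialDeriv i (partialDeriv j u) x =
      ∫ x, partialDeriv i ζ x * partialDeriv i (partialDeriv j u) x * partialDeriv j u x := by
    congr 1 with x
    ring
  rw [e4]
  ring

/-- Caccioppoli type estimate: a bound on the gradient and on the Laplacian controls the second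
derivatives in `L²_loc`. -/
lemma exists_integral_sq_partialDeriv_le {χ : E3 → ℝ} (hχ : ContDiff ℝ ∞ χ)
    (hc : HasCompactSupport χ) : ∃ C : ℝ, ∀ (u : E3 → ℝ) (A : ℝ), ContDiff ℝ ∞ u →
      (∀ j x, |partialDeriv j u x| ≤ A) → (∀ x, |∑ i, partialDeriv i (partialDeriv i u) x| ≤ A) →
      ∫ x, χ x ^ 2 * ∑ i, ∑ j, partialDeriv i (partialDeriv j u) x ^ 2 ≤ C * A ^ 2 := by
  set K : E3 → ℝ := fun x => χ x ^ 2 + 2 * ∑ j, |χ x| * |partialDeriv j χ x| +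
    6 * ∑ i, partialDeriv i χ x ^ 2 with hK
  refine ⟨2 * ∫ x, K x, fun u A hu h1 h2 => ?_⟩
  have s1 := contDiff_partialDeriv hu
  have s2 := fun i j => contDiff_partialDeriv (s1 j) i
  have hχ1 := contDiff_partialDeriv hχ
  have hc1 : ∀ i, HasCompactSupport (partialDeriv i χ) := fun i =>
    hc.fderiv_apply (𝕜 := ℝ) (stdVec i)
  have hζ : ContDiff ℝ ∞ (fun x => χ x ^ 2) := hχ.pow 2
  have hcζ : HasCompactSupport (fun x => χ x ^ 2) := by
    simp only [pow_two]
    exact hc.mul_right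
  have hζ1 : ∀ i x, partialDeriv i (fun x => χ x ^ 2) x = 2 * χ x * partialDeriv i χ x := by
    intro i x
    have := partialDeriv_mul hχ hχ i x
    simp only [← pow_two] at this
    rw [this]
    ring
  have hcK : HasCompactSupport K := by
    refine HasCompactSupport.intro hc (K := tsupport χ) fun x hx => ?_
    have e1 : χ x = 0 := image_eq_zero_of_notMem_tsupport hx
    have e2 : ∀ i, partialDeriv i χ x = 0 := fun i => by
      have : fderiv ℝ χ x = 0 := by
        by_contra h
        exact hx (support_fderiv_subset ℝ h)
      simp [partialDeriv, this]
    simp [hK, e1, e2]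
  have c0 := hχ.continuous
  have c1 := fun i => (hχ1 i).continuous
  have c2 := fun i => (s1 i).continuous
  have c3 := fun i j => (s2 i j).continuous
  have iK : Integrable K := by
    refine Continuous.integrable_of_hasCompactSupport ?_ hcK
    fun_prop
  have iij : ∀ i j, Integrable fun x => χ x ^ 2 * partialDeriv i (partialDeriv j u) x ^ 2 :=
    fun i j => Continuous.integrable_of_hasCompactSupport (by fun_prop) hcζ.mul_right
  have iI : Integrable fun x => χ x ^ 2 * ∑ i, ∑ j, partialDeriv i (partialDeriv j u) x ^ 2 :=
    Continuous.integrable_of_hasCompactSupport (by fun_prop) hcζ.mul_right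
  set P : Fin 3 → Fin 3 → E3 → ℝ := fun i j x =>
    (χ x ^ 2 * partialDeriv i (partialDeriv i u) x * partialDeriv j (partialDeriv j u) x +
        2 * χ x * partialDeriv j χ x * partialDeriv i (partialDeriv i u) x * partialDeriv j u x -
        2 * χ x * partialDeriv i χ x * partialDeriv j u x * partialDeriv i (partialDeriv j u) x)
    with hP
  have hPc : ∀ i j, Integrable (P i j) := fun i j => by
    refine Continuous.integrable_of_hasCompactSupport (by fun_prop) ?_
    refine HasCompactSupport.intro hc (K := tsupport χ) fun x hx => ?_
    simp [hP, image_eq_zero_of_notMem_tsupport hx]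
  have hid : ∫ x, χ x ^ 2 * ∑ i, ∑ j, partialDeriv i (partialDeriv j u) x ^ 2 =
      ∫ x, ∑ i, ∑ j, P i j x := by
    simp only [Finset.mul_sum]
    rw [integral_finsetSum _ fun i _ => integrable_finsetSum _ fun j _ => iij i j,
      integral_finsetSum _ fun i _ => integrable_finsetSum _ fun j _ => hPc i j]
    refine Finset.sum_congr rfl fun i _ => ?_
    rw [integral_finsetSum _ fun j _ => iij i j, integral_finsetSum _ fun j _ => hPc i j]
    refine Finset.sum_congr rfl fun j _ => ?_
    rw [integral_mul_sq_partialDeriv hζ hcζ hu i j]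
    simp only [hζ1, hP]
  have hpt : ∀ x, ∑ i, ∑ j, P i j x ≤ A ^ 2 * K x +
      (1 / 2) * (χ x ^ 2 * ∑ i, ∑ j, partialDeriv i (partialDeriv j u) x ^ 2) := by
    intro x
    have hA : 0 ≤ A := (abs_nonneg _).trans (h2 x)
    set L := ∑ i, partialDeriv i (partialDeriv i u) x with hL
    have t1 : ∑ i, ∑ j, P i j x = χ x ^ 2 * L ^ 2 +
        ∑ j, 2 * χ x * partialDeriv j χ x * partialDeriv j u x * L -
        ∑ i, ∑ j, 2 * χ x * partialDeriv i χ x * partialDeriv j u x *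
          partialDeriv i (partialDeriv j u) x := by
      simp only [hP, hL, Fin.sum_univ_three]
      ring
    have hL2 : L ^ 2 ≤ A ^ 2 := by
      rw [← sq_abs]
      exact pow_le_pow_left₀ (abs_nonneg _) (h2 x) 2
    have hu2 : ∀ j, partialDeriv j u x ^ 2 ≤ A ^ 2 := fun j => by
      rw [← sq_abs]
      exact pow_le_pow_left₀ (abs_nonneg _) (h1 j x) 2
    have t2 : ∑ j, 2 * χ x * partialDeriv j χ x * partialDeriv j u x * L ≤
        A ^ 2 * (2 * ∑ j, |χ x| * |partialDeriv j χ x|) := by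
      rw [Finset.mul_sum, Finset.mul_sum]
      refine Finset.sum_le_sum fun j _ => (le_abs_self _).trans ?_
      rw [abs_mul, abs_mul, abs_mul, abs_mul, abs_two]
      calc 2 * |χ x| * |partialDeriv j χ x| * |partialDeriv j u x| * |L|
          ≤ 2 * |χ x| * |partialDeriv j χ x| * A * A := by
            gcongr
            · exact h1 j x
            · exact h2 x
        _ = _ := by ring
    have t3 : -∑ i, ∑ j, 2 * χ x * partialDeriv i χ x * partialDeriv j u x *
          partialDeriv i (partialDeriv j u) x ≤
        ∑ i, ∑ j : Fin 3, ((1 / 2) * (χ x ^ 2 * partialDeriv i (partialDeriv j u) x ^ 2) +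
          2 * A ^ 2 * partialDeriv i χ x ^ 2) := by
      rw [← Finset.sum_neg_distrib]
      refine Finset.sum_le_sum fun i _ => ?_
      rw [← Finset.sum_neg_distrib]
      refine Finset.sum_le_sum fun j _ => ?_
      have := mul_le_mul_of_nonneg_right (hu2 j) (sq_nonneg (partialDeriv i χ x))
      nlinarith [sq_nonneg (χ x * partialDeriv i (partialDeriv j u) x +
        2 * partialDeriv i χ x * partialDeriv j u x)]
    have t4 : ∑ i, ∑ j : Fin 3, ((1 / 2) * (χ x ^ 2 * partialDeriv i (partialDeriv j u) x ^ 2) +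
          2 * A ^ 2 * partialDeriv i χ x ^ 2) =
        (1 / 2) * (χ x ^ 2 * ∑ i, ∑ j, partialDeriv i (partialDeriv j u) x ^ 2) +
          A ^ 2 * (6 * ∑ i, partialDeriv i χ x ^ 2) := by
      simp only [Fin.sum_univ_three]
      ring
    have t5 := mul_le_mul_of_nonneg_left hL2 (sq_nonneg (χ x))
    have t6 : A ^ 2 * K x = χ x ^ 2 * A ^ 2 + A ^ 2 * (2 * ∑ j, |χ x| * |partialDeriv j χ x|) +
        A ^ 2 * (6 * ∑ i, partialDeriv i χ x ^ 2) := by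
      simp only [hK]
      ring
    linarith
  have hfin : ∫ x, ∑ i, ∑ j, P i j x ≤ ∫ x, (A ^ 2 * K x +
      (1 / 2) * (χ x ^ 2 * ∑ i, ∑ j, partialDeriv i (partialDeriv j u) x ^ 2)) :=
    integral_mono (integrable_finsetSum _ fun i _ => integrable_finsetSum _ fun j _ => hPc i j)
      ((iK.const_mul _).add (iI.const_mul _)) hpt
  rw [integral_add (iK.const_mul _) (iI.const_mul _), integral_const_mul, integral_const_mul,
    ← hid] at hfin
  linarith

/-! ### Mollification and approximation of second derivatives -/

/-- Convolution of a function on `ℝ³` with a normalised smooth bump. -/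
noncomputable def mollify {W : Type*} [NormedAddCommGroup W] [NormedSpace ℝ W]
    (η : ContDiffBump (0 : E3)) (g : E3 → W) : E3 → W :=
  η.normed volume ⋆[ContinuousLinearMap.lsmul ℝ ℝ, volume] g

section Mollify

variable {W : Type*} [NormedAddCommGroup W] [NormedSpace ℝ W] (η : ContDiffBump (0 : E3))

lemma mollify_apply (g : E3 → W) (x : E3) :
    mollify η g x = ∫ y, η.normed volume y • g (x - y) := rfl

lemma integrable_mollify_kernel {g : E3 → W} (hg : Continuous g) (x : E3) :
    Integrable fun y => η.normed volume y • g (x - y) := by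
  refine Continuous.integrable_of_hasCompactSupport ?_ (η.hasCompactSupport_normed.smul_right)
  have := η.continuous_normed (μ := (volume : Measure E3))
  fun_prop

lemma hasFDerivAt_mollify [CompleteSpace W] {g : E3 → W} (hg : ContDiff ℝ 1 g) {B : ℝ}
    (hB : ∀ x, ‖fderiv ℝ g x‖ ≤ B) (x : E3) :
    HasFDerivAt (mollify η g) (mollify η (fderiv ℝ g) x) x := by
  have hcη := η.continuous_normed (μ := (volume : Measure E3))
  have hg1 : Continuous (fderiv ℝ g) := hg.continuous_fderiv (by norm_num)
  refine hasFDerivAt_integral_of_dominated_of_fderiv_le (s := univ)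
    (bound := fun y => η.normed volume y * B)
    (F := fun x y => η.normed volume y • g (x - y))
    (F' := fun x y => η.normed volume y • fderiv ℝ g (x - y)) univ_mem ?_ ?_ ?_ ?_ ?_ ?_
  · exact Eventually.of_forall fun z =>
      (integrable_mollify_kernel η hg.continuous z).aestronglyMeasurable
  · exact integrable_mollify_kernel η hg.continuous x
  · exact (integrable_mollify_kernel η hg1 x).aestronglyMeasurable
  · refine Eventually.of_forall fun y z _ => ?_
    rw [norm_smul, Real.norm_of_nonneg (η.nonneg_normed y)]
    exact mul_le_mul_of_nonneg_left (hB _) (η.nonneg_normed y)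
  · exact η.integrable_normed.mul_const B
  · refine Eventually.of_forall fun y z _ => ?_
    have : HasFDerivAt (fun z => g (z - y)) (fderiv ℝ g (z - y)) z :=
      (hasFDerivAt_comp_sub (f := g) y).2 (hg.differentiable (by norm_num) _).hasFDerivAt
    exact this.const_smul _

lemma norm_mollify_sub_le {g : E3 → W} (hg : Continuous g) {a : E3} {B : ℝ}
    (hB : ∀ x, ‖g (x + a) - g x‖ ≤ B) (x : E3) :
    ‖mollify η g (x + a) - mollify η g x‖ ≤ B := by
  rw [mollify_apply, mollify_apply, ← integral_sub (integrable_mollify_kernel η hg _)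
    (integrable_mollify_kernel η hg _)]
  have : ∫ y, η.normed volume y * B = B := by
    rw [integral_mul_const, η.integral_normed, one_mul]
  rw [← this]
  refine norm_integral_le_of_norm_le (η.integrable_normed.mul_const B) (Eventually.of_forall fun y => ?_)
  rw [← smul_sub, norm_smul, Real.norm_of_nonneg (η.nonneg_normed y)]
  refine mul_le_mul_of_nonneg_left ?_ (η.nonneg_normed y)
  rw [show x + a - y = x - y + a by abel]
  exact hB _

lemma norm_mollify_le {g : E3 → W} {B : ℝ} (hB : ∀ x, ‖g x‖ ≤ B) (x : E3) :
    ‖mollify η g x‖ ≤ B := by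
  have : ∫ y, η.normed volume y * B = B := by
    rw [integral_mul_const, η.integral_normed, one_mul]
  rw [← this]
  refine norm_integral_le_of_norm_le (η.integrable_normed.mul_const B) (Eventually.of_forall fun y => ?_)
  rw [ContinuousLinearMap.lsmul_apply, norm_smul, Real.norm_of_nonneg (η.nonneg_normed y)]
  exact mul_le_mul_of_nonneg_left (hB _) (η.nonneg_normed y)

lemma contDiff_mollify {g : E3 → W} (hg : Continuous g) : ContDiff ℝ ∞ (mollify η g) := by
  refine HasCompactSupport.contDiff_convolution_left (n := ⊤) _ η.hasCompactSupport_normed ?_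
    hg.locallyIntegrable
  exact η.contDiff_normed

end Mollify

lemma lintegral_closedBall_translate (H : E3 → ℝ≥0∞) (y : E3) (r : ℝ) :
    ∫⁻ x in Metric.closedBall y r, H x = ∫⁻ x in Metric.closedBall 0 r, H (x + y) := by
  rw [← lintegral_indicator Metric.isClosed_closedBall.measurableSet,
    ← lintegral_indicator Metric.isClosed_closedBall.measurableSet,
    ← lintegral_add_right_eq_self _ y]
  congr 1 with x
  simp [indicator, Metric.mem_closedBall, dist_eq_norm]

lemma norm_sq_le_sum_stdVec (l : E3 →L[ℝ] ℝ) : ‖l‖ ^ 2 ≤ 3 * ∑ i, l (stdVec i) ^ 2 := by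
  have h := sq_sum_le_card_mul_sum_sq (s := (Finset.univ : Finset (Fin 3)))
    (f := fun i => ‖l (stdVec i)‖)
  simp only [Real.norm_eq_abs, sq_abs, Finset.card_univ, Fintype.card_fin] at h
  exact (pow_le_pow_left₀ (norm_nonneg _) (norm_le_of_stdVec l) 2).trans (by exact_mod_cast h)

lemma partialDeriv_comp_add (i : Fin 3) (u : E3 → ℝ) (y : E3) :
    partialDeriv i (fun x => u (x + y)) = fun x => partialDeriv i u (x + y) := by
  ext x
  simp [partialDeriv, fderiv_comp_add_right]

/-- Each second derivative of a function with bounded first and second derivatives and Lipschitz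
Laplacian is a pointwise limit of `C¹` functions whose derivatives are bounded in `L²` uniformly
on balls of a given radius. -/
lemma exists_hessian_approx (r A : ℝ) : ∃ C : ℝ, ∀ φ : E3 → ℝ, ContDiff ℝ 2 φ →
    (∀ x, ‖fderiv ℝ φ x‖ ≤ A) → (∀ x, ‖fderiv ℝ (fderiv ℝ φ) x‖ ≤ A) →
    (∀ x y, |Laplacian.laplacian φ x - Laplacian.laplacian φ y| ≤ A * ‖x - y‖) →
    ∀ i k : Fin 3, ∃ g : ℕ → E3 → ℝ, (∀ n, ContDiff ℝ 1 (g n)) ∧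
      (∀ x, Tendsto (fun n => g n x) atTop (𝓝 (fderiv ℝ (fderiv ℝ φ) x (stdVec i) (stdVec k)))) ∧
      ∀ n y, ∫⁻ x in Metric.closedBall y r, ‖fderiv ℝ (g n) x‖ₑ ^ 2 ≤ ENNReal.ofReal C := by
  obtain ⟨χ, hχ1, hχs, hχc, hχ⟩ : ∃ χ : E3 → ℝ, (∀ x ∈ Metric.closedBall (0 : E3) r, χ x = 1) ∧
      (∀ x, 0 ≤ χ x) ∧ HasCompactSupport χ ∧ ContDiff ℝ ∞ χ := by
    let b : ContDiffBump (0 : E3) := ⟨|r| + 1, |r| + 2, by positivity, by linarith⟩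
    refine ⟨b, fun x hx => b.one_of_mem_closedBall ?_, fun x => b.nonneg, b.hasCompactSupport,
      b.contDiff⟩
    exact Metric.closedBall_subset_closedBall (by change r ≤ |r| + 1; linarith [le_abs_self r]) hx
  -- one cutoff `χ` suffices: balls with other centres are reduced to it by translation
  obtain ⟨C, hC⟩ := exists_integral_sq_partialDeriv_le hχ hχc
  refine ⟨3 * (C * A ^ 2), fun φ hφ h1 h2 hL i k => ?_⟩
  let η : ℕ → ContDiffBump (0 : E3) := fun n =>
    ⟨1 / ((n : ℝ) + 1), 2 / ((n : ℝ) + 1), by positivity, by gcongr; norm_num⟩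
  have hη : Tendsto (fun n => (η n).rOut) atTop (𝓝 0) := by
    have := (tendsto_one_div_add_atTop_nhds_zero_nat (𝕜 := ℝ)).const_mul 2
    rw [mul_zero] at this
    refine this.congr fun n => ?_
    simp only [η]
    ring
  have hφ1 : ContDiff ℝ 1 φ := hφ.of_le (by norm_num)
  have hφ' : ContDiff ℝ 1 (fderiv ℝ φ) := hφ.fderiv_right (m := 1) (by norm_num)
  have hφ'' : Continuous (fderiv ℝ (fderiv ℝ φ)) := hφ'.continuous_fderiv (by norm_num)
  have hs : ∀ n, ContDiff ℝ ∞ (mollify (η n) φ) := fun n => contDiff_mollify _ hφ.continuous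
  have hD : ∀ n, fderiv ℝ (mollify (η n) φ) = mollify (η n) (fderiv ℝ φ) := fun n =>
    funext fun x => (hasFDerivAt_mollify (η n) hφ1 h1 x).fderiv
  have hDD : ∀ n, fderiv ℝ (fderiv ℝ (mollify (η n) φ)) = mollify (η n) (fderiv ℝ (fderiv ℝ φ)) :=
    fun n => by
      rw [hD]
      exact funext fun x => (hasFDerivAt_mollify (η n) hφ' h2 x).fderiv
  have hlapC : Continuous (Laplacian.laplacian φ) := by
    have : Laplacian.laplacian φ = fun y => ∑ j, fderiv ℝ (fderiv ℝ φ) y (stdVec j) (stdVec j) :=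
      funext fun y => laplacian_eq_sum_fderiv φ y
    rw [this]
    fun_prop
  have hlap : ∀ n, (fun x => ∑ i, partialDeriv i (partialDeriv i (mollify (η n) φ)) x) =
      mollify (η n) (Laplacian.laplacian φ) := by
    intro n
    ext x
    have hi := integrable_mollify_kernel (W := E3 →L[ℝ] E3 →L[ℝ] ℝ) (η n) hφ'' x
    have e : ∀ i, partialDeriv i (partialDeriv i (mollify (η n) φ)) x =
        ∫ y, (η n).normed volume y * fderiv ℝ (fderiv ℝ φ) (x - y) (stdVec i) (stdVec i) := by
      intro i
      rw [partialDeriv_partialDeriv (contDiff_infty.1 (hs n) 2), hDD, mollify_apply,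
        ContinuousLinearMap.integral_apply hi, ContinuousLinearMap.integral_apply (hi.apply_continuousLinearMap _)]
      simp
    simp only [e]
    rw [mollify_apply, ← integral_finsetSum]
    · congr 1 with y
      rw [laplacian_eq_sum_fderiv, smul_eq_mul, Finset.mul_sum]
    · intro i _
      simpa using (hi.apply_continuousLinearMap (stdVec i)).apply_continuousLinearMap (stdVec i)
  have hA : 0 ≤ A := (norm_nonneg _).trans (h1 0)
  refine ⟨fun n => partialDeriv i (partialDeriv k (mollify (η n) φ)), fun n => ?_, fun x => ?_,
    fun n y => ?_⟩
  · exact (contDiff_partialDeriv (contDiff_partialDeriv (hs n) k) i).of_le (by simp)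
  · simp only [partialDeriv_partialDeriv (contDiff_infty.1 (hs _) 2), hDD]
    have := ContDiffBump.convolution_tendsto_right_of_continuous (E' := E3 →L[ℝ] E3 →L[ℝ] ℝ)
      (μ := volume) hη hφ'' x
    exact ((continuous_eval_const (F := E3 →L[ℝ] ℝ) (stdVec k)).tendsto _).comp
      (((continuous_eval_const (F := E3 →L[ℝ] E3 →L[ℝ] ℝ) (stdVec i)).tendsto _).comp this)
  · rw [lintegral_closedBall_translate]
    -- `∂ₖ` of the mollified function, translated to the origin, has bounded gradient and
    -- bounded Laplacian
    set u : E3 → ℝ := fun x => partialDeriv k (mollify (η n) φ) (x + y) with hu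
    have hus : ContDiff ℝ ∞ u :=
      (contDiff_partialDeriv (hs n) k).comp (contDiff_id.add contDiff_const)
    have hu1 : ∀ j x, |partialDeriv j u x| ≤ A := by
      intro j x
      simp only [hu]
      rw [partialDeriv_comp_add]
      simp only
      rw [partialDeriv_partialDeriv (contDiff_infty.1 (hs n) 2), hDD, ← Real.norm_eq_abs]
      refine (ContinuousLinearMap.le_opNorm₂ _ _ _).trans ?_
      simp only [PiLp.norm_single, norm_one, mul_one]
      exact norm_mollify_le (W := E3 →L[ℝ] E3 →L[ℝ] ℝ) _ h2 _
    have hu2 : ∀ x, |∑ i, partialDeriv i (partialDeriv i u) x| ≤ A := by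
      intro x
      have e : ∑ i, partialDeriv i (partialDeriv i u) x =
          partialDeriv k (mollify (η n) (Laplacian.laplacian φ)) (x + y) := by
        rw [← hlap, partialDeriv_sum _ fun i => contDiff_partialDeriv (contDiff_partialDeriv (hs n) i) i]
        refine Finset.sum_congr rfl fun i _ => ?_
        simp only [hu, partialDeriv_comp_add]
        rw [partialDeriv_comm (hs n) i k, partialDeriv_comm (contDiff_partialDeriv (hs n) i) i k]
      rw [e, ← Real.norm_eq_abs]
      unfold partialDeriv
      refine (ContinuousLinearMap.le_opNorm _ _).trans ?_
      simp only [PiLp.norm_single, norm_one, mul_one]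
      refine norm_fderiv_le_of_lipschitz ℝ (C := ⟨A, hA⟩) (LipschitzWith.of_dist_le_mul fun a b => ?_)
      rw [dist_eq_norm, dist_eq_norm]
      have := norm_mollify_sub_le (η n) hlapC (a := a - b) (B := A * ‖a - b‖) (fun z => by
        rw [Real.norm_eq_abs]
        exact (hL _ _).trans (by rw [add_sub_cancel_left])) b
      rwa [add_sub_cancel] at this
    have hen := hC u A hus hu1 hu2
    have hint : Integrable fun x => 3 * (χ x ^ 2 *
        ∑ l, ∑ j, partialDeriv l (partialDeriv j u) x ^ 2) := by
      have c := fun i j => (contDiff_partialDeriv (contDiff_partialDeriv hus j) i).continuous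
      have cχ := hχ.continuous
      refine Continuous.integrable_of_hasCompactSupport (by fun_prop) ?_
      refine HasCompactSupport.intro hχc (K := tsupport χ) fun x hx => ?_
      simp [image_eq_zero_of_notMem_tsupport hx]
    have hpt : ∀ x ∈ Metric.closedBall (0 : E3) r,
        ‖fderiv ℝ (partialDeriv i (partialDeriv k (mollify (η n) φ))) (x + y)‖ₑ ^ 2 ≤
        ENNReal.ofReal (3 * (χ x ^ 2 * ∑ l, ∑ j, partialDeriv l (partialDeriv j u) x ^ 2)) := by
      intro x hx
      rw [← ofReal_norm, ← ENNReal.ofReal_pow (norm_nonneg _)]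
      refine ENNReal.ofReal_le_ofReal ((norm_sq_le_sum_stdVec _).trans ?_)
      rw [hχ1 x hx, one_pow, one_mul]
      gcongr with l _
      refine le_trans (le_of_eq ?_) (Finset.single_le_sum (fun j _ => sq_nonneg
        (partialDeriv l (partialDeriv j u) x)) (Finset.mem_univ i))
      simp only [hu, partialDeriv_comp_add]
      rfl
    calc ∫⁻ x in Metric.closedBall 0 r,
          ‖fderiv ℝ (partialDeriv i (partialDeriv k (mollify (η n) φ))) (x + y)‖ₑ ^ 2
        ≤ ∫⁻ x in Metric.closedBall 0 r, ENNReal.ofReal (3 * (χ x ^ 2 *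
          ∑ l, ∑ j, partialDeriv l (partialDeriv j u) x ^ 2)) :=
          setLIntegral_mono' Metric.isClosed_closedBall.measurableSet hpt
      _ ≤ ∫⁻ x, ENNReal.ofReal (3 * (χ x ^ 2 *
          ∑ l, ∑ j, partialDeriv l (partialDeriv j u) x ^ 2)) := setLIntegral_le_lintegral _ _
      _ = ENNReal.ofReal (∫ x, 3 * (χ x ^ 2 *
          ∑ l, ∑ j, partialDeriv l (partialDeriv j u) x ^ 2)) :=
          (ofReal_integral_eq_lintegral_ofReal hint (Eventually.of_forall fun x => by positivity)).symm
      _ ≤ ENNReal.ofReal (3 * (C * A ^ 2)) := by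
          refine ENNReal.ofReal_le_ofReal ?_
          rw [integral_const_mul]
          linarith

/-! ### Grönwall's inequality -/

/-- Grönwall's inequality in integral form, forward in time. -/
lemma gronwall_integral_forward {u : ℝ → ℝ} (hu : Continuous u) {a L t b : ℝ} (hL : 0 ≤ L)
    (h : ∀ τ ∈ Icc t b, u τ ≤ a + L * ∫ s in t..τ, u s) :
    ∀ τ ∈ Icc t b, u τ ≤ a * Real.exp (L * (τ - t)) := by
  intro τ hτ
  set w : ℝ → ℝ := fun r => Real.exp (-L * (r - t)) * (a + L * ∫ s in t..r, u s) with hw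
  have hd : ∀ r, HasDerivAt w (Real.exp (-L * (r - t)) * (-L) * (a + L * ∫ s in t..r, u s) +
      Real.exp (-L * (r - t)) * (L * u r)) r := by
    intro r
    have h1 : HasDerivAt (fun r => Real.exp (-L * (r - t))) (Real.exp (-L * (r - t)) * (-L)) r := by
      simpa using (((hasDerivAt_id r).sub_const t).const_mul (-L)).exp
    have h2 : HasDerivAt (fun r => ∫ s in t..r, u s) (u r) r :=
      intervalIntegral.integral_hasDerivAt_right (hu.intervalIntegrable _ _)
        hu.aestronglyMeasurable.stronglyMeasurableAtFilter hu.continuousAt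
    exact h1.mul ((h2.const_mul L).const_add a)
  have hanti : AntitoneOn w (Icc t b) := by
    refine antitoneOn_of_deriv_nonpos (convex_Icc t b)
      (fun r _ => (hd r).continuousAt.continuousWithinAt)
      (fun r _ => (hd r).differentiableAt.differentiableWithinAt) fun r hr => ?_
    rw [(hd r).deriv]
    have := h r (interior_subset hr)
    have h3 := mul_nonneg (mul_nonneg (Real.exp_pos (-L * (r - t))).le hL) (sub_nonneg.2 this)
    nlinarith
  have h1 := hanti ⟨le_rfl, hτ.1.trans hτ.2⟩ hτ hτ.1
  have h2 : w t = a := by simp [hw]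
  rw [h2] at h1
  have h3 : Real.exp (-L * (τ - t)) * Real.exp (L * (τ - t)) = 1 := by
    rw [← Real.exp_add]
    simp
  calc u τ ≤ a + L * ∫ s in t..τ, u s := h τ hτ
    _ = w τ * Real.exp (L * (τ - t)) := by
        simp only [hw]
        rw [mul_right_comm, h3, one_mul]
    _ ≤ a * Real.exp (L * (τ - t)) := by gcongr

/-- Grönwall's inequality in integral form, on both sides of the initial time. -/
lemma gronwall_integral {u : ℝ → ℝ} {T a L t : ℝ} (ht : t ∈ Icc 0 T) (hu : ContinuousOn u (Icc 0 T))
    (hu0 : ∀ τ ∈ Icc 0 T, 0 ≤ u τ) (hL : 0 ≤ L)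
    (h : ∀ τ ∈ Icc 0 T, u τ ≤ a + L * |∫ s in t..τ, u s|) :
    ∀ τ ∈ Icc 0 T, u τ ≤ a * Real.exp (L * |τ - t|) := by
  have hT : 0 ≤ T := ht.1.trans ht.2
  set v : ℝ → ℝ := IccExtend hT ((Icc 0 T).domRestrict u) with hv
  have hvc : Continuous v := (continuousOn_iff_continuous_domRestrict.1 hu).Icc_extend'
  have hve : ∀ τ ∈ Icc 0 T, v τ = u τ := fun τ hτ => by
    rw [hv, IccExtend_of_mem _ _ hτ]
    rfl
  have hint : ∀ τ ∈ Icc 0 T, ∫ s in t..τ, u s = ∫ s in t..τ, v s := fun τ hτ =>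
    intervalIntegral.integral_congr fun s hs => (hve s (uIcc_subset_Icc ht hτ hs)).symm
  have hv0 : ∀ τ ∈ Icc 0 T, 0 ≤ v τ := fun τ hτ => by rw [hve τ hτ]; exact hu0 τ hτ
  intro τ hτ
  rcases le_total t τ with htτ | hτt
  · have := gronwall_integral_forward hvc (a := a) (t := t) (b := T) hL (fun r hr => by
      have hr' : r ∈ Icc 0 T := ⟨ht.1.trans hr.1, hr.2⟩
      have := h r hr'
      rwa [hint r hr', abs_of_nonneg (intervalIntegral.integral_nonneg hr.1 fun s hs =>
        hv0 s ⟨ht.1.trans hs.1, hs.2.trans hr.2⟩), ← hve r hr'] at this) τ ⟨htτ, hτ.2⟩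
    rwa [hve τ hτ, ← abs_of_nonneg (sub_nonneg.2 htτ)] at this
  · have := gronwall_integral_forward (u := fun s => v (2 * t - s)) (by fun_prop) (a := a) (t := t)
      (b := 2 * t) hL (fun r hr => by
      have hr' : 2 * t - r ∈ Icc 0 T := ⟨by linarith [hr.2], by linarith [hr.1, ht.2]⟩
      have := h _ hr'
      rw [hint _ hr', ← hve _ hr', intervalIntegral.integral_symm, abs_neg, abs_of_nonneg
        (intervalIntegral.integral_nonneg (by linarith [hr.1]) fun s hs =>
          hv0 s ⟨hr'.1.trans hs.1, hs.2.trans ht.2⟩)] at this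
      rw [intervalIntegral.integral_comp_sub_left (fun s => v s)]
      rwa [show 2 * t - t = t by ring]) (2 * t - τ) ⟨by linarith, by linarith [hτ.1]⟩
    rwa [show 2 * t - (2 * t - τ) = τ by ring, show 2 * t - τ - t = |τ - t| by
      rw [abs_of_nonpos (by linarith)]; ring, hve τ hτ] at this

/-- Grönwall's inequality for an integral equation with inhomogeneity `r`, in both time directions. -/
lemma norm_le_of_eq_add_integral {E : Type*} [NormedAddCommGroup E] [NormedSpace ℝ E]
    {T L t : ℝ} (ht : t ∈ Icc 0 T) {y f : ℝ → E} {y₀ : E} {r : ℝ → ℝ}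
    (hy : ContinuousOn y (Icc 0 T)) (hL : 0 ≤ L)
    (heq : ∀ τ ∈ Icc 0 T, y τ = y₀ + ∫ s in t..τ, f s)
    (hf : ∀ s ∈ Icc 0 T, ‖f s‖ ≤ L * ‖y s‖ + r s)
    (hr : IntegrableOn r (Icc 0 T)) (hr0 : ∀ s ∈ Icc 0 T, 0 ≤ r s) :
    ∀ τ ∈ Icc 0 T, ‖y τ‖ ≤ (‖y₀‖ + ∫ s in Icc 0 T, r s) * Real.exp (L * |τ - t|) := by
  refine gronwall_integral ht hy.norm (fun _ _ => norm_nonneg _) hL fun τ hτ => ?_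
  have hsub : uIcc t τ ⊆ Icc 0 T := uIcc_subset_Icc ht hτ
  have i1 : IntervalIntegrable (fun s => L * ‖y s‖) volume t τ :=
    (continuousOn_const.mul (hy.norm.mono hsub)).intervalIntegrable
  have i2 : IntervalIntegrable r volume t τ := (hr.mono_set hsub).intervalIntegrable
  have h1 : ‖∫ s in t..τ, f s‖ ≤ |∫ s in t..τ, (L * ‖y s‖ + r s)| := by
    refine intervalIntegral.norm_integral_le_abs_of_norm_le ?_ (i1.add i2)
    exact (ae_restrict_mem measurableSet_uIoc).mono fun s hs => hf s (hsub (uIoc_subset_uIcc hs))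
  have h2 : |∫ s in t..τ, r s| ≤ ∫ s in Icc 0 T, r s := by
    rw [intervalIntegral.abs_integral_eq_abs_integral_uIoc, abs_of_nonneg
      (setIntegral_nonneg measurableSet_uIoc fun s hs => hr0 s (hsub (uIoc_subset_uIcc hs)))]
    exact setIntegral_mono_set hr ((ae_restrict_mem measurableSet_Icc).mono fun s hs => hr0 s hs)
      (uIoc_subset_uIcc.trans hsub).eventuallyLE
  rw [intervalIntegral.integral_add i1 i2, intervalIntegral.integral_const_mul] at h1
  have h3 := abs_add_le (L * ∫ s in t..τ, ‖y s‖) (∫ s in t..τ, r s)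
  rw [abs_mul, abs_of_nonneg hL] at h3
  calc ‖y τ‖ ≤ ‖y₀‖ + ‖∫ s in t..τ, f s‖ := by
        rw [heq τ hτ]
        exact norm_add_le _ _
    _ ≤ _ := by linarith

/-! ### Carathéodory functions -/

/-- A function that is measurable in the first variable and continuous in the second one agrees, for
almost every value of the first variable, with a jointly measurable function. -/
lemma exists_stronglyMeasurable_uncurry {S E F : Type*} [MeasurableSpace S] {μ : Measure S}
    [NormedAddCommGroup E] [MeasurableSpace E] [BorelSpace E] [SecondCountableTopology E]
    [NormedAddCommGroup F] {g : S → E → F}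
    (hc : ∀ᵐ s ∂μ, Continuous (g s)) (hm : ∀ z, AEStronglyMeasurable (fun s => g s z) μ) :
    ∃ g' : S → E → F, StronglyMeasurable (Function.uncurry g') ∧ ∀ᵐ s ∂μ, ∀ z, g s z = g' s z := by
  classical
  set d := TopologicalSpace.denseSeq E with hd
  have hae : ∀ᵐ s ∂μ, Continuous (g s) ∧ ∀ n, g s (d n) = (hm (d n)).mk _ s :=
    hc.and (ae_all_iff.2 fun n => (hm (d n)).ae_eq_mk)
  set N := toMeasurable μ {s | ¬ (Continuous (g s) ∧ ∀ n, g s (d n) = (hm (d n)).mk _ s)} with hN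
  have hNm : MeasurableSet N := measurableSet_toMeasurable _ _
  have hN0 : μ N = 0 := by
    rw [hN, measure_toMeasurable]
    exact hae
  have hgood : ∀ s ∉ N, Continuous (g s) ∧ ∀ n, g s (d n) = (hm (d n)).mk _ s := by
    intro s hs
    by_contra h
    exact hs (subset_toMeasurable _ _ h)
  refine ⟨fun s z => if s ∈ N then 0 else g s z, ?_, ?_⟩
  · have hdm : ∀ n, StronglyMeasurable fun s => if s ∈ N then 0 else g s (d n) := by
      intro n
      have : (fun s => if s ∈ N then 0 else g s (d n)) =
          fun s => if s ∈ N then 0 else (hm (d n)).mk _ s := by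
        ext s
        split_ifs with h
        · rfl
        · exact (hgood s h).2 n
      rw [this]
      exact StronglyMeasurable.ite hNm stronglyMeasurable_const (hm (d n)).stronglyMeasurable_mk
    have hcz : ∀ s, Continuous fun z => if s ∈ N then 0 else g s z := by
      intro s
      by_cases h : s ∈ N
      · simp only [h, if_true]
        exact continuous_const
      · simp only [h, if_false]
        exact (hgood s h).1
    have hz : ∀ z, StronglyMeasurable fun s => if s ∈ N then 0 else g s z := by
      intro z
      obtain ⟨k, hk⟩ : ∃ k : ℕ → E, (∀ n, k n ∈ range d) ∧ Tendsto k atTop (𝓝 z) :=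
        mem_closure_iff_seq_limit.1 (TopologicalSpace.denseRange_denseSeq E z)
      refine stronglyMeasurable_of_tendsto atTop (f := fun n s => if s ∈ N then 0 else g s (k n)) ?_ ?_
      · intro n
        obtain ⟨m, hm⟩ := hk.1 n
        rw [← hm]
        exact hdm m
      · exact tendsto_pi_nhds.2 fun s => ((hcz s).tendsto z).comp hk.2
    exact (stronglyMeasurable_uncurry_of_continuous_of_stronglyMeasurable
      (u := fun z s => if s ∈ N then 0 else g s z) hcz hz).comp_measurable measurable_swap
  · have : ∀ᵐ s ∂μ, s ∉ N := measure_eq_zero_iff_ae_notMem.1 hN0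
    filter_upwards [this] with s hs z
    simp [hs]

lemma aestronglyMeasurable_comp_caratheodory {S E F : Type*} [MeasurableSpace S] {μ : Measure S}
    [NormedAddCommGroup E] [MeasurableSpace E] [BorelSpace E] [SecondCountableTopology E]
    [NormedAddCommGroup F] {g : S → E → F}
    (hc : ∀ᵐ s ∂μ, Continuous (g s)) (hm : ∀ z, AEStronglyMeasurable (fun s => g s z) μ)
    {Y : S → E} (hY : AEStronglyMeasurable Y μ) :
    AEStronglyMeasurable (fun s => g s (Y s)) μ := by
  obtain ⟨g', hg', hgg'⟩ := exists_stronglyMeasurable_uncurry hc hm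
  refine ⟨fun s => g' s (hY.mk Y s), hg'.comp_measurable
    (measurable_id.prodMk hY.stronglyMeasurable_mk.measurable), ?_⟩
  filter_upwards [hgg', hY.ae_eq_mk] with s h1 h2
  rw [h1, h2]

lemma aestronglyMeasurable_uncurry_caratheodory {S E F : Type*} [MeasurableSpace S]
    {μ : Measure S} [NormedAddCommGroup E] [MeasurableSpace E] [BorelSpace E]
    [SecondCountableTopology E] [NormedAddCommGroup F] {g : S → E → F} {ν : Measure E} [SFinite ν]
    (hc : ∀ᵐ s ∂μ, Continuous (g s)) (hm : ∀ z, AEStronglyMeasurable (fun s => g s z) μ) :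
    AEStronglyMeasurable (Function.uncurry g) (μ.prod ν) := by
  obtain ⟨g', hg', hgg'⟩ := exists_stronglyMeasurable_uncurry hc hm
  refine ⟨_, hg', ?_⟩
  filter_upwards [Measure.quasiMeasurePreserving_fst.ae hgg'] with p hp using hp p.2

lemma aestronglyMeasurable_clm_of_apply {S E F : Type*} [MeasurableSpace S] {μ : Measure S}
    [NormedAddCommGroup E] [NormedSpace ℝ E] [FiniteDimensional ℝ E]
    [NormedAddCommGroup F] [NormedSpace ℝ F] {l : S → (E →L[ℝ] F)}
    (h : ∀ e, AEStronglyMeasurable (fun s => l s e) μ) : AEStronglyMeasurable l μ := by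
  set b := Module.finBasis ℝ E
  have : l = fun s => ∑ i, (b.coord i).toContinuousLinearMap.smulRight (l s (b i)) := by
    ext s x
    have := congrArg (l s) (b.sum_repr x)
    simp only [map_sum, map_smul] at this
    simpa using this.symm
  rw [this]
  refine Finset.aestronglyMeasurable_fun_sum _ fun i _ => ?_
  exact ((ContinuousLinearMap.smulRightL ℝ E F (b.coord i).toContinuousLinearMap).continuous).comp_aestronglyMeasurable (h (b i))

/-- The derivative in space of a function depending measurably on a parameter depends measurably on
the parameter. -/
lemma aestronglyMeasurable_of_hasFDerivAt {S E F : Type*} [MeasurableSpace S] {μ : Measure S}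
    [NormedAddCommGroup E] [NormedSpace ℝ E] [FiniteDimensional ℝ E]
    [NormedAddCommGroup F] [NormedSpace ℝ F] {g : S → E → F} {g' : S → E →L[ℝ] F} {z : E}
    (hm : ∀ z, AEStronglyMeasurable (fun s => g s z) μ) (hd : ∀ᵐ s ∂μ, HasFDerivAt (g s) (g' s) z) :
    AEStronglyMeasurable g' μ := by
  refine aestronglyMeasurable_clm_of_apply fun e => ?_
  refine aestronglyMeasurable_of_tendsto_ae atTop
    (f := fun (n : ℕ) s => (n : ℝ) • (g s (z + (n : ℝ)⁻¹ • e) - g s z)) ?_ ?_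
  · exact fun n => ((hm _).sub (hm _)).const_smul _
  · filter_upwards [hd] with s hs
    exact hs.lim e (c := fun n : ℕ => (n : ℝ)) (by
      simpa using tendsto_natCast_atTop_atTop (R := ℝ))

/-! ### Differentiability of the flow of a Carathéodory field -/

/-- `Z τ t z` is the flow on `[0,T]` of the field `W`, which is only measurable in time, in
integrated form. In space the field has the derivative `B`, bounded by `L` and Hölder continuous
with exponent `α`. -/
structure IsCaratheodoryFlow {E : Type*} [NormedAddCommGroup E] [NormedSpace ℝ E]
    (T L A α : ℝ) (W : ℝ → E → E) (B : ℝ → E → E →L[ℝ] E) (Z : ℝ → ℝ → E → E) : Prop where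
  L_nonneg : 0 ≤ L
  A_nonneg : 0 ≤ A
  α_pos : 0 < α
  hasFDerivAt : ∀ s ∈ Icc 0 T, ∀ z, HasFDerivAt (W s) (B s z) z
  bound : ∀ s ∈ Icc 0 T, ∀ z, ‖B s z‖ ≤ L
  holder : ∀ s ∈ Icc 0 T, ∀ z z', ‖B s z - B s z'‖ ≤ A * ‖z - z'‖ ^ α
  measurable : ∀ z, AEStronglyMeasurable (fun s => W s z) (volume.restrict (Icc 0 T))
  bound_zero : ∃ A₀, ∀ s ∈ Icc 0 T, ‖W s 0‖ ≤ A₀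
  continuousOn : ∀ t ∈ Icc 0 T, ∀ z, ContinuousOn (fun τ => Z τ t z) (Icc 0 T)
  eq_add_integral : ∀ t ∈ Icc 0 T, ∀ z, ∀ τ ∈ Icc 0 T, Z τ t z = z + ∫ s in t..τ, W s (Z s t z)

namespace IsCaratheodoryFlow

variable {E : Type*} [NormedAddCommGroup E] [NormedSpace ℝ E] [FiniteDimensional ℝ E]
  [MeasurableSpace E] [BorelSpace E] [SecondCountableTopology E] [CompleteSpace E]
  {T L A α : ℝ} {W : ℝ → E → E} {B : ℝ → E → E →L[ℝ] E} {Z : ℝ → ℝ → E → E}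

lemma continuous_field (h : IsCaratheodoryFlow T L A α W B Z) {s : ℝ} (hs : s ∈ Icc 0 T) :
    Continuous (W s) :=
  continuous_iff_continuousAt.2 fun z => (h.hasFDerivAt s hs z).continuousAt

lemma continuous_deriv (h : IsCaratheodoryFlow T L A α W B Z) {s : ℝ} (hs : s ∈ Icc 0 T) :
    Continuous (B s) := by
  refine continuous_iff_continuousAt.2 fun z => ?_
  rw [ContinuousAt, tendsto_iff_norm_sub_tendsto_zero]
  have h1 : Tendsto (fun z' => A * ‖z' - z‖ ^ α) (𝓝 z) (𝓝 0) := by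
    have : Continuous fun z' => A * ‖z' - z‖ ^ α :=
      continuous_const.mul ((continuous_id.sub continuous_const).norm.rpow_const
        fun _ => Or.inr h.α_pos.le)
    simpa [Real.zero_rpow h.α_pos.ne'] using this.tendsto z
  exact squeeze_zero (fun _ => norm_nonneg _) (fun z' => h.holder s hs z' z) h1

lemma ae_continuous_field (h : IsCaratheodoryFlow T L A α W B Z) :
    ∀ᵐ s ∂(volume.restrict (Icc 0 T)), Continuous (W s) :=
  (ae_restrict_mem measurableSet_Icc).mono fun _ hs => h.continuous_field hs

lemma ae_continuous_deriv (h : IsCaratheodoryFlow T L A α W B Z) :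
    ∀ᵐ s ∂(volume.restrict (Icc 0 T)), Continuous (B s) :=
  (ae_restrict_mem measurableSet_Icc).mono fun _ hs => h.continuous_deriv hs

lemma measurable_deriv (h : IsCaratheodoryFlow T L A α W B Z) (z : E) :
    AEStronglyMeasurable (fun s => B s z) (volume.restrict (Icc 0 T)) :=
  aestronglyMeasurable_of_hasFDerivAt h.measurable
    ((ae_restrict_mem measurableSet_Icc).mono fun s hs => h.hasFDerivAt s hs z)

lemma norm_field_sub_le (h : IsCaratheodoryFlow T L A α W B Z) {s : ℝ} (hs : s ∈ Icc 0 T)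
    (z z' : E) : ‖W s z - W s z'‖ ≤ L * ‖z - z'‖ :=
  Convex.norm_image_sub_le_of_norm_hasFDerivWithin_le
    (fun w _ => (h.hasFDerivAt s hs w).hasFDerivWithinAt) (fun w _ => h.bound s hs w) convex_univ
    (mem_univ z') (mem_univ z)

lemma norm_field_taylor_le (h : IsCaratheodoryFlow T L A α W B Z) {s : ℝ} (hs : s ∈ Icc 0 T)
    (z z' : E) : ‖W s z - W s z' - B s z' (z - z')‖ ≤ A * ‖z - z'‖ ^ α * ‖z - z'‖ := by
  refine Convex.norm_image_sub_le_of_norm_hasFDerivWithin_le' (s := segment ℝ z' z)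
    (fun w _ => (h.hasFDerivAt s hs w).hasFDerivWithinAt) (fun w hw => ?_) (convex_segment _ _)
    (left_mem_segment _ _ _) (right_mem_segment _ _ _)
  refine (h.holder s hs w z').trans ?_
  have hw' : ‖w - z'‖ ≤ ‖z - z'‖ := norm_sub_le_of_mem_segment hw
  exact mul_le_mul_of_nonneg_left (Real.rpow_le_rpow (norm_nonneg _) hw' h.α_pos.le) h.A_nonneg

lemma aestronglyMeasurable_trajectory (h : IsCaratheodoryFlow T L A α W B Z) {t : ℝ}
    (ht : t ∈ Icc 0 T) (z : E) :
    AEStronglyMeasurable (fun s => Z s t z) (volume.restrict (Icc 0 T)) :=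
  (h.continuousOn t ht z).aestronglyMeasurable measurableSet_Icc

lemma integrableOn_field (h : IsCaratheodoryFlow T L A α W B Z) {t : ℝ} (ht : t ∈ Icc 0 T)
    (z : E) : IntegrableOn (fun s => W s (Z s t z)) (Icc 0 T) := by
  obtain ⟨A₀, hA₀⟩ := h.bound_zero
  have hm : AEStronglyMeasurable (fun s => W s (Z s t z)) (volume.restrict (Icc 0 T)) :=
    aestronglyMeasurable_comp_caratheodory h.ae_continuous_field h.measurable
      (h.aestronglyMeasurable_trajectory ht z)
  have hg : IntegrableOn (fun s => L * ‖Z s t z‖ + A₀) (Icc 0 T) :=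
    ((continuousOn_const.mul (h.continuousOn t ht z).norm).add
      continuousOn_const).integrableOn_compact isCompact_Icc
  refine Integrable.mono' hg hm ((ae_restrict_mem measurableSet_Icc).mono fun s hs => ?_)
  have h1 := h.norm_field_sub_le hs (Z s t z) 0
  rw [sub_zero] at h1
  calc ‖W s (Z s t z)‖ ≤ ‖W s (Z s t z) - W s 0‖ + ‖W s 0‖ := by
        simpa using norm_add_le (W s (Z s t z) - W s 0) (W s 0)
    _ ≤ _ := add_le_add h1 (hA₀ s hs)

lemma aestronglyMeasurable_deriv (h : IsCaratheodoryFlow T L A α W B Z) {t : ℝ}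
    (ht : t ∈ Icc 0 T) (z : E) :
    AEStronglyMeasurable (fun s => B s (Z s t z)) (volume.restrict (Icc 0 T)) :=
  aestronglyMeasurable_comp_caratheodory h.ae_continuous_deriv h.measurable_deriv
      (h.aestronglyMeasurable_trajectory ht z)

lemma integrableOn_deriv (h : IsCaratheodoryFlow T L A α W B Z) {t : ℝ}
    (ht : t ∈ Icc 0 T) (z : E) {y : ℝ → E} (hy : ContinuousOn y (Icc 0 T)) :
    IntegrableOn (fun s => B s (Z s t z) (y s)) (Icc 0 T) := by
  have hm : AEStronglyMeasurable (fun s => B s (Z s t z) (y s)) (volume.restrict (Icc 0 T)) :=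
    isBoundedBilinearMap_apply.continuous.comp_aestronglyMeasurable
      ((h.aestronglyMeasurable_deriv ht z).prodMk (hy.aestronglyMeasurable measurableSet_Icc))
  have hg : IntegrableOn (fun s => L * ‖y s‖) (Icc 0 T) :=
    (continuousOn_const.mul hy.norm).integrableOn_compact isCompact_Icc
  exact Integrable.mono' hg hm ((ae_restrict_mem measurableSet_Icc).mono fun s hs =>
    (B s (Z s t z)).le_of_opNorm_le (h.bound s hs _) _)

lemma intervalIntegrable_of_mem {F : Type*} [NormedAddCommGroup F] {f : ℝ → F} {t τ : ℝ}
    (hf : IntegrableOn f (Icc 0 T)) (ht : t ∈ Icc 0 T) (hτ : τ ∈ Icc 0 T) :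
    IntervalIntegrable f volume t τ :=
  (hf.mono_set (uIcc_subset_Icc ht hτ)).intervalIntegrable

lemma abs_sub_le_of_mem {t τ : ℝ} (ht : t ∈ Icc 0 T) (hτ : τ ∈ Icc 0 T) : |τ - t| ≤ T := by
  rw [abs_le]
  constructor <;> linarith [ht.1, ht.2, hτ.1, hτ.2]

lemma exp_le (h : IsCaratheodoryFlow T L A α W B Z) {t τ : ℝ} (ht : t ∈ Icc 0 T)
    (hτ : τ ∈ Icc 0 T) : Real.exp (L * |τ - t|) ≤ Real.exp (L * T) :=
  Real.exp_le_exp.2 (mul_le_mul_of_nonneg_left (abs_sub_le_of_mem ht hτ) h.L_nonneg)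

/-- The flow is Lipschitz continuous in the initial value. -/
lemma norm_sub_le (h : IsCaratheodoryFlow T L A α W B Z) {t τ : ℝ} (ht : t ∈ Icc 0 T)
    (hτ : τ ∈ Icc 0 T) (z z' : E) : ‖Z τ t z - Z τ t z'‖ ≤ Real.exp (L * T) * ‖z - z'‖ := by
  have := norm_le_of_eq_add_integral ht (y := fun τ => Z τ t z - Z τ t z')
    (f := fun s => W s (Z s t z) - W s (Z s t z')) (y₀ := z - z') (r := fun _ => 0)
    ((h.continuousOn t ht z).sub (h.continuousOn t ht z')) h.L_nonneg
    (fun τ hτ => by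
      rw [intervalIntegral.integral_sub (intervalIntegrable_of_mem (h.integrableOn_field ht z) ht hτ)
        (intervalIntegrable_of_mem (h.integrableOn_field ht z') ht hτ),
        h.eq_add_integral t ht z τ hτ, h.eq_add_integral t ht z' τ hτ]
      abel)
    (fun s hs => by simpa using h.norm_field_sub_le hs _ _) integrableOn_zero (fun _ _ => le_rfl) τ hτ
  simp only [integral_zero, add_zero] at this
  rw [mul_comm]
  exact this.trans (mul_le_mul_of_nonneg_left (h.exp_le ht hτ) (norm_nonneg _))

/-- `y` solves on `[0,T]` the equation linearised along the trajectory through `z` at time `t`, with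
initial value `δ`. -/
def IsVariation (T : ℝ) (B : ℝ → E → E →L[ℝ] E) (Z : ℝ → ℝ → E → E) (t : ℝ) (z δ : E)
    (y : ℝ → E) : Prop :=
  ContinuousOn y (Icc 0 T) ∧ ∀ τ ∈ Icc 0 T, y τ = δ + ∫ s in t..τ, B s (Z s t z) (y s)

/-- Solutions of the linearised equation grow at most exponentially. -/
lemma IsVariation.norm_le (h : IsCaratheodoryFlow T L A α W B Z) {t τ : ℝ} (ht : t ∈ Icc 0 T)
    (hτ : τ ∈ Icc 0 T) {z δ : E} {y : ℝ → E} (hy : IsVariation T B Z t z δ y) :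
    ‖y τ‖ ≤ ‖δ‖ * Real.exp (L * |τ - t|) := by
  have := norm_le_of_eq_add_integral ht (r := fun _ => 0) hy.1 h.L_nonneg hy.2
    (fun s hs => by simpa using (B s (Z s t z)).le_of_opNorm_le (h.bound s hs _) _)
    integrableOn_zero (fun _ _ => le_rfl) τ hτ
  simpa using this

lemma IsVariation.linear_combination (h : IsCaratheodoryFlow T L A α W B Z) {t : ℝ}
    (ht : t ∈ Icc 0 T) {z δ δ' : E} {y y' : ℝ → E} (hy : IsVariation T B Z t z δ y)
    (hy' : IsVariation T B Z t z δ' y') (c : ℝ) :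
    IsVariation T B Z t z (δ + c • δ') fun τ => y τ + c • y' τ := by
  refine ⟨hy.1.add (hy'.1.const_smul c), fun τ hτ => ?_⟩
  have i1 := intervalIntegrable_of_mem (h.integrableOn_deriv ht z hy.1) ht hτ
  have i2 := intervalIntegrable_of_mem (h.integrableOn_deriv ht z hy'.1) ht hτ
  have i3 : IntervalIntegrable (fun s => c • B s (Z s t z) (y' s)) volume t τ := i2.smul c
  simp only [map_add, map_smul]
  rw [intervalIntegral.integral_add i1 i3, intervalIntegral.integral_smul, hy.2 τ hτ,
    hy'.2 τ hτ, smul_add]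
  abel

lemma IsVariation.unique (h : IsCaratheodoryFlow T L A α W B Z) {t τ : ℝ} (ht : t ∈ Icc 0 T)
    (hτ : τ ∈ Icc 0 T) {z δ : E} {y y' : ℝ → E} (hy : IsVariation T B Z t z δ y)
    (hy' : IsVariation T B Z t z δ y') : y τ = y' τ := by
  have := (hy.linear_combination h ht hy' (-1)).norm_le h ht hτ
  simp only [neg_smul, one_smul, add_neg_cancel, norm_zero, zero_mul] at this
  exact sub_eq_zero.1 (by simpa [sub_eq_add_neg] using norm_le_zero_iff.1 this)

/-- The linearised equation is solvable: the difference quotients of the flow form a Cauchy sequence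
by Grönwall's inequality, and their limit solves it. -/
lemma exists_isVariation (h : IsCaratheodoryFlow T L A α W B Z) {t : ℝ} (ht : t ∈ Icc 0 T)
    (z δ : E) : ∃ y, IsVariation T B Z t z δ y := by
  set κ : ℕ → ℝ := fun n => 1 / ((n : ℝ) + 1) with hκ
  have hκ0 : ∀ n, 0 < κ n := fun n => by positivity
  have hκlim : Tendsto κ atTop (𝓝 0) := tendsto_one_div_add_atTop_nhds_zero_nat
  set zn : ℕ → E := fun n => z + κ n • δ with hzn
  set q : ℕ → ℝ → E := fun n τ => (κ n)⁻¹ • (Z τ t (zn n) - Z τ t z) with hq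
  set f : ℕ → ℝ → E := fun n s => (κ n)⁻¹ • (W s (Z s t (zn n)) - W s (Z s t z)) with hf
  set M : ℝ := Real.exp (L * T) * ‖δ‖ with hM
  have hM0 : 0 ≤ M := by positivity
  set ρ : ℕ → ℝ := fun n => A * (κ n * M) ^ α * M with hρ
  have hρ0 : ∀ n, 0 ≤ ρ n := fun n =>
    mul_nonneg (mul_nonneg h.A_nonneg (Real.rpow_nonneg (mul_nonneg (hκ0 n).le hM0) _)) hM0
  have hρlim : Tendsto ρ atTop (𝓝 0) := by
    have h1 : Tendsto (fun n => (κ n * M) ^ α) atTop (𝓝 0) := by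
      have := (hκlim.mul_const M).rpow_const (p := α) (Or.inr h.α_pos.le)
      simpa [Real.zero_rpow h.α_pos.ne'] using this
    simpa using (h1.const_mul A).mul_const M
  have hqc : ∀ n, ContinuousOn (q n) (Icc 0 T) := fun n =>
    ((h.continuousOn t ht (zn n)).sub (h.continuousOn t ht z)).const_smul _
  have hfint : ∀ n, IntegrableOn (f n) (Icc 0 T) := fun n =>
    ((h.integrableOn_field ht (zn n)).sub (h.integrableOn_field ht z)).smul _
  have hqeq : ∀ n, ∀ τ ∈ Icc 0 T, q n τ = δ + ∫ s in t..τ, f n s := by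
    intro n τ hτ
    simp only [hq, hf]
    rw [intervalIntegral.integral_smul, intervalIntegral.integral_sub
      (intervalIntegrable_of_mem (h.integrableOn_field ht _) ht hτ)
      (intervalIntegrable_of_mem (h.integrableOn_field ht _) ht hτ),
      h.eq_add_integral t ht (zn n) τ hτ, h.eq_add_integral t ht z τ hτ]
    have : δ = (κ n)⁻¹ • (κ n • δ) := by rw [smul_smul, inv_mul_cancel₀ (hκ0 n).ne', one_smul]
    conv_rhs => rw [this, ← smul_add]
    congr 1
    simp only [hzn]
    abel
  have hqM : ∀ n, ∀ s ∈ Icc 0 T, ‖Z s t (zn n) - Z s t z‖ ≤ κ n * M := by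
    intro n s hs
    refine (h.norm_sub_le ht hs _ _).trans_eq ?_
    simp only [hzn, add_sub_cancel_left, norm_smul, Real.norm_of_nonneg (hκ0 n).le, hM]
    ring
  -- the Taylor remainder tends to zero uniformly in time, by Hölder continuity of the derivative
  have hrem : ∀ n, ∀ s ∈ Icc 0 T, ‖f n s - B s (Z s t z) (q n s)‖ ≤ ρ n := by
    intro n s hs
    have e : f n s - B s (Z s t z) (q n s) = (κ n)⁻¹ • (W s (Z s t (zn n)) - W s (Z s t z) -
        B s (Z s t z) (Z s t (zn n) - Z s t z)) := by
      simp only [hf, hq]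
      rw [map_smul, ← smul_sub]
    rw [e, norm_smul, norm_inv, Real.norm_of_nonneg (hκ0 n).le, inv_mul_le_iff₀ (hκ0 n)]
    refine (h.norm_field_taylor_le hs _ _).trans ?_
    have := hqM n s hs
    calc A * ‖Z s t (zn n) - Z s t z‖ ^ α * ‖Z s t (zn n) - Z s t z‖
        ≤ A * (κ n * M) ^ α * (κ n * M) := by
          have h1 := Real.rpow_le_rpow (norm_nonneg _) this h.α_pos.le
          have h2 : 0 ≤ (κ n * M) ^ α := Real.rpow_nonneg (mul_nonneg (hκ0 n).le hM0) _
          have h3 := h.A_nonneg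
          gcongr
      _ = κ n * ρ n := by
          simp only [hρ]
          ring
  set K : ℝ := T * Real.exp (L * T) with hK
  have hT0 : 0 ≤ T := ht.1.trans ht.2
  have hcauchy : ∀ n m, ∀ τ ∈ Icc 0 T, ‖q n τ - q m τ‖ ≤ (ρ n + ρ m) * K := by
    intro n m τ hτ
    have := norm_le_of_eq_add_integral ht (y := fun τ => q n τ - q m τ)
      (f := fun s => f n s - f m s) (y₀ := 0) (r := fun _ => ρ n + ρ m)
      ((hqc n).sub (hqc m)) h.L_nonneg
      (fun τ hτ => by
        rw [intervalIntegral.integral_sub (intervalIntegrable_of_mem (hfint n) ht hτ)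
          (intervalIntegrable_of_mem (hfint m) ht hτ), hqeq n τ hτ, hqeq m τ hτ]
        abel)
      (fun s hs => by
        have e : f n s - f m s = B s (Z s t z) (q n s - q m s) +
            ((f n s - B s (Z s t z) (q n s)) - (f m s - B s (Z s t z) (q m s))) := by
          rw [map_sub]
          abel
        rw [e]
        refine (norm_add_le _ _).trans (add_le_add
          ((B s (Z s t z)).le_of_opNorm_le (h.bound s hs _) _) ((_root_.norm_sub_le _ _).trans ?_))
        exact add_le_add (hrem n s hs) (hrem m s hs))
      (integrableOn_const (by simp)) (fun _ _ => add_nonneg (hρ0 n) (hρ0 m)) τ hτ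
    rw [norm_zero, zero_add, setIntegral_const, Measure.real, Real.volume_Icc, sub_zero,
      ENNReal.toReal_ofReal hT0, smul_eq_mul] at this
    refine this.trans ?_
    rw [hK, ← mul_assoc, mul_comm (ρ n + ρ m) T]
    exact mul_le_mul_of_nonneg_left (h.exp_le ht hτ)
      (mul_nonneg hT0 (add_nonneg (hρ0 n) (hρ0 m)))
  have hconv : ∀ τ ∈ Icc 0 T, ∃ y, Tendsto (fun n => q n τ) atTop (𝓝 y) := by
    intro τ hτ
    refine cauchySeq_tendsto_of_complete ?_
    rw [Metric.cauchySeq_iff']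
    intro ε hε
    have h1 : Tendsto (fun n => (ρ n + ρ n) * K) atTop (𝓝 0) := by
      simpa using (hρlim.add hρlim).mul_const K
    have h2 : Tendsto (fun p : ℕ × ℕ => (ρ p.1 + ρ p.2) * K) atTop (𝓝 0) := by
      rw [← prod_atTop_atTop_eq]
      simpa using ((hρlim.comp tendsto_fst).add (hρlim.comp tendsto_snd)).mul_const K
    have h3 := h2.eventually (gt_mem_nhds hε)
    rw [← prod_atTop_atTop_eq, eventually_prod_iff] at h3
    obtain ⟨p, hp, p', hp', h3⟩ := h3
    obtain ⟨N, hN, hN'⟩ := ((eventually_forall_ge_atTop.2 hp).and hp').exists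
    refine ⟨N, fun n hn => ?_⟩
    rw [dist_eq_norm]
    exact (hcauchy n N τ hτ).trans_lt (h3 (hN n hn) hN')
  choose! y hy using hconv
  have hylim : ∀ n, ∀ τ ∈ Icc 0 T, ‖q n τ - y τ‖ ≤ ρ n * K := by
    intro n τ hτ
    have h1 : Tendsto (fun m => ‖q n τ - q m τ‖) atTop (𝓝 ‖q n τ - y τ‖) :=
      ((hy τ hτ).const_sub _).norm
    have h2 : Tendsto (fun m => (ρ n + ρ m) * K) atTop (𝓝 (ρ n * K)) := by
      simpa using (hρlim.const_add (ρ n)).mul_const K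
    exact le_of_tendsto_of_tendsto' h1 h2 fun m => hcauchy n m τ hτ
  have hyc : ContinuousOn y (Icc 0 T) := by
    have hu : TendstoUniformlyOn q y atTop (Icc 0 T) := by
      rw [Metric.tendstoUniformlyOn_iff]
      intro ε hε
      have h1 : Tendsto (fun n => ρ n * K) atTop (𝓝 0) := by simpa using hρlim.mul_const K
      filter_upwards [h1.eventually (gt_mem_nhds hε)] with n hn τ hτ
      rw [dist_comm, dist_eq_norm]
      exact (hylim n τ hτ).trans_lt hn
    exact hu.continuousOn (Eventually.of_forall hqc).frequently
  refine ⟨y, hyc, fun τ hτ => ?_⟩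
  have hlim : Tendsto (fun n => ∫ s in t..τ, f n s) atTop (𝓝 (∫ s in t..τ, B s (Z s t z) (y s))) := by
    refine intervalIntegral.tendsto_integral_filter_of_dominated_convergence (fun _ => L * M) ?_ ?_ ?_ ?_
    · exact Eventually.of_forall fun n =>
        ((hfint n).mono_set (uIoc_subset_uIcc.trans (uIcc_subset_Icc ht hτ))).aestronglyMeasurable
    · refine Eventually.of_forall fun n => Eventually.of_forall fun s hs => ?_
      have hs' := uIcc_subset_Icc ht hτ (uIoc_subset_uIcc hs)
      simp only [hf]
      rw [norm_smul, norm_inv, Real.norm_of_nonneg (hκ0 n).le, inv_mul_le_iff₀ (hκ0 n)]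
      calc ‖W s (Z s t (zn n)) - W s (Z s t z)‖ ≤ L * ‖Z s t (zn n) - Z s t z‖ :=
            h.norm_field_sub_le hs' _ _
        _ ≤ L * (κ n * M) := mul_le_mul_of_nonneg_left (hqM n s hs') h.L_nonneg
        _ = κ n * (L * M) := by ring
    · exact intervalIntegrable_const
    · refine Eventually.of_forall fun s hs => ?_
      have hs' := uIcc_subset_Icc ht hτ (uIoc_subset_uIcc hs)
      have h1 : Tendsto (fun n => B s (Z s t z) (q n s)) atTop (𝓝 (B s (Z s t z) (y s))) :=
        ((B s (Z s t z)).continuous.tendsto _).comp (hy s hs')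
      have h2 : Tendsto (fun n => f n s - B s (Z s t z) (q n s)) atTop (𝓝 0) :=
        squeeze_zero_norm (fun n => hrem n s hs') hρlim
      simpa using h2.add h1
  refine tendsto_nhds_unique (hy τ hτ) ?_
  refine (hlim.const_add δ).congr fun n => (hqeq n τ hτ).symm

/-- The flow is differentiable in the initial value; its derivative solves the linearised
equation. -/
lemma exists_jacobian (h : IsCaratheodoryFlow T L A α W B Z) :
    ∃ J : ℝ → ℝ → E → E →L[ℝ] E, (∀ t ∈ Icc 0 T, ∀ z δ, IsVariation T B Z t z δ fun τ => J τ t z δ) ∧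
      ∀ t ∈ Icc 0 T, ∀ τ ∈ Icc 0 T, ∀ z, HasFDerivAt (Z τ t) (J τ t z) z := by
  have hex : ∀ t ∈ Icc 0 T, ∀ z δ, ∃ y, IsVariation T B Z t z δ y :=
    fun t ht z δ => h.exists_isVariation ht z δ
  choose! y hy using hex
  have hJ : ∀ t ∈ Icc 0 T, ∀ τ ∈ Icc 0 T, ∀ z, ∃ J : E →L[ℝ] E, ∀ δ, J δ = y t z δ τ := by
    intro t ht τ hτ z
    have hlin : ∀ δ δ' c, y t z (δ + c • δ') τ = y t z δ τ + c • y t z δ' τ := fun δ δ' c =>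
      (hy t ht z (δ + c • δ')).unique h ht hτ
        ((hy t ht z δ).linear_combination h ht (hy t ht z δ') c)
    have hzero : y t z 0 τ = 0 := by
      have := (hy t ht z 0).norm_le h ht hτ
      simpa using this
    let l : E →ₗ[ℝ] E :=
      { toFun := fun δ => y t z δ τ
        map_add' := fun a b => by simpa using hlin a b 1
        map_smul' := fun c a => by simpa [hzero] using hlin 0 a c }
    exact ⟨l.toContinuousLinearMap, fun δ => rfl⟩
  choose! J hJ using hJ
  refine ⟨fun τ t z => J t τ z, fun t ht z δ => ?_, fun t ht τ hτ z => ?_⟩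
  · have := hy t ht z δ
    refine ⟨this.1.congr fun τ hτ => hJ t ht τ hτ z δ, fun τ hτ => ?_⟩
    change J t τ z δ = δ + ∫ s in t..τ, B s (Z s t z) (J t s z δ)
    rw [hJ t ht τ hτ z δ, this.2 τ hτ]
    congr 1
    refine intervalIntegral.integral_congr fun s hs => ?_
    rw [hJ t ht s (uIcc_subset_Icc ht hτ hs) z δ]
  · set M := Real.exp (L * T) with hM
    have hM0 : 0 < M := Real.exp_pos _
    have hT0 : 0 ≤ T := ht.1.trans ht.2
    have key : ∀ z', ‖Z τ t z' - Z τ t z - J t τ z (z' - z)‖ ≤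
        (T * (A * M ^ α * M) * M) * ‖z' - z‖ ^ α * ‖z' - z‖ := by
      intro z'
      rw [hJ t ht τ hτ]
      have hyv := hy t ht z (z' - z)
      have hr0 : 0 ≤ A * (M * ‖z' - z‖) ^ α * (M * ‖z' - z‖) :=
        mul_nonneg (mul_nonneg h.A_nonneg (Real.rpow_nonneg (by positivity) _)) (by positivity)
      have := norm_le_of_eq_add_integral ht (y := fun τ => Z τ t z' - Z τ t z - y t z (z' - z) τ)
        (f := fun s => W s (Z s t z') - W s (Z s t z) - B s (Z s t z) (y t z (z' - z) s)) (y₀ := 0)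
        (r := fun _ => A * (M * ‖z' - z‖) ^ α * (M * ‖z' - z‖))
        (((h.continuousOn t ht z').sub (h.continuousOn t ht z)).sub hyv.1) h.L_nonneg
        (fun τ hτ => by
          have i1 := intervalIntegrable_of_mem (h.integrableOn_field ht z') ht hτ
          have i2 := intervalIntegrable_of_mem (h.integrableOn_field ht z) ht hτ
          rw [intervalIntegral.integral_sub (i1.sub i2)
            (intervalIntegrable_of_mem (h.integrableOn_deriv ht z hyv.1) ht hτ),
            intervalIntegral.integral_sub i1 i2, hyv.2 τ hτ, h.eq_add_integral t ht z' τ hτ,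
            h.eq_add_integral t ht z τ hτ]
          abel)
        (fun s hs => by
          have e : W s (Z s t z') - W s (Z s t z) - B s (Z s t z) (y t z (z' - z) s) =
            B s (Z s t z) (Z s t z' - Z s t z - y t z (z' - z) s) +
            (W s (Z s t z') - W s (Z s t z) - B s (Z s t z) (Z s t z' - Z s t z)) := by
            rw [map_sub _ (Z s t z' - Z s t z)]
            abel
          rw [e]
          refine (norm_add_le _ _).trans (add_le_add
            ((B s (Z s t z)).le_of_opNorm_le (h.bound s hs _) _) ((h.norm_field_taylor_le hs _ _).trans ?_))
          have h1 := h.norm_sub_le ht hs z' z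
          have h2 := Real.rpow_le_rpow (norm_nonneg _) h1 h.α_pos.le
          have h3 := h.A_nonneg
          gcongr)
        (integrableOn_const (by simp)) (fun _ _ => hr0) τ hτ
      rw [norm_zero, zero_add, setIntegral_const, Measure.real, Real.volume_Icc, sub_zero,
        ENNReal.toReal_ofReal hT0, smul_eq_mul] at this
      refine this.trans ((mul_le_mul_of_nonneg_left (h.exp_le ht hτ) (mul_nonneg hT0 hr0)).trans_eq ?_)
      rw [Real.mul_rpow hM0.le (norm_nonneg _)]
      ring
    rw [hasFDerivAt_iff_isLittleO, Asymptotics.isLittleO_iff]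
    intro c hc
    have hlim : Tendsto (fun z' => (T * (A * M ^ α * M) * M) * ‖z' - z‖ ^ α) (𝓝 z) (𝓝 0) := by
      have : Continuous fun z' => (T * (A * M ^ α * M) * M) * ‖z' - z‖ ^ α :=
        continuous_const.mul ((continuous_id.sub continuous_const).norm.rpow_const
          fun _ => Or.inr h.α_pos.le)
      simpa [Real.zero_rpow h.α_pos.ne'] using this.tendsto z
    filter_upwards [hlim.eventually (gt_mem_nhds hc)] with z' hz'
    exact (key z').trans (mul_le_mul_of_nonneg_right hz'.le (norm_nonneg _))

/-- The variation of the Jacobian of the flow is controlled by the variation along the trajectories of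
the derivative of the field. -/
lemma norm_jacobian_sub_le (h : IsCaratheodoryFlow T L A α W B Z) {J : ℝ → ℝ → E → E →L[ℝ] E}
    (hJ : ∀ t ∈ Icc 0 T, ∀ z δ, IsVariation T B Z t z δ fun τ => J τ t z δ) {t τ : ℝ}
    (ht : t ∈ Icc 0 T) (hτ : τ ∈ Icc 0 T) (z z' : E) :
    ‖J τ t z - J τ t z'‖ ≤ Real.exp (L * T) ^ 2 *
      ∫ s in Icc 0 T, ‖B s (Z s t z) - B s (Z s t z')‖ := by
  have hI : IntegrableOn (fun s => ‖B s (Z s t z) - B s (Z s t z')‖) (Icc 0 T) := by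
    refine Integrable.mono' (g := fun _ => L + L) (integrableOn_const (by simp))
      ((h.aestronglyMeasurable_deriv ht z).sub (h.aestronglyMeasurable_deriv ht z')).norm
      ((ae_restrict_mem measurableSet_Icc).mono fun s hs => ?_)
    rw [norm_norm]
    exact (_root_.norm_sub_le _ _).trans (add_le_add (h.bound s hs _) (h.bound s hs _))
  have hI0 : 0 ≤ ∫ s in Icc 0 T, ‖B s (Z s t z) - B s (Z s t z')‖ :=
    integral_nonneg fun _ => norm_nonneg _
  refine ContinuousLinearMap.opNorm_le_bound _ (by positivity) fun δ => ?_
  have v1 := hJ t ht z δ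
  have v2 := hJ t ht z' δ
  have := norm_le_of_eq_add_integral ht (y := fun τ => J τ t z δ - J τ t z' δ)
    (f := fun s => B s (Z s t z) (J s t z δ) - B s (Z s t z') (J s t z' δ)) (y₀ := 0)
    (r := fun s => ‖B s (Z s t z) - B s (Z s t z')‖ * (‖δ‖ * Real.exp (L * T)))
    (v1.1.sub v2.1) h.L_nonneg
    (fun τ hτ => by
      have e1 : J τ t z δ = _ := v1.2 τ hτ
      have e2 : J τ t z' δ = _ := v2.2 τ hτ
      rw [intervalIntegral.integral_sub
        (intervalIntegrable_of_mem (h.integrableOn_deriv ht z v1.1) ht hτ)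
        (intervalIntegrable_of_mem (h.integrableOn_deriv ht z' v2.1) ht hτ), e1, e2]
      abel)
    (fun s hs => by
      have e : B s (Z s t z) (J s t z δ) - B s (Z s t z') (J s t z' δ) =
          B s (Z s t z) (J s t z δ - J s t z' δ) +
            (B s (Z s t z) - B s (Z s t z')) (J s t z' δ) := by
        rw [map_sub, sub_apply]
        abel
      rw [e]
      refine (norm_add_le _ _).trans (add_le_add
        ((B s (Z s t z)).le_of_opNorm_le (h.bound s hs _) _)
        ((ContinuousLinearMap.le_opNorm _ _).trans ?_))
      refine mul_le_mul_of_nonneg_left ?_ (norm_nonneg _)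
      exact (v2.norm_le h ht hs).trans (mul_le_mul_of_nonneg_left (h.exp_le ht hs) (norm_nonneg _)))
    (hI.mul_const _) (fun s _ => by positivity) τ hτ
  rw [norm_zero, zero_add, integral_mul_const] at this
  rw [sub_apply]
  refine this.trans ((mul_le_mul_of_nonneg_left (h.exp_le ht hτ) (by positivity)).trans_eq ?_)
  ring

lemma continuous_jacobian (h : IsCaratheodoryFlow T L A α W B Z) {J : ℝ → ℝ → E → E →L[ℝ] E}
    (hJ : ∀ t ∈ Icc 0 T, ∀ z δ, IsVariation T B Z t z δ fun τ => J τ t z δ) {t τ : ℝ}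
    (ht : t ∈ Icc 0 T) (hτ : τ ∈ Icc 0 T) : Continuous (J τ t) := by
  refine continuous_iff_continuousAt.2 fun z => ?_
  rw [ContinuousAt, tendsto_iff_norm_sub_tendsto_zero]
  set M := Real.exp (L * T)
  have hT0 : 0 ≤ T := ht.1.trans ht.2
  have h1 : Tendsto (fun z' => M ^ 2 * (T * (A * (M * ‖z' - z‖) ^ α))) (𝓝 z) (𝓝 0) := by
    have : Continuous fun z' => M ^ 2 * (T * (A * (M * ‖z' - z‖) ^ α)) :=
      continuous_const.mul (continuous_const.mul (continuous_const.mul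
        ((continuous_const.mul (continuous_id.sub continuous_const).norm).rpow_const
        fun _ => Or.inr h.α_pos.le)))
    simpa [Real.zero_rpow h.α_pos.ne'] using this.tendsto z
  refine squeeze_zero (fun _ => norm_nonneg _) (fun z' => ?_) h1
  refine (h.norm_jacobian_sub_le hJ ht hτ z' z).trans (mul_le_mul_of_nonneg_left ?_ (by positivity))
  have h2 : ∀ s ∈ Icc 0 T, ‖B s (Z s t z') - B s (Z s t z)‖ ≤ A * (M * ‖z' - z‖) ^ α := fun s hs =>
    (h.holder s hs _ _).trans (mul_le_mul_of_nonneg_left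
      (Real.rpow_le_rpow (norm_nonneg _) (h.norm_sub_le ht hs _ _) h.α_pos.le) h.A_nonneg)
  have h3 := norm_setIntegral_le_of_norm_le_const (μ := volume) (s := Icc 0 T)
    (f := fun s => ‖B s (Z s t z') - B s (Z s t z)‖) (by simp) (fun s hs => by
      rw [norm_norm]
      exact h2 s hs)
  rw [Measure.real, Real.volume_Icc, sub_zero, ENNReal.toReal_ofReal hT0] at h3
  rw [mul_comm T]
  exact (le_abs_self _).trans h3

end IsCaratheodoryFlow

/-! ### Weak limits in `L²` -/

/-- A bounded sequence in a Hilbert space converges weakly along some ultrafilter. -/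
lemma exists_weak_limit {H : Type*} [NormedAddCommGroup H] [InnerProductSpace ℝ H] [CompleteSpace H]
    {x : ℕ → H} {C : ℝ} (hx : ∀ n, ‖x n‖ ≤ C) :
    ∃ (𝓕 : Ultrafilter ℕ), (𝓕 : Filter ℕ) ≤ atTop ∧ ∃ a : H, ∀ y,
      Tendsto (fun n => inner ℝ (x n) y) 𝓕 (𝓝 (inner ℝ a y)) := by
  set u : ℕ → WeakDual ℝ H := fun n =>
    StrongDual.toWeakDual (InnerProductSpace.toDual ℝ H (x n)) with hu
  have hc := WeakDual.isCompact_closedBall (𝕜 := ℝ) (0 : StrongDual ℝ H) C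
  obtain ⟨l, -, hl⟩ := hc.ultrafilter_le_nhds ((hyperfilter ℕ).map u) (by
    rw [le_principal_iff]
    refine mem_map.2 (univ_mem' fun n => ?_)
    simp only [hu, mem_preimage, Metric.mem_closedBall, dist_zero_right]
    simpa using hx n)
  refine ⟨hyperfilter ℕ, by simpa using Nat.hyperfilter_le_atTop,
    (InnerProductSpace.toDual ℝ H).symm (WeakDual.toStrongDual l), fun y => ?_⟩
  have h1 : Tendsto (fun n => u n y) (hyperfilter ℕ) (𝓝 (l y)) :=
    ((WeakDual.eval_continuous y).tendsto l).comp hl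
  simpa [hu] using h1

/-- A sequence of functions that is bounded in `L²` on every ball has, along some ultrafilter, a weak
limit in `L²_loc`. -/
lemma exists_weak_limit_locL2 {U : Type*} [NormedAddCommGroup U] [MeasurableSpace U] [BorelSpace U]
    {μ : Measure U} {q : ℕ → U → ℝ} (hq : ∀ n, AEStronglyMeasurable (q n) μ)
    (hb : ∀ R : ℕ, ∃ c : ℝ, ∀ n,
      ∫⁻ p in Metric.closedBall 0 R, ‖q n p‖ₑ ^ 2 ∂μ ≤ ENNReal.ofReal c) :
    ∃ 𝓕 : Ultrafilter ℕ, (𝓕 : Filter ℕ) ≤ atTop ∧ ∃ G : U → ℝ, StronglyMeasurable G ∧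
      (∀ R : ℕ, ∫⁻ p in Metric.closedBall 0 R, ‖G p‖ₑ ^ 2 ∂μ < ⊤) ∧
      ∀ ψ : U → ℝ, MemLp ψ 2 μ → (∃ R : ℕ, ∀ p, (R : ℝ) < ‖p‖ → ψ p = 0) →
        Tendsto (fun n => ∫ p, ψ p * q n p ∂μ) 𝓕 (𝓝 (∫ p, ψ p * G p ∂μ)) := by
  choose c hc using hb
  -- a weight that turns the local bounds into a global one
  set a : ℕ → ℝ := fun j => Real.sqrt ((1 / 2) ^ j / (|c j| + 1)) with ha
  have ha0 : ∀ j, 0 < a j := fun j => Real.sqrt_pos.2 (by positivity)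
  have hac : ∀ j, a j ^ 2 * |c j| ≤ (1 / 2) ^ j := by
    intro j
    rw [ha, Real.sq_sqrt (by positivity), div_mul_eq_mul_div, div_le_iff₀ (by positivity)]
    gcongr
    linarith
  set w : U → ℝ := fun p => a ⌈‖p‖⌉₊ with hw
  have hw0 : ∀ p, 0 < w p := fun p => ha0 _
  have hwm : Measurable w := (measurable_from_nat (f := a)).comp (Nat.measurable_ceil.comp measurable_norm)
  have hwb : ∀ R : ℕ, ∃ K : ℝ, ∀ p, ‖p‖ ≤ R → (w p)⁻¹ ≤ K := by
    intro R
    refine ⟨∑ j ∈ Finset.range (R + 1), (a j)⁻¹, fun p hp => ?_⟩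
    exact Finset.single_le_sum (f := fun j => (a j)⁻¹) (fun j _ => (inv_pos.2 (ha0 j)).le)
      (Finset.mem_range.2 (Nat.lt_succ_of_le (Nat.ceil_le.2 hp)))
  have hQm : ∀ n, AEStronglyMeasurable (fun p => w p * q n p) μ := fun n =>
    hwm.aestronglyMeasurable.mul (hq n)
  have hQ : ∀ n, ∫⁻ p, ‖w p * q n p‖ₑ ^ 2 ∂μ ≤ 2 := by
    intro n
    calc ∫⁻ p, ‖w p * q n p‖ₑ ^ 2 ∂μ
        ≤ ∫⁻ p, ∑' j : ℕ, (Metric.closedBall (0 : U) j).indicator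
            (fun p => ENNReal.ofReal (a j ^ 2) * ‖q n p‖ₑ ^ 2) p ∂μ := by
          refine lintegral_mono fun p => ?_
          refine le_trans (le_of_eq ?_) (ENNReal.le_tsum ⌈‖p‖⌉₊)
          rw [indicator_of_mem (by simpa using Nat.le_ceil ‖p‖), enorm_mul, mul_pow,
            ENNReal.ofReal_pow (ha0 _).le, Real.enorm_of_nonneg (hw0 p).le]
      _ = ∑' j : ℕ, ENNReal.ofReal (a j ^ 2) *
            ∫⁻ p in Metric.closedBall (0 : U) j, ‖q n p‖ₑ ^ 2 ∂μ := by
          have hqm : AEMeasurable (fun p => ‖q n p‖ₑ ^ 2) μ := (hq n).enorm.pow_const 2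
          rw [lintegral_tsum fun j => (hqm.const_mul _).indicator
            Metric.isClosed_closedBall.measurableSet]
          congr 1 with j
          rw [lintegral_indicator Metric.isClosed_closedBall.measurableSet,
            lintegral_const_mul'' _ hqm.restrict]
      _ ≤ ∑' j : ℕ, (2⁻¹ : ℝ≥0∞) ^ j := by
          refine ENNReal.tsum_le_tsum fun j => ?_
          calc ENNReal.ofReal (a j ^ 2) * ∫⁻ p in Metric.closedBall (0 : U) j, ‖q n p‖ₑ ^ 2 ∂μ
              ≤ ENNReal.ofReal (a j ^ 2) * ENNReal.ofReal |c j| := by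
                gcongr
                exact (hc j n).trans (ENNReal.ofReal_le_ofReal (le_abs_self _))
            _ = ENNReal.ofReal (a j ^ 2 * |c j|) := (ENNReal.ofReal_mul (by positivity)).symm
            _ ≤ ENNReal.ofReal ((1 / 2) ^ j) := ENNReal.ofReal_le_ofReal (hac j)
            _ = (2⁻¹ : ℝ≥0∞) ^ j := by
                rw [ENNReal.ofReal_pow (by positivity), one_div,
                  ENNReal.ofReal_inv_of_pos (by norm_num)]
                norm_num
      _ = 2 := by
          rw [ENNReal.tsum_geometric, ENNReal.one_sub_inv_two, inv_inv]
  have hnorm2 : ∀ g : U → ℝ, eLpNorm g 2 μ = (∫⁻ p, ‖g p‖ₑ ^ 2 ∂μ) ^ (1 / 2 : ℝ) := by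
    intro g
    rw [eLpNorm_eq_lintegral_rpow_enorm_toReal (by norm_num) (by norm_num)]
    simp
  have hQL : ∀ n, MemLp (fun p => w p * q n p) 2 μ := fun n => by
    refine ⟨hQm n, ?_⟩
    rw [hnorm2]
    exact ENNReal.rpow_lt_top_of_nonneg (by norm_num) ((hQ n).trans_lt (by norm_num)).ne
  have hQn : ∀ n, ‖(hQL n).toLp _‖ ≤ 2 := by
    intro n
    rw [Lp.norm_toLp]
    refine ENNReal.toReal_le_of_le_ofReal (by norm_num) ?_
    rw [hnorm2, show ENNReal.ofReal 2 = 2 by norm_num]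
    calc (∫⁻ p, ‖w p * q n p‖ₑ ^ 2 ∂μ) ^ (1 / 2 : ℝ) ≤ 2 ^ (1 / 2 : ℝ) :=
          ENNReal.rpow_le_rpow (hQ n) (by norm_num)
      _ ≤ 2 ^ (1 : ℝ) := ENNReal.rpow_le_rpow_of_exponent_le (by norm_num) (by norm_num)
      _ = 2 := ENNReal.rpow_one _
  obtain ⟨𝓕, h𝓕, Q, hlim⟩ := exists_weak_limit hQn
  have hQmeas : StronglyMeasurable (Q : U → ℝ) := Lp.stronglyMeasurable Q
  refine ⟨𝓕, h𝓕, fun p => (w p)⁻¹ * Q p, hwm.inv.stronglyMeasurable.mul hQmeas, fun R => ?_,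
    fun ψ hψ hψR => ?_⟩
  · obtain ⟨K, hK⟩ := hwb R
    have hQ2 : ∫⁻ p, ‖Q p‖ₑ ^ 2 ∂μ < ⊤ := by
      have h1 := (Lp.memLp Q).2
      rw [hnorm2] at h1
      by_contra! h2
      rw [top_le_iff.1 h2, ENNReal.top_rpow_of_pos (by norm_num)] at h1
      exact lt_irrefl _ h1
    calc ∫⁻ p in Metric.closedBall 0 R, ‖(w p)⁻¹ * Q p‖ₑ ^ 2 ∂μ
        ≤ ∫⁻ p in Metric.closedBall 0 R, ENNReal.ofReal (K ^ 2) * ‖Q p‖ₑ ^ 2 ∂μ := by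
          refine setLIntegral_mono' Metric.isClosed_closedBall.measurableSet fun p hp => ?_
          have h1 := hK p (by simpa using hp)
          have h2 : 0 ≤ (w p)⁻¹ := (inv_pos.2 (hw0 p)).le
          rw [enorm_mul, mul_pow, Real.enorm_of_nonneg h2, ENNReal.ofReal_pow (h2.trans h1)]
          gcongr
      _ ≤ ∫⁻ p, ENNReal.ofReal (K ^ 2) * ‖Q p‖ₑ ^ 2 ∂μ := setLIntegral_le_lintegral _ _
      _ = ENNReal.ofReal (K ^ 2) * ∫⁻ p, ‖Q p‖ₑ ^ 2 ∂μ :=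
          lintegral_const_mul' _ _ ENNReal.ofReal_ne_top
      _ < ⊤ := ENNReal.mul_lt_top ENNReal.ofReal_lt_top hQ2
  · obtain ⟨R, hR⟩ := hψR
    obtain ⟨K, hK⟩ := hwb R
    have hg : MemLp (fun p => (w p)⁻¹ * ψ p) 2 μ := by
      refine MemLp.of_le (hψ.const_mul K) (hwm.inv.aestronglyMeasurable.mul hψ.1)
        (Eventually.of_forall fun p => ?_)
      rcases le_or_gt ‖p‖ (R : ℝ) with hp | hp
      · rw [norm_mul, norm_mul]
        have h1 := hK p hp
        have h2 : 0 ≤ (w p)⁻¹ := (inv_pos.2 (hw0 p)).le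
        gcongr
        rw [Real.norm_of_nonneg h2]
        exact h1.trans (Real.le_norm_self _)
      · simp [hR p hp]
    have h1 := hlim (hg.toLp _)
    simp only [L2.inner_def] at h1
    have e1 : ∫ p, inner ℝ (Q p) (hg.toLp _ p) ∂μ = ∫ p, ψ p * ((w p)⁻¹ * Q p) ∂μ := by
      refine integral_congr_ae ?_
      filter_upwards [hg.coeFn_toLp] with p hp
      rw [hp, RCLike.inner_apply]
      simp only [conj_trivial]
      ring
    have e2 : ∀ n, ∫ p, inner ℝ ((hQL n).toLp _ p) (hg.toLp _ p) ∂μ = ∫ p, ψ p * q n p ∂μ := by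
      intro n
      refine integral_congr_ae ?_
      filter_upwards [hg.coeFn_toLp, (hQL n).coeFn_toLp] with p hp hp'
      rw [hp, hp', RCLike.inner_apply]
      simp only [conj_trivial]
      field_simp [(hw0 p).ne']
    rw [e1] at h1
    exact h1.congr e2

lemma integrable_sq_of_lintegral {U : Type*} [MeasurableSpace U] {μ : Measure U} {g : U → ℝ}
    (hm : AEStronglyMeasurable g μ) (hg : ∫⁻ p, ‖g p‖ₑ ^ 2 ∂μ < ⊤) :
    Integrable (fun p => g p ^ 2) μ := by
  refine ⟨hm.pow 2, ?_⟩
  rw [HasFiniteIntegral]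
  simpa [enorm_pow] using hg

lemma ofReal_integral_sq {U : Type*} [MeasurableSpace U] {μ : Measure U} {g : U → ℝ}
    (hg : Integrable (fun p => g p ^ 2) μ) :
    ENNReal.ofReal (∫ p, g p ^ 2 ∂μ) = ∫⁻ p, ‖g p‖ₑ ^ 2 ∂μ := by
  rw [ofReal_integral_eq_lintegral_ofReal hg (Eventually.of_forall fun p => sq_nonneg _)]
  refine lintegral_congr fun p => ?_
  rw [← sq_abs, ENNReal.ofReal_pow (abs_nonneg _), ← Real.norm_eq_abs, ofReal_norm]

/-- Weak lower semicontinuity of the `L²` norm on a bounded set `D`, tested with `1_D G`. -/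
lemma setLIntegral_sq_le_of_weak_limit {U : Type*} [NormedAddCommGroup U] [MeasurableSpace U]
    [BorelSpace U] {μ : Measure U} {q : ℕ → U → ℝ} (hq : ∀ n, AEStronglyMeasurable (q n) μ)
    {𝓕 : Ultrafilter ℕ} {G : U → ℝ} (hG : StronglyMeasurable G)
    (hG2 : ∀ R : ℕ, ∫⁻ p in Metric.closedBall 0 R, ‖G p‖ₑ ^ 2 ∂μ < ⊤)
    (hlim : ∀ ψ : U → ℝ, MemLp ψ 2 μ → (∃ R : ℕ, ∀ p, (R : ℝ) < ‖p‖ → ψ p = 0) →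
        Tendsto (fun n => ∫ p, ψ p * q n p ∂μ) 𝓕 (𝓝 (∫ p, ψ p * G p ∂μ)))
    {D : Set U} (hD : MeasurableSet D) {R : ℕ} (hDR : D ⊆ Metric.closedBall 0 R) {c : ℝ}
    (hc0 : 0 ≤ c) (hc : ∀ n, ∫⁻ p in D, ‖q n p‖ₑ ^ 2 ∂μ ≤ ENNReal.ofReal c) :
    ∫⁻ p in D, ‖G p‖ₑ ^ 2 ∂μ ≤ ENNReal.ofReal c := by
  have hGD : ∫⁻ p in D, ‖G p‖ₑ ^ 2 ∂μ < ⊤ := (lintegral_mono_set hDR).trans_lt (hG2 R)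
  have iG : Integrable (fun p => G p ^ 2) (μ.restrict D) :=
    integrable_sq_of_lintegral hG.aestronglyMeasurable hGD
  have iq : ∀ n, Integrable (fun p => q n p ^ 2) (μ.restrict D) := fun n =>
    integrable_sq_of_lintegral (hq n).restrict ((hc n).trans_lt ENNReal.ofReal_lt_top)
  have hqc : ∀ n, ∫ p in D, q n p ^ 2 ∂μ ≤ c := fun n => by
    have := hc n
    rwa [← ofReal_integral_sq (iq n), ENNReal.ofReal_le_ofReal_iff hc0] at this
  have hψ : MemLp (D.indicator G) 2 μ := by
    refine ⟨hG.aestronglyMeasurable.indicator hD, ?_⟩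
    rw [eLpNorm_indicator_eq_eLpNorm_restrict hD,
      eLpNorm_eq_lintegral_rpow_enorm_toReal (by norm_num) (by norm_num)]
    refine ENNReal.rpow_lt_top_of_nonneg (by norm_num) ?_
    simpa using hGD.ne
  have h1 := hlim _ hψ ⟨R, fun p hp => indicator_of_notMem (fun h => by
    have := hDR h
    rw [mem_closedBall_zero_iff] at this
    linarith) _⟩
  have e1 : ∀ g : U → ℝ, ∫ p, D.indicator G p * g p ∂μ = ∫ p in D, G p * g p ∂μ := fun g => by
    rw [← integral_indicator hD]
    congr 1 with p
    by_cases hp : p ∈ D <;> simp [hp]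
  simp only [e1] at h1
  have h2 : ∫ p in D, G p * G p ∂μ ≤ 1 / 2 * ∫ p in D, G p ^ 2 ∂μ + 1 / 2 * c := by
    refine le_of_tendsto h1 (Eventually.of_forall fun n => ?_)
    have h3 : ∫ p in D, G p * q n p ∂μ ≤ ∫ p in D, (1 / 2 * G p ^ 2 + 1 / 2 * q n p ^ 2) ∂μ := by
      have hdom : Integrable (fun p => 1 / 2 * G p ^ 2 + 1 / 2 * q n p ^ 2) (μ.restrict D) :=
        (iG.const_mul _).add ((iq n).const_mul _)
      refine integral_mono (hdom.mono' (hG.aestronglyMeasurable.mul (hq n).restrict)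
        (Eventually.of_forall fun p => ?_)) hdom fun p => ?_
      · rw [Real.norm_eq_abs, abs_le]
        constructor <;> nlinarith [sq_nonneg (G p + q n p), sq_nonneg (G p - q n p)]
      · simp only
        nlinarith [sq_nonneg (G p - q n p)]
    rw [integral_add (iG.const_mul _) ((iq n).const_mul _), integral_const_mul,
      integral_const_mul] at h3
    linarith [hqc n]
  simp only [← pow_two] at h2
  rw [← ofReal_integral_sq iG]
  exact ENNReal.ofReal_le_ofReal (by linarith)

/-! ### Weak limits of difference quotients -/

instance isAddHaarMeasure_volume_phaseSpace : (volume : Measure (E3 × E3)).IsAddHaarMeasure :=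
  inferInstanceAs ((volume : Measure E3).prod (volume : Measure E3)).IsAddHaarMeasure

/-- The difference quotient of `f` in direction `e` with step `1 / (n + 1)`. -/
noncomputable def diffQuotient {U : Type*} [NormedAddCommGroup U] [NormedSpace ℝ U] (f : U → ℝ)
    (e : U) (n : ℕ) (p : U) : ℝ := ((n : ℝ) + 1) * (f (p + ((n : ℝ) + 1)⁻¹ • e) - f p)

/-- Difference quotients converge to the derivative in the sense of distributions. -/
lemma tendsto_integral_diffQuotient {U : Type*} [NormedAddCommGroup U] [NormedSpace ℝ U]
    [FiniteDimensional ℝ U] [MeasurableSpace U] [BorelSpace U] {μ : Measure U} [μ.IsAddHaarMeasure]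
    {f : U → ℝ} (hf : Continuous f) (e : U) {ψ : U → ℝ} (hψ : ContDiff ℝ ∞ ψ)
    (hc : HasCompactSupport ψ) :
    Tendsto (fun n => ∫ p, ψ p * diffQuotient f e n p ∂μ) atTop
      (𝓝 (- ∫ p, fderiv ℝ ψ p e * f p ∂μ)) := by
  have hψc := hψ.continuous
  set r : ℕ → ℝ := fun n => (n : ℝ) + 1 with hr
  have hr0 : ∀ n, 0 < r n := fun n => by positivity
  have e1 : ∀ n, ∫ p, ψ p * diffQuotient f e n p ∂μ =
      ∫ p, r n * (ψ (p + (r n)⁻¹ • (-e)) - ψ p) * f p ∂μ := by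
    intro n
    have i1 : Integrable (fun p => r n * (ψ p * f (p + (r n)⁻¹ • e))) μ :=
      ((show Continuous fun p => ψ p * f (p + (r n)⁻¹ • e) by fun_prop).integrable_of_hasCompactSupport
        hc.mul_right).const_mul _
    have i2 : Integrable (fun p => r n * (ψ p * f p)) μ :=
      ((hψc.mul hf).integrable_of_hasCompactSupport hc.mul_right).const_mul _
    have i3 : Integrable (fun p => r n * (ψ (p + (r n)⁻¹ • (-e)) * f p)) μ := by
      have := i1.comp_add_right ((r n)⁻¹ • (-e))
      simpa [add_assoc] using this
    have h1 : ∫ p, r n * (ψ p * f (p + (r n)⁻¹ • e)) ∂μ =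
        ∫ p, r n * (ψ (p + (r n)⁻¹ • (-e)) * f p) ∂μ := by
      rw [← integral_add_right_eq_self _ ((r n)⁻¹ • (-e))]
      simp [add_assoc]
    calc ∫ p, ψ p * diffQuotient f e n p ∂μ
        = ∫ p, (r n * (ψ p * f (p + (r n)⁻¹ • e)) - r n * (ψ p * f p)) ∂μ := by
          congr 1 with p
          simp only [diffQuotient, hr]
          ring
      _ = ∫ p, (r n * (ψ (p + (r n)⁻¹ • (-e)) * f p) - r n * (ψ p * f p)) ∂μ := by
          rw [integral_sub i1 i2, integral_sub i3 i2, h1]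
      _ = _ := by
          congr 1 with p
          ring
  simp only [e1]
  rw [← integral_neg]
  obtain ⟨C, hC⟩ := hψ.lipschitzWith_of_hasCompactSupport hc (by simp)
  obtain ⟨R, hR⟩ := hc.isCompact.isBounded.subset_closedBall (0 : U)
  set K := Metric.closedBall (0 : U) (R + ‖e‖) with hK
  have hzero : ∀ p, p ∉ tsupport ψ → ψ p = 0 := fun p hp => image_eq_zero_of_notMem_tsupport hp
  refine tendsto_integral_of_dominated_convergence
    (K.indicator fun p => (C : ℝ) * ‖e‖ * ‖f p‖) ?_ ?_ ?_ ?_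
  · intro n
    exact Continuous.aestronglyMeasurable (by fun_prop)
  · rw [integrable_indicator_iff Metric.isClosed_closedBall.measurableSet]
    exact ((continuous_const.mul hf.norm).continuousOn).integrableOn_compact
      (isCompact_closedBall _ _)
  · intro n
    refine Eventually.of_forall fun p => ?_
    by_cases hp : p ∈ K
    · rw [indicator_of_mem hp, norm_mul, norm_mul, Real.norm_of_nonneg (hr0 n).le]
      have h1 := hC.dist_le_mul (p + (r n)⁻¹ • (-e)) p
      rw [dist_eq_norm, dist_eq_norm, add_sub_cancel_left, norm_smul, norm_neg, norm_inv,
        Real.norm_of_nonneg (hr0 n).le] at h1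
      have h2 : r n * ‖ψ (p + (r n)⁻¹ • (-e)) - ψ p‖ ≤ C * ‖e‖ := by
        calc r n * ‖ψ (p + (r n)⁻¹ • (-e)) - ψ p‖ ≤ r n * (C * ((r n)⁻¹ * ‖e‖)) :=
              mul_le_mul_of_nonneg_left h1 (hr0 n).le
          _ = C * ‖e‖ := by
              field_simp [(hr0 n).ne']
      exact mul_le_mul_of_nonneg_right h2 (norm_nonneg _)
    · rw [indicator_of_notMem hp]
      rw [hK, mem_closedBall_zero_iff, not_le] at hp
      have h1 : ψ p = 0 := hzero p fun h => by
        have := hR h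
        rw [mem_closedBall_zero_iff] at this
        linarith [norm_nonneg e]
      have h2 : ψ (p + (r n)⁻¹ • (-e)) = 0 := hzero _ fun h => by
        have := hR h
        rw [mem_closedBall_zero_iff] at this
        have h3 : ‖p‖ ≤ ‖p + (r n)⁻¹ • (-e)‖ + ‖(r n)⁻¹ • (-e)‖ := by
          simpa using norm_sub_le (p + (r n)⁻¹ • (-e)) ((r n)⁻¹ • (-e))
        have h4 : ‖(r n)⁻¹ • (-e)‖ ≤ ‖e‖ := by
          rw [norm_smul, norm_neg, norm_inv, Real.norm_of_nonneg (hr0 n).le]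
          refine mul_le_of_le_one_left (norm_nonneg _) (inv_le_one_of_one_le₀ ?_)
          simp [hr]
        linarith
      rw [h1, h2]
      simp
  · refine Eventually.of_forall fun p => ?_
    have hd := (hψ.differentiable (by simp) p).hasFDerivAt
    have h1 : Tendsto (fun n : ℕ => r n • (ψ (p + (r n)⁻¹ • (-e)) - ψ p)) atTop
        (𝓝 (fderiv ℝ ψ p (-e))) := hd.lim (-e) (by
      simp only [hr]
      refine tendsto_norm_atTop_atTop.comp ?_
      exact tendsto_atTop_add_const_right _ _ tendsto_natCast_atTop_atTop)
    simpa using h1.mul_const (f p)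

/-- If the difference quotients of `f` in direction `e` are bounded in `L²` on all balls of the slices
`{v = const}`, then `f` has a weak derivative in direction `e` that satisfies the same bounds on
almost every slice. -/
lemma exists_weak_partial_slices {f : E3 × E3 → ℝ} (hf : Continuous f) (e : E3 × E3)
    {c : ℕ → ℝ} (hc0 : ∀ N, 0 ≤ c N)
    (hc : ∀ (N : ℕ) (x₀ v : E3) (n : ℕ), ∫⁻ x in Metric.closedBall x₀ N,
      ‖diffQuotient f e n (x, v)‖ₑ ^ 2 ≤ ENNReal.ofReal (c N)) :
    ∃ G : E3 × E3 → ℝ, StronglyMeasurable G ∧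
      (∀ R : ℕ, ∫⁻ p in Metric.closedBall 0 R, ‖G p‖ₑ ^ 2 < ⊤) ∧
      (∀ ψ : E3 × E3 → ℝ, ContDiff ℝ ∞ ψ → HasCompactSupport ψ →
        ∫ p, fderiv ℝ ψ p e * f p = - ∫ p, ψ p * G p) ∧
      ∀ (N : ℕ) (x₀ : E3), ∀ᵐ v : E3, ∫⁻ x in Metric.closedBall x₀ N, ‖G (x, v)‖ₑ ^ 2 ≤
        ENNReal.ofReal (c N) := by
  have hqc : ∀ n, Continuous (diffQuotient f e n) := fun n => by
    unfold diffQuotient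
    fun_prop
  have hprod : ∀ (g : E3 × E3 → ℝ≥0∞), Measurable g → ∀ (D S : Set E3),
      ∫⁻ p in D ×ˢ S, g p = ∫⁻ v in S, ∫⁻ x in D, g (x, v) := by
    intro g hg D S
    rw [Measure.volume_eq_prod, ← Measure.prod_restrict, lintegral_prod_symm' _ hg]
  have hD : ∀ (N : ℕ) (x₀ : E3) (S : Set E3) (n : ℕ),
      ∫⁻ p in Metric.closedBall x₀ N ×ˢ S, ‖diffQuotient f e n p‖ₑ ^ 2 ≤
        ENNReal.ofReal (c N) * volume S := by
    intro N x₀ S n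
    rw [hprod _ ((hqc n).measurable.enorm.pow_const 2)]
    calc _ ≤ ∫⁻ _v in S, ENNReal.ofReal (c N) := lintegral_mono fun v => hc N x₀ v n
      _ = _ := by simp
  obtain ⟨𝓕, h𝓕, G, hGm, hG2, hlim⟩ := exists_weak_limit_locL2 (μ := (volume : Measure (E3 × E3)))
    (q := diffQuotient f e)
    (fun n => (hqc n).aestronglyMeasurable) (fun R => by
      refine ⟨c R * (volume (Metric.closedBall (0 : E3) R)).toReal, fun n => ?_⟩
      have h1 : Metric.closedBall (0 : E3 × E3) R =
          Metric.closedBall (0 : E3) R ×ˢ Metric.closedBall (0 : E3) R := by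
        rw [closedBall_prod_same]
        rfl
      rw [h1, ENNReal.ofReal_mul (hc0 R), ENNReal.ofReal_toReal measure_closedBall_lt_top.ne]
      exact hD R 0 _ n)
  refine ⟨G, hGm, hG2, fun ψ hψ hψc => ?_, fun N x₀ => ?_⟩
  · have h1 := (tendsto_integral_diffQuotient (μ := volume) hf e hψ hψc).mono_left h𝓕
    obtain ⟨R, hR⟩ := hψc.isCompact.isBounded.subset_closedBall (0 : E3 × E3)
    have h2 := hlim ψ (hψ.continuous.memLp_of_hasCompactSupport hψc) ⟨⌈R⌉₊, fun p hp => by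
      refine image_eq_zero_of_notMem_tsupport fun h => ?_
      have := hR h
      rw [mem_closedBall_zero_iff] at this
      linarith [Nat.le_ceil R]⟩
    have := tendsto_nhds_unique h1 h2
    linarith
  · have hΦ : Measurable fun v => ∫⁻ x in Metric.closedBall x₀ N, ‖G (x, v)‖ₑ ^ 2 :=
      Measurable.lintegral_prod_left' (hGm.measurable.enorm.pow_const 2)
    have hM : ∀ M : ℕ, ∀ᵐ v ∂(volume.restrict (Metric.closedBall (0 : E3) M)),
        ∫⁻ x in Metric.closedBall x₀ N, ‖G (x, v)‖ₑ ^ 2 ≤ ENNReal.ofReal (c N) := by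
      intro M
      refine ae_le_of_forall_setLIntegral_le_of_sigmaFinite hΦ (g := fun _ => ENNReal.ofReal (c N))
        fun S hS _ => ?_
      rw [Measure.restrict_restrict hS, ← hprod _ (hGm.measurable.enorm.pow_const 2),
        setLIntegral_const]
      have hfin : volume (S ∩ Metric.closedBall (0 : E3) M) < ⊤ :=
        (measure_mono inter_subset_right).trans_lt measure_closedBall_lt_top
      have hsub : Metric.closedBall x₀ N ×ˢ (S ∩ Metric.closedBall (0 : E3) M) ⊆
          Metric.closedBall (0 : E3 × E3) (⌈‖x₀‖ + N + M⌉₊ : ℕ) := by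
        rintro ⟨x, v⟩ ⟨hx, -, hv⟩
        rw [mem_closedBall_zero_iff] at hv ⊢
        rw [Metric.mem_closedBall, dist_eq_norm] at hx
        have h1 : ‖x‖ ≤ ‖x - x₀‖ + ‖x₀‖ := by simpa using norm_add_le (x - x₀) x₀
        refine le_trans (max_le ?_ ?_) (Nat.le_ceil _)
        · simp only at hx h1 ⊢
          linarith [(Nat.cast_nonneg M : (0 : ℝ) ≤ M)]
        · simp only at hv ⊢
          linarith [norm_nonneg x₀, (Nat.cast_nonneg N : (0 : ℝ) ≤ N)]
      have := setLIntegral_sq_le_of_weak_limit (fun n => (hqc n).aestronglyMeasurable) hGm hG2 hlim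
        (Metric.isClosed_closedBall.measurableSet.prod
          (hS.inter Metric.isClosed_closedBall.measurableSet)) hsub
        (c := c N * (volume (S ∩ Metric.closedBall (0 : E3) M)).toReal)
        (mul_nonneg (hc0 N) ENNReal.toReal_nonneg) (fun n => by
          rw [ENNReal.ofReal_mul (hc0 N), ENNReal.ofReal_toReal hfin.ne]
          exact hD N x₀ _ n)
      rwa [ENNReal.ofReal_mul (hc0 N), ENNReal.ofReal_toReal hfin.ne] at this
    have hM' : ∀ᵐ v : E3, ∀ M : ℕ, v ∈ Metric.closedBall (0 : E3) M →
        ∫⁻ x in Metric.closedBall x₀ N, ‖G (x, v)‖ₑ ^ 2 ≤ ENNReal.ofReal (c N) :=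
      ae_all_iff.2 fun M => (ae_restrict_iff' Metric.isClosed_closedBall.measurableSet).1 (hM M)
    filter_upwards [hM'] with v hv
    exact hv ⌈‖v‖⌉₊ (by simpa using Nat.le_ceil ‖v‖)

/-! ### Weak derivatives bounded in `L²` on slices -/

lemma HasWeakDeriv.congr_ae {U W : Type*} [NormedAddCommGroup U] [NormedSpace ℝ U]
    [MeasureSpace U] [NormedAddCommGroup W] [NormedSpace ℝ W] {f : U → W} {G G' : U → (U →L[ℝ] W)}
    (h : HasWeakDeriv f G) (hG : G =ᵐ[volume] G') : HasWeakDeriv f G' := by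
  refine ⟨h.1, fun x => ?_, fun ψ hψ hc e => ?_⟩
  · obtain ⟨s, hs, hi⟩ := h.2.1 x
    exact ⟨s, hs, hi.congr (ae_restrict_of_ae hG)⟩
  · rw [h.2.2 ψ hψ hc e]
    congr 1
    refine integral_congr_ae ?_
    filter_upwards [hG] with p hp
    rw [hp]

lemma locallyIntegrable_of_sq {U : Type*} [NormedAddCommGroup U] [NormedSpace ℝ U]
    [FiniteDimensional ℝ U] [MeasurableSpace U] [BorelSpace U] {μ : Measure U}
    [IsFiniteMeasureOnCompacts μ] {G : U → ℝ}
    (hG : StronglyMeasurable G) (h : ∀ R : ℕ, ∫⁻ p in Metric.closedBall 0 R, ‖G p‖ₑ ^ 2 ∂μ < ⊤) :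
    LocallyIntegrable G μ := by
  intro x
  obtain ⟨R, hR⟩ := exists_nat_gt ‖x‖
  refine ⟨Metric.closedBall 0 R, ?_, ?_⟩
  · refine mem_of_superset (Metric.isOpen_ball.mem_nhds ?_) Metric.ball_subset_closedBall
    rwa [mem_ball_zero_iff]
  · have i1 := integrable_sq_of_lintegral hG.aestronglyMeasurable (h R)
    have i2 : IntegrableOn (fun _ : U => (1 : ℝ)) (Metric.closedBall 0 R) μ :=
      integrableOn_const (isCompact_closedBall _ _).measure_ne_top
    refine Integrable.mono' (i2.add i1) hG.aestronglyMeasurable (Eventually.of_forall fun p => ?_)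
    simp only [Pi.add_apply, Real.norm_eq_abs]
    rw [abs_le]
    constructor <;> nlinarith [sq_nonneg (G p + 1), sq_nonneg (G p - 1)]

lemma eq_of_forall_ae_bad {P : E3 → Prop} (h : ∀ᵐ v, P v) :
    ∃ N : Set E3, MeasurableSet N ∧ volume N = 0 ∧ ∀ v ∉ N, P v := by
  refine ⟨toMeasurable volume {v | ¬ P v}, measurableSet_toMeasurable _ _, ?_, fun v hv => ?_⟩
  · rw [measure_toMeasurable]
    exact h
  · by_contra hP
    exact hv (subset_toMeasurable _ _ hP)

lemma locallyIntegrable_sum_smul {U F ι : Type*} [NormedAddCommGroup U] [NormedSpace ℝ U]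
    [FiniteDimensional ℝ U] [MeasurableSpace U] {μ : Measure U} [NormedAddCommGroup F]
    [NormedSpace ℝ F] [Fintype ι] {G : ι → U → ℝ} (hG : ∀ i, LocallyIntegrable (G i) μ)
    (S : ι → F) : LocallyIntegrable (fun p => ∑ i, G i p • S i) μ := by
  have : ProperSpace U := FiniteDimensional.proper ℝ U
  rw [locallyIntegrable_iff]
  intro k hk
  refine integrable_finsetSum _ fun i _ => Integrable.smul_const ?_ _
  exact (hG i).integrableOn_isCompact hk

/-- Weak directional derivatives of the coordinates of `f` assemble to a weak derivative. The families
`(d, m)` and `(b, l)` are bases with their coordinate functionals. -/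
lemma hasWeakDeriv_of_partials {U W ι κ : Type*} [NormedAddCommGroup U] [NormedSpace ℝ U]
    [FiniteDimensional ℝ U] [MeasureSpace U] [BorelSpace U]
    [IsFiniteMeasureOnCompacts (volume : Measure U)] [NormedAddCommGroup W] [NormedSpace ℝ W]
    [FiniteDimensional ℝ W] [Fintype ι] [Fintype κ] {d : κ → U} {m : κ → (U →L[ℝ] ℝ)}
    (hm : ∀ e, ∑ j, m j e • d j = e) {b : ι → W} {l : ι → (W →L[ℝ] ℝ)}
    (hl : ∀ w, ∑ i, l i w • b i = w) {f : U → W} (hf : Continuous f) {G : ι × κ → U → ℝ}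
    (hG : ∀ i, LocallyIntegrable (G i) volume)
    (hw : ∀ i, ∀ ψ : U → ℝ, ContDiff ℝ ∞ ψ → HasCompactSupport ψ →
      ∫ p, fderiv ℝ ψ p (d i.2) * l i.1 (f p) = - ∫ p, ψ p * G i p) :
    HasWeakDeriv f fun p => ∑ i, G i p • (m i.2).smulRight (b i.1) := by
  refine ⟨hf.locallyIntegrable, ?_, fun ψ hψ hψc e => ?_⟩
  · exact locallyIntegrable_sum_smul hG fun i => (m i.2).smulRight (b i.1)
  · have e1 : ∀ p, fderiv ℝ ψ p e • f p =
        ∑ i : ι × κ, (m i.2 e * (fderiv ℝ ψ p (d i.2) * l i.1 (f p))) • b i.1 := by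
      intro p
      have h1 := congrArg (fderiv ℝ ψ p) (hm e)
      rw [map_sum] at h1
      calc fderiv ℝ ψ p e • f p
          = (∑ j, fderiv ℝ ψ p (m j e • d j)) • ∑ i, l i (f p) • b i := by
            rw [h1, hl]
        _ = _ := by
            rw [Finset.sum_smul_sum, Finset.sum_comm, Fintype.sum_prod_type]
            refine Finset.sum_congr rfl fun i _ => Finset.sum_congr rfl fun j _ => ?_
            rw [map_smul, smul_smul, smul_eq_mul, mul_assoc]
    have e2 : ∀ p, ψ p • (∑ i, G i p • (m i.2).smulRight (b i.1)) e =
        ∑ i : ι × κ, (m i.2 e * (ψ p * G i p)) • b i.1 := by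
      intro p
      rw [sum_apply, Finset.smul_sum]
      refine Finset.sum_congr rfl fun i _ => ?_
      rw [smul_apply, ContinuousLinearMap.smulRight_apply, smul_smul, smul_smul]
      congr 1
      ring
    have hψ1 : Continuous (fderiv ℝ ψ) := hψ.continuous_fderiv (by simp)
    have i1 : ∀ i : ι × κ, Integrable fun p => m i.2 e * (fderiv ℝ ψ p (d i.2) * l i.1 (f p)) :=
      fun i => ((show Continuous fun p => fderiv ℝ ψ p (d i.2) * l i.1 (f p) by
        fun_prop).integrable_of_hasCompactSupport
        (hψc.fderiv_apply (𝕜 := ℝ) (d i.2)).mul_right).const_mul _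
    have i2 : ∀ i : ι × κ, Integrable fun p => m i.2 e * (ψ p * G i p) := fun i =>
      ((hG i).integrable_smul_left_of_hasCompactSupport hψ.continuous hψc).const_mul _
    simp only [e1, e2]
    rw [integral_finsetSum _ fun i _ => (i1 i).smul_const _,
      integral_finsetSum _ fun i _ => (i2 i).smul_const _, ← Finset.sum_neg_distrib]
    refine Finset.sum_congr rfl fun i _ => ?_
    rw [integral_smul_const, integral_smul_const, integral_const_mul, integral_const_mul,
      hw i ψ hψ hψc, ← neg_smul]
    congr 1
    ring

lemma exists_basis_norm_le_one :
    ∃ d : Module.Basis (Fin 3 ⊕ Fin 3) ℝ (E3 × E3), ∀ j, ‖d j‖ ≤ 1 := by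
  refine ⟨(EuclideanSpace.basisFun (Fin 3) ℝ).toBasis.prod
    (EuclideanSpace.basisFun (Fin 3) ℝ).toBasis, ?_⟩
  rintro (j | j) <;> simp [Prod.norm_def]

/-- A continuous function on phase space whose increments are bounded in `L²` on balls of the slices
`{v = const}`, linearly in the shift, has a weak derivative that is bounded in `L²` on the same
balls. The representative vanishes on the exceptional slices. -/
lemma exists_hasWeakDeriv_slices (W : Type*) [NormedAddCommGroup W] [NormedSpace ℝ W]
    [FiniteDimensional ℝ W] : ∃ κ : ℝ, ∀ (f : E3 × E3 → W) (c : ℕ → ℝ), Continuous f →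
      (∀ N, 0 ≤ c N) → (∀ (N : ℕ) (x₀ v : E3) (e : E3 × E3), ‖e‖ ≤ 1 →
        ∫⁻ x in Metric.closedBall x₀ N, ‖f ((x, v) + e) - f (x, v)‖ₑ ^ 2 ≤
          ENNReal.ofReal (c N * ‖e‖ ^ 2)) →
      ∃ G : E3 × E3 → (E3 × E3 →L[ℝ] W), HasWeakDeriv f G ∧
        ∀ (N : ℕ) (x₀ v : E3), ∫⁻ x in Metric.closedBall x₀ N, ‖G (x, v)‖ₑ ^ 2 ≤
          ENNReal.ofReal (κ * c (N + 1)) := by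
  classical
  obtain ⟨b⟩ : Nonempty (Module.Basis (Fin (Module.finrank ℝ W)) ℝ W) := ⟨Module.finBasis ℝ W⟩
  obtain ⟨d, hd1⟩ := exists_basis_norm_le_one
  set l : Fin (Module.finrank ℝ W) → (W →L[ℝ] ℝ) := fun i => (b.coord i).toContinuousLinearMap
  set m : Fin 3 ⊕ Fin 3 → (E3 × E3 →L[ℝ] ℝ) := fun j => (d.coord j).toContinuousLinearMap
  set ι := Fin (Module.finrank ℝ W) × (Fin 3 ⊕ Fin 3)
  set K : ℝ := ∑ i, ‖l i‖ with hK
  have hlK : ∀ i, ‖l i‖ ≤ K := fun i =>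
    Finset.single_le_sum (f := fun i => ‖l i‖) (fun i _ => norm_nonneg _) (Finset.mem_univ i)
  have hK0 : 0 ≤ K := Finset.sum_nonneg fun i _ => norm_nonneg _
  set S : ι → (E3 × E3 →L[ℝ] W) := fun i => (m i.2).smulRight (b i.1) with hS
  set D : ℝ := ∑ i, ‖S i‖ with hDdef
  have hD0 : 0 ≤ D := Finset.sum_nonneg fun i _ => norm_nonneg _
  have hSD : ∀ i, ‖S i‖ ≤ D := fun i =>
    Finset.single_le_sum (f := fun i => ‖S i‖) (fun i _ => norm_nonneg _) (Finset.mem_univ i)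
  set Q : ℝ := (Fintype.card ι : ℝ) with hQ
  have hQ0 : 0 ≤ Q := Nat.cast_nonneg _
  refine ⟨D ^ 2 * Q * (Q * K ^ 2), fun f c hf hc0 hinc => ?_⟩
  have hex : ∀ i : ι, _ := fun i => exists_weak_partial_slices (f := fun p => l i.1 (f p))
    (by fun_prop) (d i.2) (c := fun N => K ^ 2 * c N) (fun N => mul_nonneg (sq_nonneg K) (hc0 N))
    (fun N x₀ v n => by
      set r : ℝ := (n : ℝ) + 1 with hr
      have hr0 : 0 < r := by positivity
      have hr1 : ‖r⁻¹ • d i.2‖ ≤ r⁻¹ := by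
        rw [norm_smul, Real.norm_of_nonneg (inv_pos.2 hr0).le]
        exact mul_le_of_le_one_right (inv_pos.2 hr0).le (hd1 _)
      have hr2 : ‖r⁻¹ • d i.2‖ ≤ 1 := hr1.trans (inv_le_one_of_one_le₀ (by simp [hr]))
      calc ∫⁻ x in Metric.closedBall x₀ N, ‖diffQuotient (fun p => l i.1 (f p)) (d i.2) n (x, v)‖ₑ ^ 2
          ≤ ∫⁻ x in Metric.closedBall x₀ N, ENNReal.ofReal ((r * K) ^ 2) *
              ‖f ((x, v) + r⁻¹ • d i.2) - f (x, v)‖ₑ ^ 2 := by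
            refine lintegral_mono fun x => ?_
            rw [← ofReal_norm, ← ofReal_norm, ← ENNReal.ofReal_pow (norm_nonneg _),
              ← ENNReal.ofReal_pow (norm_nonneg _), ← ENNReal.ofReal_mul (by positivity), ← mul_pow]
            refine ENNReal.ofReal_le_ofReal (pow_le_pow_left₀ (norm_nonneg _) ?_ 2)
            unfold diffQuotient
            rw [norm_mul, ← hr, Real.norm_of_nonneg hr0.le, ← map_sub, mul_assoc]
            exact mul_le_mul_of_nonneg_left ((l i.1).le_of_opNorm_le (hlK _) _) hr0.le
        _ = ENNReal.ofReal ((r * K) ^ 2) * ∫⁻ x in Metric.closedBall x₀ N,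
              ‖f ((x, v) + r⁻¹ • d i.2) - f (x, v)‖ₑ ^ 2 :=
            lintegral_const_mul' _ _ ENNReal.ofReal_ne_top
        _ ≤ ENNReal.ofReal ((r * K) ^ 2) * ENNReal.ofReal (c N * ‖r⁻¹ • d i.2‖ ^ 2) := by
            gcongr
            exact hinc N x₀ v _ hr2
        _ ≤ ENNReal.ofReal ((r * K) ^ 2) * ENNReal.ofReal (c N * r⁻¹ ^ 2) := by
            gcongr
            exact hc0 N
        _ = ENNReal.ofReal (K ^ 2 * c N) := by
            rw [← ENNReal.ofReal_mul (by positivity)]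
            congr 1
            field_simp [hr0.ne'])
  choose G hGm hG2 hGw hGs using hex
  have hGl : ∀ i, LocallyIntegrable (G i) volume := fun i => locallyIntegrable_of_sq (hGm i) (hG2 i)
  -- Countably many balls need only one null set `B` of exceptional slices. A ball of radius `N` with
  -- arbitrary centre lies in a ball of radius `N + 1` with centre in the dense sequence.
  set x : ℕ → E3 := TopologicalSpace.denseSeq E3 with hx
  have hae : ∀ᵐ v : E3, ∀ (i : ι) (N k : ℕ), ∫⁻ y in Metric.closedBall (x k) N, ‖G i (y, v)‖ₑ ^ 2 ≤
      ENNReal.ofReal (K ^ 2 * c N) :=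
    ae_all_iff.2 fun i => ae_all_iff.2 fun N => ae_all_iff.2 fun k => hGs i N (x k)
  obtain ⟨B, hBm, hB0, hB⟩ := eq_of_forall_ae_bad hae
  set H : E3 × E3 → (E3 × E3 →L[ℝ] W) := fun p => ∑ i, G i p • S i with hH
  have hHw : HasWeakDeriv f H := hasWeakDeriv_of_partials (fun e => d.sum_repr e)
    (fun w => b.sum_repr w) hf hGl hGw
  refine ⟨fun p => if p.2 ∈ B then 0 else H p, hHw.congr_ae ?_, fun N x₀ v => ?_⟩
  · have h1 : ∀ᵐ p : E3 × E3, p.2 ∉ B :=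
      Measure.quasiMeasurePreserving_snd.ae (measure_eq_zero_iff_ae_notMem.1 hB0)
    filter_upwards [h1] with p hp
    rw [if_neg hp]
  · by_cases hv : v ∈ B
    · have h0 : ∀ (F : Type _) [NormedAddCommGroup F] (s : Set E3),
          ∫⁻ _y in s, ‖(0 : F)‖ₑ ^ 2 = 0 := by simp
      simp only [hv, if_true]
      exact (h0 _ _).le.trans zero_le
    · simp only [hv, if_false]
      obtain ⟨k, hk⟩ : ∃ k, dist x₀ (x k) < 1 :=
        (TopologicalSpace.denseRange_denseSeq E3).exists_dist_lt x₀ one_pos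
      have hsub : Metric.closedBall x₀ N ⊆ Metric.closedBall (x k) ((N + 1 : ℕ) : ℝ) := by
        refine Metric.closedBall_subset_closedBall' ?_
        push_cast
        linarith
      have hpt : ∀ y, ‖H (y, v)‖ₑ ^ 2 ≤ ∑ i, ENNReal.ofReal (D ^ 2 * Q) * ‖G i (y, v)‖ₑ ^ 2 := by
        intro y
        have h1 : ‖H (y, v)‖ ≤ D * ∑ i, ‖G i (y, v)‖ := by
          rw [Finset.mul_sum]
          refine (norm_sum_le _ _).trans (Finset.sum_le_sum fun i _ => ?_)
          rw [norm_smul, mul_comm]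
          gcongr
          exact hSD i
        have h2 := sq_sum_le_card_mul_sum_sq (s := (Finset.univ : Finset ι))
          (f := fun i => ‖G i (y, v)‖)
        have h3 : ‖H (y, v)‖ ^ 2 ≤ ∑ i, D ^ 2 * Q * ‖G i (y, v)‖ ^ 2 := by
          calc ‖H (y, v)‖ ^ 2 ≤ (D * ∑ i, ‖G i (y, v)‖) ^ 2 :=
                pow_le_pow_left₀ (norm_nonneg _) h1 2
            _ = D ^ 2 * (∑ i, ‖G i (y, v)‖) ^ 2 := by ring
            _ ≤ D ^ 2 * (Q * ∑ i, ‖G i (y, v)‖ ^ 2) :=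
                mul_le_mul_of_nonneg_left h2 (sq_nonneg D)
            _ = _ := by rw [← mul_assoc, Finset.mul_sum]
        rw [← ofReal_norm, ← ENNReal.ofReal_pow (norm_nonneg _)]
        refine (ENNReal.ofReal_le_ofReal h3).trans_eq ?_
        rw [ENNReal.ofReal_sum_of_nonneg fun i _ => by positivity]
        refine Finset.sum_congr rfl fun i _ => ?_
        rw [ENNReal.ofReal_mul (by positivity), ENNReal.ofReal_pow (norm_nonneg _), ofReal_norm]
      have hmeas : ∀ i, Measurable fun y => ‖G i (y, v)‖ₑ ^ 2 := fun i =>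
        ((hGm i).measurable.comp measurable_prodMk_right).enorm.pow_const 2
      calc ∫⁻ y in Metric.closedBall x₀ N, ‖H (y, v)‖ₑ ^ 2
          ≤ ∫⁻ y in Metric.closedBall (x k) ((N + 1 : ℕ) : ℝ),
              ∑ i, ENNReal.ofReal (D ^ 2 * Q) * ‖G i (y, v)‖ₑ ^ 2 :=
            (lintegral_mono_set hsub).trans (lintegral_mono hpt)
        _ = ∑ i, ENNReal.ofReal (D ^ 2 * Q) *
              ∫⁻ y in Metric.closedBall (x k) ((N + 1 : ℕ) : ℝ), ‖G i (y, v)‖ₑ ^ 2 := by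
            rw [lintegral_finsetSum _ fun i _ => (hmeas i).const_mul _]
            exact Finset.sum_congr rfl fun i _ => lintegral_const_mul _ (hmeas i)
        _ ≤ ∑ _i : ι, ENNReal.ofReal (D ^ 2 * Q) * ENNReal.ofReal (K ^ 2 * c (N + 1)) := by
            gcongr with i _
            exact hB v hv i (N + 1) k
        _ = ENNReal.ofReal (D ^ 2 * Q * (Q * K ^ 2) * c (N + 1)) := by
            rw [Finset.sum_const, Finset.card_univ, nsmul_eq_mul,
              ← ENNReal.ofReal_mul (by positivity), ← ENNReal.ofReal_natCast,
              ← ENNReal.ofReal_mul (Nat.cast_nonneg _)]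
            congr 1
            simp only [hQ]
            ring

/-! ### Lipschitz bounds from weak derivatives -/

lemma ae_norm_le_of_eLpNorm_top_le {U W : Type*} [MeasureSpace U] [NormedAddCommGroup W] {g : U → W}
    {B : ℝ} (h : eLpNorm g ⊤ volume ≤ ENNReal.ofReal B) (hB : 0 ≤ B) : ∀ᵐ p, ‖g p‖ ≤ B := by
  filter_upwards [enorm_ae_le_eLpNormEssSup g (volume : Measure U)] with p hp
  have h2 : ‖g p‖ₑ ≤ ENNReal.ofReal B := hp.trans (by simpa using h)
  rwa [← ofReal_norm, ENNReal.ofReal_le_ofReal_iff hB] at h2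

section WeakLipschitz

variable {U : Type*} [NormedAddCommGroup U] [NormedSpace ℝ U] [MeasureSpace U]

/-- `f` is bounded by `B` and Lipschitz continuous with constant `B`, up to null sets that may depend
on the shift. Unlike the bound on the weak derivative, this passes directly to integrals over
fibres. -/
def BoundedLipschitzAE (f : U → ℝ) (B : ℝ) : Prop :=
  AEStronglyMeasurable f volume ∧ (∀ᵐ p, |f p| ≤ B) ∧ ∀ e, ∀ᵐ p, |f (p + e) - f p| ≤ B * ‖e‖

lemma BoundedLipschitzAE.const_mul {f : U → ℝ} {B : ℝ} (h : BoundedLipschitzAE f B) {c : ℝ}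
    (hc : 0 ≤ c) : BoundedLipschitzAE (fun p => c * f p) (c * B) := by
  refine ⟨h.1.const_mul c, ?_, fun e => ?_⟩
  · filter_upwards [h.2.1] with p hp
    rw [abs_mul, abs_of_nonneg hc]
    exact mul_le_mul_of_nonneg_left hp hc
  · filter_upwards [h.2.2 e] with p hp
    rw [← mul_sub, abs_mul, abs_of_nonneg hc, mul_assoc]
    exact mul_le_mul_of_nonneg_left hp hc

lemma BoundedLipschitzAE.mono {f : U → ℝ} {B B' : ℝ} (h : BoundedLipschitzAE f B) (hB : B ≤ B') :
    BoundedLipschitzAE f B' :=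
  ⟨h.1, h.2.1.mono fun _ hp => hp.trans hB, fun e => (h.2.2 e).mono fun _ hp =>
    hp.trans (mul_le_mul_of_nonneg_right hB (norm_nonneg e))⟩

lemma BoundedLipschitzAE.add {f g : U → ℝ} {B B' : ℝ} (hf : BoundedLipschitzAE f B)
    (hg : BoundedLipschitzAE g B') : BoundedLipschitzAE (fun p => f p + g p) (B + B') := by
  refine ⟨hf.1.add hg.1, ?_, fun e => ?_⟩
  · filter_upwards [hf.2.1, hg.2.1] with p h1 h2
    exact (abs_add_le _ _).trans (add_le_add h1 h2)
  · filter_upwards [hf.2.2 e, hg.2.2 e] with p h1 h2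
    rw [show f (p + e) + g (p + e) - (f p + g p) = f (p + e) - f p + (g (p + e) - g p) by ring,
      add_mul]
    exact (abs_add_le _ _).trans (add_le_add h1 h2)

lemma BoundedLipschitzAE.sum {ι : Type*} (s : Finset ι) {f : ι → U → ℝ} {B : ι → ℝ}
    (h : ∀ i ∈ s, BoundedLipschitzAE (f i) (B i)) :
    BoundedLipschitzAE (fun p => ∑ i ∈ s, f i p) (∑ i ∈ s, B i) := by
  classical
  induction s using Finset.induction_on with
  | empty => exact ⟨by simpa using aestronglyMeasurable_const, by simp, by simp⟩
  | insert a s ha ih =>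
    simp only [Finset.sum_insert ha]
    exact (h a (Finset.mem_insert_self a s)).add
      (ih fun i hi => h i (Finset.mem_insert_of_mem hi))

variable [FiniteDimensional ℝ U] [BorelSpace U] [(volume : Measure U).IsAddHaarMeasure]

/-- A function with bounded weak derivative is Lipschitz continuous almost everywhere: its
mollifications are Lipschitz continuous and converge to it almost everywhere. -/
lemma ae_abs_sub_le_of_hasWeakDeriv {f : U → ℝ} {G : U → (U →L[ℝ] ℝ)} {L : ℝ}
    (h : HasWeakDeriv f G) (hG : ∀ᵐ p, ‖G p‖ ≤ L) (e : U) :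
    ∀ᵐ p, |f (p + e) - f p| ≤ L * ‖e‖ := by
  let η : ℕ → ContDiffBump (0 : U) := fun n =>
    ⟨1 / ((n : ℝ) + 1), 2 / ((n : ℝ) + 1), by positivity, by gcongr; norm_num⟩
  have hη : Tendsto (fun n => (η n).rOut) atTop (𝓝 0) := by
    have := (tendsto_one_div_add_atTop_nhds_zero_nat (𝕜 := ℝ)).const_mul 2
    rw [mul_zero] at this
    refine this.congr fun n => ?_
    simp only [η]
    ring
  have hη' : ∀ᶠ n in atTop, (η n).rOut ≤ 2 * (η n).rIn := Eventually.of_forall fun n => by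
    simp only [η]
    exact le_of_eq (by ring)
  have hae := ContDiffBump.ae_convolution_tendsto_right_of_locallyIntegrable (μ := volume) hη hη' h.1
  set g : ℕ → U → ℝ := fun n => (η n).normed volume ⋆[ContinuousLinearMap.lsmul ℝ ℝ, volume] f
    with hg
  have hlip : ∀ n p, ‖g n (p + e) - g n p‖ ≤ L * ‖e‖ := by
    intro n p
    set ψ := (η n).normed (volume : Measure U) with hψ
    have hψs : ContDiff ℝ ∞ ψ := (η n).contDiff_normed
    have hψc : HasCompactSupport ψ := (η n).hasCompactSupport_normed
    have hd : ∀ x, HasFDerivAt (g n) ((fderiv ℝ ψ ⋆[ContinuousLinearMap.precompL U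
        (ContinuousLinearMap.lsmul ℝ ℝ), volume] f) x) x :=
      hψc.hasFDerivAt_convolution_left _ (hψs.of_le (by simp)) h.1
    have hb : ∀ x, ‖(fderiv ℝ ψ ⋆[ContinuousLinearMap.precompL U
        (ContinuousLinearMap.lsmul ℝ ℝ), volume] f) x‖ ≤ L := by
      intro x
      have hL0 : 0 ≤ L := by
        obtain ⟨p, hp⟩ := hG.exists
        exact (norm_nonneg _).trans hp
      refine ContinuousLinearMap.opNorm_le_bound _ hL0 fun a => ?_
      set χ : U → ℝ := fun y => ψ (x - y) with hχ
      have hχs : ContDiff ℝ ∞ χ := hψs.comp (contDiff_const.sub contDiff_id)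
      have hχc : HasCompactSupport χ := hψc.comp_homeomorph (Homeomorph.subLeft x)
      have hχd : ∀ y, fderiv ℝ χ y a = - fderiv ℝ ψ (x - y) a := by
        intro y
        have h1 := ((hψs.differentiable (by simp) (x - y)).hasFDerivAt).comp y
          ((hasFDerivAt_id y).const_sub x)
        have h2 : fderiv ℝ χ y = _ := h1.fderiv
        rw [h2]
        simp
      have e1 : (fderiv ℝ ψ ⋆[ContinuousLinearMap.precompL U
          (ContinuousLinearMap.lsmul ℝ ℝ), volume] f) x a = ∫ y, χ y • G y a := by
        have hconv : ConvolutionExistsAt (fderiv ℝ ψ) f x (ContinuousLinearMap.precompL U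
          (ContinuousLinearMap.lsmul ℝ ℝ)) volume :=
          (hψc.fderiv (𝕜 := ℝ)).convolutionExists_left _ (hψs.continuous_fderiv (by simp)) h.1 x
        rw [convolution_def, ContinuousLinearMap.integral_apply hconv,
          ← integral_sub_left_eq_self _ volume x]
        simp only [ContinuousLinearMap.precompL_apply, sub_sub_cancel]
        have := h.2.2 χ hχs hχc a
        rw [← neg_eq_iff_eq_neg] at this
        rw [← this, ← integral_neg]
        congr 1 with y
        rw [hχd]
        simp
      rw [e1]
      have h1 : ∫ y, χ y * (L * ‖a‖) = L * ‖a‖ := by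
        rw [integral_mul_const, hχ, integral_sub_left_eq_self ψ volume x, (η n).integral_normed,
          one_mul]
      rw [← h1]
      refine norm_integral_le_of_norm_le
        ((hχs.continuous.integrable_of_hasCompactSupport hχc).mul_const _) ?_
      filter_upwards [hG] with y hy
      have hχ0 : 0 ≤ χ y := (η n).nonneg_normed _
      rw [norm_smul, Real.norm_of_nonneg hχ0]
      exact mul_le_mul_of_nonneg_left ((G y).le_of_opNorm_le hy a) hχ0
    have := Convex.norm_image_sub_le_of_norm_hasFDerivWithin_le
      (fun x _ => (hd x).hasFDerivWithinAt) (fun x _ => hb x) convex_univ (mem_univ p)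
      (mem_univ (p + e))
    simpa using this
  have hae' : ∀ᵐ p, Tendsto (fun n => g n (p + e)) atTop (𝓝 (f (p + e))) :=
    (quasiMeasurePreserving_add_right volume e).ae hae
  filter_upwards [hae, hae'] with p h1 h2
  exact le_of_tendsto (h2.sub h1).norm (Eventually.of_forall fun n => hlip n p)

lemma boundedLipschitzAE_of_w1InfNorm_lt {f : U → ℝ} {B : ℝ} (h : w1InfNorm f < ENNReal.ofReal B) :
    BoundedLipschitzAE f B := by
  simp only [w1InfNorm, iInf_lt_iff] at h
  obtain ⟨G, hG, hlt⟩ := h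
  have hB : 0 < B := by
    by_contra! h0
    rw [ENNReal.ofReal_of_nonpos h0] at hlt
    exact not_lt_zero hlt
  have h1 : eLpNorm f ⊤ volume ≤ ENNReal.ofReal B := le_self_add.trans hlt.le
  have h2 : eLpNorm G ⊤ volume ≤ ENNReal.ofReal B := le_add_self.trans hlt.le
  exact ⟨hG.1.aestronglyMeasurable, ae_norm_le_of_eLpNorm_top_le h1 hB.le, fun e =>
    ae_abs_sub_le_of_hasWeakDeriv hG (ae_norm_le_of_eLpNorm_top_le (W := U →L[ℝ] ℝ) h2 hB.le) e⟩

end WeakLipschitz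

lemma BoundedLipschitzAE.fiber_integral {h : E3 × E3 → ℝ} {B : ℝ} (hh : BoundedLipschitzAE h B)
    {κ : E3 → ℝ} (hκ : Integrable κ) (hκ0 : ∀ v, 0 ≤ κ v) :
    (∀ᵐ x : E3, Integrable fun v => h (x, v) * κ v) ∧
      BoundedLipschitzAE (fun x => ∫ v, h (x, v) * κ v) (B * ∫ v, κ v) := by
  have hm : AEStronglyMeasurable (fun p : E3 × E3 => h p * κ p.2)
      ((volume : Measure E3).prod (volume : Measure E3)) :=
    AEStronglyMeasurable.mul hh.1 (hκ.1.comp_quasiMeasurePreserving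
      Measure.quasiMeasurePreserving_snd)
  have hb : ∀ᵐ x : E3, ∀ᵐ v : E3, |h (x, v)| ≤ B := Measure.ae_ae_of_ae_prod hh.2.1
  have hi : ∀ᵐ x : E3, Integrable fun v => h (x, v) * κ v := by
    filter_upwards [hb, hm.prodMk_left] with x hx hmx
    refine Integrable.mono' (hκ.const_mul B) hmx ?_
    filter_upwards [hx] with v hv
    rw [norm_mul, Real.norm_eq_abs, Real.norm_of_nonneg (hκ0 v)]
    exact mul_le_mul_of_nonneg_right hv (hκ0 v)
  refine ⟨hi, AEStronglyMeasurable.integral_prod_right' hm, ?_, fun e => ?_⟩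
  · filter_upwards [hb] with x hx
    rw [← integral_const_mul, ← Real.norm_eq_abs]
    refine norm_integral_le_of_norm_le (hκ.const_mul B) ?_
    filter_upwards [hx] with v hv
    rw [norm_mul, Real.norm_eq_abs, Real.norm_of_nonneg (hκ0 v)]
    exact mul_le_mul_of_nonneg_right hv (hκ0 v)
  · have he : ∀ᵐ x : E3, ∀ᵐ v : E3, |h (x + e, v) - h (x, v)| ≤ B * ‖e‖ := by
      have := Measure.ae_ae_of_ae_prod (hh.2.2 (e, 0))
      filter_upwards [this] with x hx
      filter_upwards [hx] with v hv
      simpa using hv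
    filter_upwards [he, hi, (quasiMeasurePreserving_add_right volume e).ae hi] with x hx h1 h2
    rw [← integral_sub h2 h1, ← Real.norm_eq_abs, mul_right_comm, ← integral_const_mul]
    refine norm_integral_le_of_norm_le (hκ.const_mul _) ?_
    filter_upwards [hx] with v hv
    rw [← sub_mul, norm_mul, Real.norm_eq_abs, Real.norm_of_nonneg (hκ0 v)]
    exact mul_le_mul_of_nonneg_right hv (hκ0 v)

/-! ### Bounds for the density -/

lemma integral_maxwellian {θ : ℝ} (hθ : 0 < θ) (ρ : ℝ) (u : E3) :
    ∫ v, maxwellian ρ θ u v = ρ := by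
  have hb : 0 < 1 / (2 * θ) := by positivity
  have h1 := GaussianFourier.integral_rexp_neg_mul_sq_norm (V := E3) hb
  have h2 : (2 * Real.pi * θ) ^ (3 / 2 : ℝ) ≠ 0 := by positivity
  unfold maxwellian
  rw [integral_const_mul, integral_sub_right_eq_self (fun v : E3 => Real.exp (-‖v‖ ^ 2 / (2 * θ))) u]
  have h3 : ∫ v : E3, Real.exp (-‖v‖ ^ 2 / (2 * θ)) = (2 * Real.pi * θ) ^ (3 / 2 : ℝ) := by
    rw [show (2 * Real.pi * θ) ^ (3 / 2 : ℝ)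
      = (Real.pi / (1 / (2 * θ))) ^ (Module.finrank ℝ E3 / 2 : ℝ) by
        rw [show Real.pi / (1 / (2 * θ)) = 2 * Real.pi * θ by field_simp]
        simp, ← h1]
    congr 1 with v
    congr 1
    ring
  rw [h3, div_mul_cancel₀ _ h2]

lemma integrable_exp_neg_mul_sq_norm {b : ℝ} (hb : 0 < b) :
    Integrable fun v : E3 => Real.exp (-b * ‖v‖ ^ 2) := by
  by_contra h
  have h1 := GaussianFourier.integral_rexp_neg_mul_sq_norm (V := E3) hb
  rw [integral_undef h] at h1
  have : 0 < (Real.pi / b) ^ (Module.finrank ℝ E3 / 2 : ℝ) := by positivity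
  exact this.ne h1

/-- The velocity profile `√μ_M / w`, so that `R = h · √μ_M / w`. -/
noncomputable def remainderProfile (β θM : ℝ) (v : E3) : ℝ :=
  Real.sqrt (maxwellian 1 θM 0 v) / velWeight β v

lemma velWeight_pos (β : ℝ) (v : E3) : 0 < velWeight β v := by
  unfold velWeight
  positivity

lemma maxwellian_one_pos {θ : ℝ} (hθ : 0 < θ) (v : E3) : 0 < maxwellian 1 θ 0 v := by
  unfold maxwellian
  positivity

lemma remainderProfile_nonneg (β θM : ℝ) (v : E3) : 0 ≤ remainderProfile β θM v :=
  div_nonneg (Real.sqrt_nonneg _) (velWeight_pos β v).le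

lemma weightedRemainder_mul_remainderProfile {θM : ℝ} (hθ : 0 < θM) (β : ℝ) (R : E3 → E3 → ℝ)
    (x v : E3) : weightedRemainder β θM R (x, v) * remainderProfile β θM v = R x v := by
  have h1 := (velWeight_pos β v).ne'
  have h2 := (Real.sqrt_pos.2 (maxwellian_one_pos hθ v)).ne'
  simp only [weightedRemainder, remainderProfile]
  field_simp

lemma integrable_remainderProfile {β θM : ℝ} (hβ : 0 ≤ β) (hθ : 0 < θM) :
    Integrable (remainderProfile β θM) := by
  have hb : 0 < 1 / (4 * θM) := by positivity
  set c : ℝ := 1 / (2 * Real.pi * θM) ^ (3 / 2 : ℝ)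
  refine Integrable.mono' ((integrable_exp_neg_mul_sq_norm hb).const_mul (Real.sqrt c)) ?_ ?_
  · refine Continuous.aestronglyMeasurable ?_
    unfold remainderProfile maxwellian
    refine Continuous.div (by fun_prop) ?_ fun v => (velWeight_pos β v).ne'
    unfold velWeight
    exact Continuous.rpow_const (by fun_prop) fun v => Or.inr hβ
  · refine Eventually.of_forall fun v => ?_
    have hw : 1 ≤ velWeight β v := Real.one_le_rpow (by nlinarith [sq_nonneg ‖v‖]) hβ
    rw [Real.norm_of_nonneg (remainderProfile_nonneg β θM v)]
    refine (div_le_self (Real.sqrt_nonneg _) hw).trans (le_of_eq ?_)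
    unfold maxwellian
    have hc : 0 ≤ c := by positivity
    have he : -(1 / (4 * θM)) * ‖v‖ ^ 2 = -‖v - 0‖ ^ 2 / (2 * θM) / 2 := by
      rw [sub_zero]
      ring
    rw [Real.sqrt_mul hc, he, Real.exp_half]

lemma boundedLipschitzAE_of_coeffSize_le {k : ℕ} {F : ℕ → ℝ → E3 → E3 → ℝ} {T M : ℝ}
    (h : coeffSize k F T ≤ ENNReal.ofReal M) {i : ℕ} (hi : i < 2 * k) {t : ℝ} (ht : t ∈ Icc 0 T) :
    BoundedLipschitzAE (fun x => ∫ v, F i t x v) ((|M| + 1) * (1 + t) ^ (2 * i)) := by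
  have ht1 : 0 < (1 + t) ^ (2 * i) := by
    have := ht.1
    positivity
  have h1 : w1InfNorm (fun x : E3 => ∫ v, F i t x v) / ENNReal.ofReal ((1 + t) ^ (2 * i))
      ≤ ENNReal.ofReal M := by
    refine le_trans ?_ h
    unfold coeffSize
    refine le_trans ?_ (le_iSup₂ (f := fun i _ => ⨆ t ∈ Icc (0 : ℝ) T,
      w1InfNorm (fun x : E3 => ∫ v, F i t x v) / ENNReal.ofReal ((1 + t) ^ (2 * i))) i
        (Finset.mem_range.2 hi))
    exact le_iSup₂ (f := fun t _ =>
      w1InfNorm (fun x : E3 => ∫ v, F i t x v) / ENNReal.ofReal ((1 + t) ^ (2 * i))) t ht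
  refine boundedLipschitzAE_of_w1InfNorm_lt ?_
  rw [ENNReal.div_le_iff (by simpa using ht1) ENNReal.ofReal_ne_top] at h1
  refine h1.trans_lt ?_
  rw [mul_comm, mul_comm (|M| + 1), ← ENNReal.ofReal_mul ht1.le]
  refine (ENNReal.ofReal_lt_ofReal_iff (by positivity)).2 (mul_lt_mul_of_pos_left ?_ ht1)
  linarith [le_abs_self M]

lemma boundedLipschitzAE_remainder {k : ℕ} {ε β θM : ℝ} (hε : 0 < ε) (hβ : 0 ≤ β) (hθ : 0 < θM)
    {R : E3 → E3 → ℝ} (h : ENNReal.ofReal (ε ^ k) * w1InfNorm (weightedRemainder β θM R) ≤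
      ENNReal.ofReal (Real.sqrt ε)) :
    (∀ᵐ x, Integrable (R x)) ∧ BoundedLipschitzAE (fun x => ε ^ k * ∫ v, R x v)
      (2 * Real.sqrt ε * ∫ v, remainderProfile β θM v) := by
  have hk : 0 < ε ^ k := pow_pos hε k
  have hs : 0 < Real.sqrt ε := Real.sqrt_pos.2 hε
  have h1 : BoundedLipschitzAE (weightedRemainder β θM R) (2 * Real.sqrt ε / ε ^ k) := by
    refine boundedLipschitzAE_of_w1InfNorm_lt ?_
    rw [ENNReal.ofReal_div_of_pos hk, ENNReal.lt_div_iff_mul_lt (by simp [hk]) (by simp), mul_comm]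
    refine h.trans_lt ((ENNReal.ofReal_lt_ofReal_iff (by positivity)).2 (by linarith))
  have h2 := h1.fiber_integral (integrable_remainderProfile hβ hθ)
    (remainderProfile_nonneg β θM)
  simp only [weightedRemainder_mul_remainderProfile hθ] at h2
  refine ⟨h2.1, (h2.2.const_mul hk.le).mono (le_of_eq ?_)⟩
  field_simp

/-- For times at most `ε^{-m}` with `m < 1/2`, all terms of the expansion but the leading one are
small in `W^{1,∞}`. -/
lemma exists_eps_pow_le {m : ℝ} (hm : 0 < m) (hm' : m < 1 / 2) (A B δ : ℝ) (hδ : 0 < δ) :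
    ∃ ε₀ : ℝ, 0 < ε₀ ∧ ∀ ε, 0 < ε → ε < ε₀ → ∃ a, 0 ≤ a ∧ A * a + B * Real.sqrt ε ≤ δ ∧
      ∀ t, 0 ≤ t → t ≤ ε ^ (-m) → ∀ i, 1 ≤ i → ε ^ i * (1 + t) ^ (2 * i) ≤ a := by
  have hp : 0 < 1 - 2 * m := by linarith
  have hc : ContinuousAt (fun ε : ℝ => A * (4 * ε ^ (1 - 2 * m)) + B * Real.sqrt ε) 0 :=
    ((continuousAt_const.mul (Real.continuousAt_rpow_const 0 _ (Or.inr hp.le))).const_mul A).add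
      (Real.continuous_sqrt.continuousAt.const_mul B)
  have hc' : ContinuousAt (fun ε : ℝ => 4 * ε ^ (1 - 2 * m)) 0 :=
    continuousAt_const.mul (Real.continuousAt_rpow_const 0 _ (Or.inr hp.le))
  have e1 := hc.eventually_lt_const (show _ < δ by simpa [Real.zero_rpow hp.ne'] using hδ)
  have e2 := hc'.eventually_lt_const (show _ < (1 : ℝ) by simp [Real.zero_rpow hp.ne'])
  obtain ⟨r, hr, h⟩ := Metric.eventually_nhds_iff.1 (e1.and e2)
  refine ⟨min r 1, lt_min hr one_pos, fun ε h0 hε => ?_⟩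
  obtain ⟨hA, ha⟩ := @h ε (by
    rw [Real.dist_eq, sub_zero, abs_of_pos h0]
    exact hε.trans_le (min_le_left _ _))
  have hε1 : ε ≤ 1 := (hε.trans_le (min_le_right _ _)).le
  refine ⟨4 * ε ^ (1 - 2 * m), by positivity, hA.le, fun t ht0 ht i hi => ?_⟩
  have h1 : (1 : ℝ) ≤ ε ^ (-m) := Real.one_le_rpow_of_pos_of_le_one_of_nonpos h0 hε1 (by linarith)
  have h2 : ε * (1 + t) ^ 2 ≤ 4 * ε ^ (1 - 2 * m) := by
    have h3 : (1 + t) ^ 2 ≤ (2 * ε ^ (-m)) ^ 2 := pow_le_pow_left₀ (by linarith) (by linarith) 2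
    have h4 : ε ^ (1 - 2 * m) = ε * (ε ^ (-m)) ^ 2 := by
      rw [← Real.rpow_natCast (ε ^ (-m)), ← Real.rpow_mul h0.le]
      nth_rw 2 [← Real.rpow_one ε]
      rw [← Real.rpow_add h0]
      congr 1
      push_cast
      ring
    rw [h4]
    nlinarith
  have h3 : 0 ≤ ε * (1 + t) ^ 2 := by positivity
  rw [pow_mul, ← mul_pow]
  exact (pow_le_of_le_one h3 (h2.trans ha.le) (by omega)).trans h2

/-- Uniformly in the data, the density is bounded above and below and Lipschitz continuous. -/
lemma exists_density_bounds (k : ℕ) (hk : 1 ≤ k) (K θM β m M : ℝ) (hK : 0 < K) (hθM : 0 < θM)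
    (hβ : 0 ≤ β) (hm : 0 < m) (hm' : m < 1 / 2) :
    ∃ ε₀ ρmin ρmax : ℝ, 0 < ε₀ ∧ 0 < ρmin ∧
      ∀ (ε T : ℝ), 0 < ε → ε < ε₀ → T ≤ ε ^ (-m) →
      ∀ (ρ₀ : ℝ → E3 → ℝ) (u₀ : ℝ → E3 → E3) (F : ℕ → ℝ → E3 → E3 → ℝ),
      (∀ t ∈ Icc 0 T, ∀ x, 0 < ρ₀ t x ∧ θM ≤ K * ρ₀ t x ^ (2 / 3 : ℝ)) →
      (∀ t ∈ Icc 0 T, ∀ x v,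
        F 0 t x v = maxwellian (ρ₀ t x) (K * ρ₀ t x ^ (2 / 3 : ℝ)) (u₀ t x) v) →
      (∀ i < 2 * k, ∀ t ∈ Icc 0 T, ∀ᵐ x : E3, Integrable (F i t x)) →
      coeffSize k F T ≤ ENNReal.ofReal M →
      ∀ (R : ℝ → E3 → E3 → ℝ),
      (∀ t ∈ Icc 0 T, ENNReal.ofReal (ε ^ k) * w1InfNorm (weightedRemainder β θM (R t)) ≤
        ENNReal.ofReal (Real.sqrt ε)) →
      ∀ t ∈ Icc 0 T, (∀ᵐ x, ρmin ≤ ∫ v, truncatedExpansion k ε F R t x v) ∧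
        BoundedLipschitzAE (fun x => ∫ v, truncatedExpansion k ε F R t x v) ρmax := by
  set c : ℝ := (θM / K) ^ (3 / 2 : ℝ) with hcdef
  have hc : 0 < c := by positivity
  obtain ⟨n, rfl⟩ : ∃ n, k = n + 1 := ⟨k - 1, by omega⟩
  set N := 2 * n + 1 with hN
  have hkN : 2 * (n + 1) = N + 1 := by omega
  set I := ∫ v, remainderProfile β θM v
  obtain ⟨ε₀, hε₀, hsmall⟩ := exists_eps_pow_le hm hm' (N * (|M| + 1)) (2 * I) (min (c / 2) 1)
    (by positivity)
  refine ⟨ε₀, c / 2, |M| + 2, hε₀, by positivity, ?_⟩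
  intro ε T hε hεε hT ρ₀ u₀ F hρ hF0 hFi hsize R hR t ht
  obtain ⟨a, ha0, ha, hpow⟩ := hsmall ε hε hεε
  have hi : ∀ i < N + 1, BoundedLipschitzAE (fun x => ∫ v, F i t x v)
      ((|M| + 1) * (1 + t) ^ (2 * i)) := fun i hi =>
    boundedLipschitzAE_of_coeffSize_le hsize (by omega) ht
  have hM : 0 ≤ |M| + 1 := by positivity
  obtain ⟨hRi, hRB⟩ := boundedLipschitzAE_remainder hε hβ hθM (hR t ht)
  -- the perturbation of the leading density
  have hP : BoundedLipschitzAE (fun x => (∑ i ∈ Finset.range N, ε ^ (i + 1) * ∫ v, F (i + 1) t x v)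
      + ε ^ (n + 1) * ∫ v, R t x v) (min (c / 2) 1) := by
    refine ((BoundedLipschitzAE.sum (Finset.range N) (B := fun _ => (|M| + 1) * a)
      fun i hi' => ?_).add hRB).mono ?_
    · refine ((hi (i + 1) (by have := Finset.mem_range.1 hi'; omega)).const_mul
        (pow_pos hε (i + 1)).le).mono ?_
      have := mul_le_mul_of_nonneg_left (hpow t ht.1 (ht.2.trans hT) (i + 1) (by omega)) hM
      linarith
    · simp only [Finset.sum_const, Finset.card_range, nsmul_eq_mul]
      linarith
  have heq : ∀ᵐ x, ∫ v, truncatedExpansion (n + 1) ε F R t x v = (∫ v, F 0 t x v) +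
      ((∑ i ∈ Finset.range N, ε ^ (i + 1) * ∫ v, F (i + 1) t x v) + ε ^ (n + 1) * ∫ v, R t x v) := by
    have hall : ∀ᵐ x : E3, ∀ i ∈ Finset.range (N + 1), Integrable (F i t x) :=
      (Finset.eventually_all (Finset.range (N + 1))).2 fun i hi' =>
        hFi i (by have := Finset.mem_range.1 hi'; omega) t ht
    filter_upwards [hall, hRi] with x hx hRx
    unfold truncatedExpansion
    rw [hkN, integral_add (integrable_finsetSum _ fun i hi' => (hx i hi').const_mul _)
      (hRx.const_mul _), integral_finsetSum _ fun i hi' => (hx i hi').const_mul _]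
    simp only [integral_const_mul]
    rw [Finset.sum_range_succ']
    simp only [pow_zero, one_mul]
    ring
  have h0 : ∀ x, c ≤ ∫ v, F 0 t x v := by
    intro x
    obtain ⟨hp, hθ⟩ := hρ t ht x
    have hθ0 : 0 < K * ρ₀ t x ^ (2 / 3 : ℝ) := by positivity
    simp only [hF0 t ht x]
    rw [integral_maxwellian hθ0]
    have h1 : θM / K ≤ ρ₀ t x ^ (2 / 3 : ℝ) := by
      rw [div_le_iff₀ hK]
      linarith
    have h2 := Real.rpow_le_rpow (by positivity) h1 (show (0 : ℝ) ≤ 3 / 2 by norm_num)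
    rw [← Real.rpow_mul hp.le] at h2
    norm_num at h2
    exact h2
  have hsum := ((hi 0 (by omega)).add hP).mono (B' := |M| + 2) (by
    have := min_le_right (c / 2) 1
    simp only [mul_zero, pow_zero]
    linarith)
  refine ⟨?_, hsum.1.congr (heq.mono fun x hx => hx.symm), ?_, fun e => ?_⟩
  · filter_upwards [heq, hP.2.1] with x hx hPx
    rw [hx]
    have h1 := (abs_le.1 (hPx.trans (min_le_left _ _))).1
    linarith [h0 x]
  · filter_upwards [heq, hsum.2.1] with x hx h1
    rwa [hx]
  · filter_upwards [heq, (quasiMeasurePreserving_add_right volume e).ae heq, hsum.2.2 e]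
      with x hx hx' h1
    rwa [hx, hx']

/-! ### Bounds for the potential -/

lemma forall_of_ae_of_isClosed {p : E3 → Prop} (hc : IsClosed {x | p x}) (h : ∀ᵐ x, p x) (x : E3) :
    p x := by
  have h1 := (Measure.dense_of_ae h).closure_eq
  rw [hc.closure_eq] at h1
  exact (h1 ▸ mem_univ x : x ∈ {x | p x})

/-- Elliptic estimates for the Poisson equation with exponential nonlinearity. -/
lemma exists_potential_bound {ρmin : ℝ} (hρ : 0 < ρmin) (ρmax : ℝ) :
    ∃ A, 1 ≤ A ∧ ∀ (φ : E3 → ℝ) (ρ : E3 → ℝ), ContDiff ℝ 2 φ → (∃ B, ∀ x, |φ x| ≤ B) →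
      (∀ᵐ x, ρmin ≤ ρ x) → BoundedLipschitzAE ρ ρmax →
      (∀ᵐ x, Laplacian.laplacian φ x = Real.exp (φ x) - ρ x) →
      (∀ x, ‖fderiv ℝ φ x‖ ≤ A) ∧ (∀ x, ‖fderiv ℝ (fderiv ℝ φ) x‖ ≤ A) ∧
        ∀ x y, |Laplacian.laplacian φ x - Laplacian.laplacian φ y| ≤ A * ‖x - y‖ := by
  set A₁ : ℝ := max (max |Real.log ρmin| |Real.log ρmax|) (2 * |ρmax|) + 1 with hA₁
  have hA₁0 : 0 < A₁ := by positivity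
  set A₂ : ℝ := max (6 * A₁) (|ρmax| * (6 * A₁) + |ρmax|) with hA₂
  have hA₂0 : 0 < A₂ := lt_max_of_lt_left (by positivity)
  refine ⟨max 1 (18 * A₂), le_max_left _ _, fun φ ρ hφ hB hlow hBL hlap => ?_⟩
  obtain ⟨B, hB⟩ := hB
  have hsym := hasSymLaplacian_of_contDiff hφ
  have hlc : Continuous (Laplacian.laplacian φ) := by
    have h1 : Continuous (fderiv ℝ (fderiv ℝ φ)) :=
      (hφ.fderiv_right (m := 1) (by norm_num)).continuous_fderiv (by norm_num)
    have : Laplacian.laplacian φ = fun x => ∑ i, fderiv ℝ (fderiv ℝ φ) x (stdVec i) (stdVec i) :=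
      funext fun x => laplacian_eq_sum_fderiv φ x
    rw [this]
    fun_prop
  have hφc := hφ.continuous
  set g : E3 → ℝ := fun x => Real.exp (φ x) - Laplacian.laplacian φ x with hg
  have hgc : Continuous g := by fun_prop
  have hgρ : ∀ᵐ x, ρ x = g x := by
    filter_upwards [hlap] with x hx
    simp only [hg, hx]
    ring
  have hgl : ∀ x, ρmin ≤ g x := forall_of_ae_of_isClosed (isClosed_le continuous_const hgc) (by
    filter_upwards [hlow, hgρ] with x h1 h2
    rwa [← h2])
  have hgu : ∀ x, |g x| ≤ ρmax := forall_of_ae_of_isClosed (isClosed_le hgc.abs continuous_const) (by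
    filter_upwards [hBL.2.1, hgρ] with x h1 h2
    rwa [← h2])
  have hgL : ∀ e x, |g (x + e) - g x| ≤ ρmax * ‖e‖ := fun e =>
    forall_of_ae_of_isClosed (isClosed_le (by fun_prop) continuous_const) (by
      filter_upwards [hBL.2.2 e, hgρ, (quasiMeasurePreserving_add_right volume e).ae hgρ]
        with x h1 h2 h3
      rwa [← h2, ← h3])
  have hρm : 0 < ρmax := hρ.trans_le ((hgl 0).trans ((le_abs_self _).trans (hgu 0)))
  rw [abs_of_pos hρm] at hA₁ hA₂
  have hs : HasSymLaplacian φ fun x => Real.exp (φ x) - g x := by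
    simpa [hg] using hsym
  have hup : ∀ x, Real.exp (φ x) ≤ ρmax := exp_le_of_hasSymLaplacian hφc
    (fun x => (le_abs_self _).trans (hB x)) hs fun x => (le_abs_self _).trans (hgu x)
  have hlo : ∀ x, ρmin ≤ Real.exp (φ x) := le_exp_of_hasSymLaplacian hφc
    (fun x => (abs_le.1 (hB x)).1) hs hgl
  have hφA : ∀ x, |φ x| ≤ A₁ := by
    intro x
    have h1 := (Real.log_le_iff_le_exp hρ).2 (hlo x)
    have h2 := (Real.le_log_iff_exp_le hρm).2 (hup x)
    have h3 := neg_abs_le (Real.log ρmin)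
    have h4 := le_abs_self (Real.log ρmax)
    have h5 := le_max_left |Real.log ρmin| |Real.log ρmax|
    have h6 := le_max_right |Real.log ρmin| |Real.log ρmax|
    have h7 := le_max_left (max |Real.log ρmin| |Real.log ρmax|) (2 * ρmax)
    exact abs_le.2 ⟨by linarith, by linarith⟩
  have hlA : ∀ x, |Laplacian.laplacian φ x| ≤ A₁ := by
    intro x
    have h1 := abs_le.1 (hgu x)
    have h2 := Real.exp_pos (φ x)
    have h3 := hup x
    have h4 : Laplacian.laplacian φ x = Real.exp (φ x) - g x := by simp [hg]
    have h7 := le_max_right (max |Real.log ρmin| |Real.log ρmax|) (2 * ρmax)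
    rw [h4]
    exact abs_le.2 ⟨by linarith, by linarith⟩
  have hdiff : Differentiable ℝ φ := hφ.differentiable (by norm_num)
  have hD : ∀ x, ‖fderiv ℝ φ x‖ ≤ 6 * A₁ :=
    norm_fderiv_le_of_laplacian hdiff hA₁0 hφA hsym hlA
  have hexp : ∀ x y, |Real.exp (φ x) - Real.exp (φ y)| ≤ ρmax * (6 * A₁) * ‖x - y‖ := by
    intro x y
    refine Convex.norm_image_sub_le_of_norm_hasFDerivWithin_le (s := univ)
      (fun z _ => ((hdiff z).hasFDerivAt.exp).hasFDerivWithinAt) (fun z _ => ?_) convex_univ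
      (mem_univ y) (mem_univ x)
    rw [norm_smul, Real.norm_of_nonneg (Real.exp_pos _).le]
    exact mul_le_mul (hup z) (hD z) (norm_nonneg _) hρm.le
  have hL : ∀ x y, |Laplacian.laplacian φ x - Laplacian.laplacian φ y| ≤ A₂ * ‖x - y‖ := by
    intro x y
    have h1 := hgL (x - y) y
    rw [add_sub_cancel] at h1
    have h2 := hexp x y
    have h3 : Laplacian.laplacian φ x - Laplacian.laplacian φ y
        = (Real.exp (φ x) - Real.exp (φ y)) - (g x - g y) := by
      simp only [hg]
      ring
    rw [h3]
    refine (abs_sub _ _).trans ?_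
    have h4 := mul_le_mul_of_nonneg_right (le_max_right (6 * A₁) (ρmax * (6 * A₁) + ρmax))
      (norm_nonneg (x - y))
    rw [← hA₂] at h4
    linarith
  have hD2 := norm_fderiv_fderiv_le_of_laplacian hφ hA₂0
    (fun x => (hD x).trans (le_max_left _ _)) hsym hL
  have h18 : 18 * A₂ ≤ max 1 (18 * A₂) := le_max_right _ _
  have h6 : 6 * A₁ ≤ A₂ := le_max_left _ _
  refine ⟨fun x => (hD x).trans (by linarith), fun x => (hD2 x).trans h18, fun x y =>
    (hL x y).trans (mul_le_mul_of_nonneg_right (by linarith) (norm_nonneg _))⟩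

/-! ### The characteristics and their Jacobian -/

/-- The gradient as a linear function of the derivative. -/
noncomputable def gradOfDual : (E3 →L[ℝ] ℝ) →L[ℝ] E3 :=
  LinearMap.mkContinuous
    { toFun := fun l => (InnerProductSpace.toDual ℝ E3).symm l
      map_add' := fun l l' => map_add _ l l'
      map_smul' := fun c l => by simp } 1 fun l => by simp

lemma gradOfDual_fderiv (f : E3 → ℝ) (x : E3) : gradOfDual (fderiv ℝ f x) = ∇ f x := rfl

lemma norm_gradOfDual (l : E3 →L[ℝ] ℝ) : ‖gradOfDual l‖ = ‖l‖ :=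
  (InnerProductSpace.toDual ℝ E3).symm.norm_map l

/-- The vector field `(v, -∇φ)` of the characteristics on phase space. -/
noncomputable def vlasovField (φ : ℝ → E3 → ℝ) (s : ℝ) (z : E3 × E3) : E3 × E3 :=
  (z.2, -∇ (φ s) z.1)

/-- The derivative of `vlasovField`. -/
noncomputable def vlasovDeriv (φ : ℝ → E3 → ℝ) (s : ℝ) (z : E3 × E3) : E3 × E3 →L[ℝ] E3 × E3 :=
  (ContinuousLinearMap.snd ℝ E3 E3).prod
    (-(gradOfDual ∘L fderiv ℝ (fderiv ℝ (φ s)) z.1 ∘L ContinuousLinearMap.fst ℝ E3 E3))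

/-- Position and velocity as one map of phase space. -/
def phaseFlow (X V : ℝ → ℝ → E3 → E3 → E3) (τ t : ℝ) (z : E3 × E3) : E3 × E3 :=
  (X τ t z.1 z.2, V τ t z.1 z.2)

lemma hasFDerivAt_vlasovField {φ : ℝ → E3 → ℝ} {s : ℝ} (h : ContDiff ℝ 2 (φ s)) (z : E3 × E3) :
    HasFDerivAt (vlasovField φ s) (vlasovDeriv φ s z) z := by
  have hd : HasFDerivAt (fderiv ℝ (φ s)) (fderiv ℝ (fderiv ℝ (φ s)) z.1) z.1 :=
    ((h.fderiv_right (m := 1) (by norm_num)).differentiable (by norm_num) z.1).hasFDerivAt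
  have h1 : HasFDerivAt (fun z : E3 × E3 => gradOfDual (fderiv ℝ (φ s) z.1))
      (gradOfDual ∘L fderiv ℝ (fderiv ℝ (φ s)) z.1 ∘L ContinuousLinearMap.fst ℝ E3 E3) z :=
    gradOfDual.hasFDerivAt.comp z (hd.comp z hasFDerivAt_fst)
  exact hasFDerivAt_snd.prodMk h1.neg

lemma norm_vlasovDeriv_le {φ : ℝ → E3 → ℝ} {s L : ℝ} (hL : 1 ≤ L)
    (h : ∀ x, ‖fderiv ℝ (fderiv ℝ (φ s)) x‖ ≤ L) (z : E3 × E3) : ‖vlasovDeriv φ s z‖ ≤ L := by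
  refine ContinuousLinearMap.opNorm_le_bound _ (by linarith) fun y => ?_
  refine max_le ?_ ?_
  · exact (norm_snd_le y).trans (le_mul_of_one_le_left (norm_nonneg y) hL)
  · change ‖-gradOfDual (fderiv ℝ (fderiv ℝ (φ s)) z.1 y.1)‖ ≤ _
    rw [norm_neg, norm_gradOfDual]
    exact (ContinuousLinearMap.le_of_opNorm_le _ (h z.1) _).trans
      (mul_le_mul_of_nonneg_left (norm_fst_le y) (by linarith))

lemma norm_vlasovDeriv_sub_le (φ : ℝ → E3 → ℝ) (s : ℝ) (z z' : E3 × E3) :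
    ‖vlasovDeriv φ s z - vlasovDeriv φ s z'‖ ≤
      ‖fderiv ℝ (fderiv ℝ (φ s)) z.1 - fderiv ℝ (fderiv ℝ (φ s)) z'.1‖ := by
  refine ContinuousLinearMap.opNorm_le_bound _ (norm_nonneg (_ : E3 →L[ℝ] E3 →L[ℝ] ℝ)) fun y => ?_
  have h1 : (vlasovDeriv φ s z - vlasovDeriv φ s z') y = (0, -gradOfDual
      ((fderiv ℝ (fderiv ℝ (φ s)) z.1 - fderiv ℝ (fderiv ℝ (φ s)) z'.1) y.1)) := by
    ext1
    · simp [vlasovDeriv]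
    · simp [vlasovDeriv]
      abel
  rw [h1]
  refine max_le ?_ ?_
  · simp only [norm_zero]
    positivity
  · change ‖-gradOfDual _‖ ≤ _
    rw [norm_neg, norm_gradOfDual]
    exact (ContinuousLinearMap.le_opNorm _ _).trans
      (mul_le_mul_of_nonneg_left (norm_fst_le y) (norm_nonneg (_ : E3 →L[ℝ] E3 →L[ℝ] ℝ)))

/-- Characteristics of a potential with `|∇φ|` and `|D²φ|` bounded by `L` and with Hölder continuous
second derivatives. The Hölder constant `A` serves qualitative purposes only, while `L` enters the
estimates. -/
structure IsVlasovFlow (T L A α : ℝ) (φ : ℝ → E3 → ℝ) (X V : ℝ → ℝ → E3 → E3 → E3) : Prop where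
  one_le : 1 ≤ L
  A_nonneg : 0 ≤ A
  α_pos : 0 < α
  contDiff : ∀ t ∈ Icc 0 T, ContDiff ℝ 2 (φ t)
  norm_fderiv_le : ∀ t ∈ Icc 0 T, ∀ x, ‖fderiv ℝ (φ t) x‖ ≤ L
  norm_hessian_le : ∀ t ∈ Icc 0 T, ∀ x, ‖fderiv ℝ (fderiv ℝ (φ t)) x‖ ≤ L
  holder : ∀ t ∈ Icc 0 T, ∀ x y,
    ‖fderiv ℝ (fderiv ℝ (φ t)) x - fderiv ℝ (fderiv ℝ (φ t)) y‖ ≤ A * ‖x - y‖ ^ α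
  measurable : ∀ x, AEStronglyMeasurable (fun t => φ t x) (volume.restrict (Icc 0 T))
  isCharacteristics : IsCharacteristics T φ X V

namespace IsVlasovFlow

variable {T L A α : ℝ} {φ : ℝ → E3 → ℝ} {X V : ℝ → ℝ → E3 → E3 → E3}

lemma mono (h : IsVlasovFlow T L A α φ X V) {T' : ℝ} (hT : T' ≤ T) :
    IsVlasovFlow T' L A α φ X V := by
  have hs : Icc 0 T' ⊆ Icc 0 T := Icc_subset_Icc_right hT
  refine ⟨h.one_le, h.A_nonneg, h.α_pos, fun t ht => h.contDiff t (hs ht),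
    fun t ht => h.norm_fderiv_le t (hs ht), fun t ht => h.norm_hessian_le t (hs ht),
    fun t ht => h.holder t (hs ht), fun x => (h.measurable x).mono_set hs, fun t ht x v => ?_⟩
  obtain ⟨h1, h2, h3⟩ := h.isCharacteristics t (hs ht) x v
  exact ⟨h1.mono hs, h2.mono hs, fun τ hτ => h3 τ (hs hτ)⟩

lemma aestronglyMeasurable_fderiv (h : IsVlasovFlow T L A α φ X V) (x : E3) :
    AEStronglyMeasurable (fun t => fderiv ℝ (φ t) x) (volume.restrict (Icc 0 T)) :=
  aestronglyMeasurable_of_hasFDerivAt h.measurable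
    ((ae_restrict_mem measurableSet_Icc).mono fun t ht =>
      ((h.contDiff t ht).differentiable (by norm_num) x).hasFDerivAt)

lemma isCaratheodoryFlow (h : IsVlasovFlow T L A α φ X V) :
    IsCaratheodoryFlow T L A α (vlasovField φ) (vlasovDeriv φ) (phaseFlow X V) := by
  have hcont : ∀ t ∈ Icc (0 : ℝ) T, ∀ z : E3 × E3,
      ContinuousOn (fun τ => phaseFlow X V τ t z) (Icc 0 T) := fun t ht z => by
    obtain ⟨h1, h2, -⟩ := h.isCharacteristics t ht z.1 z.2
    exact h1.prodMk h2
  have hmeas : ∀ x, AEStronglyMeasurable (fun t => ∇ (φ t) x) (volume.restrict (Icc 0 T)) :=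
    fun x => gradOfDual.continuous.comp_aestronglyMeasurable (h.aestronglyMeasurable_fderiv x)
  have hgc : ∀ t ∈ Icc (0 : ℝ) T, Continuous (∇ (φ t)) := fun t ht =>
    gradOfDual.continuous.comp ((h.contDiff t ht).continuous_fderiv (by norm_num))
  have hgb : ∀ t ∈ Icc (0 : ℝ) T, ∀ x, ‖∇ (φ t) x‖ ≤ L := fun t ht x => by
    rw [← gradOfDual_fderiv, norm_gradOfDual]
    exact h.norm_fderiv_le t ht x
  refine ⟨by linarith [h.one_le], h.A_nonneg, h.α_pos,
    fun s hs z => hasFDerivAt_vlasovField (h.contDiff s hs) z,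
    fun s hs z => norm_vlasovDeriv_le h.one_le (h.norm_hessian_le s hs) z, ?_, ?_, ⟨L, ?_⟩, hcont, ?_⟩
  · intro s hs z z'
    refine (norm_vlasovDeriv_sub_le φ s z z').trans ((h.holder s hs _ _).trans ?_)
    exact mul_le_mul_of_nonneg_left (Real.rpow_le_rpow (norm_nonneg _)
      (norm_fst_le (z - z')) h.α_pos.le) h.A_nonneg
  · exact fun z => aestronglyMeasurable_const.prodMk (hmeas z.1).neg
  · intro s hs
    refine max_le ?_ ?_
    · change ‖(0 : E3)‖ ≤ L
      rw [norm_zero]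
      linarith [h.one_le]
    · change ‖-∇ (φ s) _‖ ≤ L
      rw [norm_neg]
      exact hgb s hs _
  · intro t ht z τ hτ
    obtain ⟨h1, h2, h3⟩ := h.isCharacteristics t ht z.1 z.2
    have i1 : IntegrableOn (fun s => V s t z.1 z.2) (Icc 0 T) := h2.integrableOn_compact isCompact_Icc
    have i2 : IntegrableOn (fun s => ∇ (φ s) (X s t z.1 z.2)) (Icc 0 T) := by
      refine Integrable.mono' (g := fun _ => L) (integrableOn_const (by simp))
        (aestronglyMeasurable_comp_caratheodory
          ((ae_restrict_mem measurableSet_Icc).mono hgc) hmeas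
          (h1.aestronglyMeasurable measurableSet_Icc))
        ((ae_restrict_mem measurableSet_Icc).mono fun s hs => hgb s hs _)
    have i3 : IntervalIntegrable (fun s => vlasovField φ s (phaseFlow X V s t z)) volume t τ :=
      IsCaratheodoryFlow.intervalIntegrable_of_mem
        (Integrable.prodMk (μ := volume.restrict (Icc 0 T)) i1 i2.neg) ht hτ
    obtain ⟨e1, e2⟩ := h3 τ hτ
    have f1 := (ContinuousLinearMap.fst ℝ E3 E3).intervalIntegral_comp_comm i3
    have f2 := (ContinuousLinearMap.snd ℝ E3 E3).intervalIntegral_comp_comm i3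
    refine Prod.ext ?_ ?_
    · change X τ t z.1 z.2 = z.1 + ContinuousLinearMap.fst ℝ E3 E3
        (∫ s in t..τ, vlasovField φ s (phaseFlow X V s t z))
      rw [← f1]
      exact e1
    · change V τ t z.1 z.2 = z.2 + ContinuousLinearMap.snd ℝ E3 E3
        (∫ s in t..τ, vlasovField φ s (phaseFlow X V s t z))
      rw [← f2]
      have : ∀ s, ContinuousLinearMap.snd ℝ E3 E3 (vlasovField φ s (phaseFlow X V s t z))
        = -∇ (φ s) (X s t z.1 z.2) := fun s => rfl
      simp only [this]
      rw [intervalIntegral.integral_neg, ← sub_eq_add_neg]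
      exact e2

end IsVlasovFlow

section Jacobian

variable {E : Type*} [NormedAddCommGroup E] [NormedSpace ℝ E]
  {T L A α : ℝ} {W : ℝ → E → E} {B : ℝ → E → E →L[ℝ] E} {Z : ℝ → ℝ → E → E}
  {J : ℝ → ℝ → E → E →L[ℝ] E}

variable [FiniteDimensional ℝ E] [MeasurableSpace E] [BorelSpace E] [SecondCountableTopology E]
  [CompleteSpace E]

lemma IsCaratheodoryFlow.norm_jacobian_le (h : IsCaratheodoryFlow T L A α W B Z)
    (hJ : ∀ t ∈ Icc 0 T, ∀ z δ, IsVariation T B Z t z δ fun τ => J τ t z δ) {t τ : ℝ}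
    (ht : t ∈ Icc 0 T) (hτ : τ ∈ Icc 0 T) (z : E) : ‖J τ t z‖ ≤ Real.exp (L * |τ - t|) :=
  ContinuousLinearMap.opNorm_le_bound _ (Real.exp_pos _).le fun δ => by
    rw [mul_comm]
    exact IsVariation.norm_le h ht hτ (hJ t ht z δ)

lemma IsCaratheodoryFlow.norm_jacobian_sub_id_le (h : IsCaratheodoryFlow T L A α W B Z)
    (hJ : ∀ t ∈ Icc 0 T, ∀ z δ, IsVariation T B Z t z δ fun τ => J τ t z δ) {t τ : ℝ}
    (ht : t ∈ Icc 0 T) (hτ : τ ∈ Icc 0 T) (z : E) :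
    ‖J τ t z - ContinuousLinearMap.id ℝ E‖ ≤ L * T * Real.exp (L * T) := by
  have hT : 0 ≤ T := ht.1.trans ht.2
  have hL := h.L_nonneg
  refine ContinuousLinearMap.opNorm_le_bound _ (by positivity) fun δ => ?_
  have h1 : J τ t z δ = δ + ∫ s in t..τ, B s (Z s t z) (J s t z δ) := (hJ t ht z δ).2 τ hτ
  have h2 : (J τ t z - ContinuousLinearMap.id ℝ E) δ = ∫ s in t..τ, B s (Z s t z) (J s t z δ) := by
    change J τ t z δ - δ = _
    rw [h1, add_sub_cancel_left]
  rw [h2]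
  have h3 : ‖∫ s in t..τ, B s (Z s t z) (J s t z δ)‖ ≤ L * (Real.exp (L * T) * ‖δ‖) * |τ - t| := by
    refine intervalIntegral.norm_integral_le_of_norm_le_const fun s hs => ?_
    have hs' : s ∈ Icc 0 T := uIcc_subset_Icc ht hτ (uIoc_subset_uIcc hs)
    refine (ContinuousLinearMap.le_of_opNorm_le _ (h.bound s hs' _) _).trans ?_
    refine mul_le_mul_of_nonneg_left (ContinuousLinearMap.le_of_opNorm_le _ ?_ _) hL
    exact (h.norm_jacobian_le hJ ht hs' z).trans (h.exp_le ht hs')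
  refine h3.trans ?_
  have h4 := IsCaratheodoryFlow.abs_sub_le_of_mem ht hτ
  have h5 : 0 ≤ L * (Real.exp (L * T) * ‖δ‖) := by positivity
  calc _ ≤ L * (Real.exp (L * T) * ‖δ‖) * T := mul_le_mul_of_nonneg_left h4 h5
    _ = _ := by ring

end Jacobian

/-- Matrices near the identity have determinant near `1` and Frobenius norm near `√3`. -/
lemma exists_radius_near_id : ∃ r : ℝ, 0 < r ∧ r ≤ 1 / 2 ∧ ∀ S : E3 →L[ℝ] E3,
    ‖S - ContinuousLinearMap.id ℝ E3‖ ≤ r → (1 / 2 ≤ |S.det| ∧ |S.det| ≤ 2) ∧ matNorm S ≤ 2 := by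
  have hdet : ContinuousAt (fun S : E3 →L[ℝ] E3 => |S.det|) (ContinuousLinearMap.id ℝ E3) :=
    (ContinuousLinearMap.continuous_det.abs).continuousAt
  have hmat : ContinuousAt matNorm (ContinuousLinearMap.id ℝ E3) := by
    unfold matNorm
    fun_prop
  have d1 : |(ContinuousLinearMap.id ℝ E3).det| = 1 := by
    simp [ContinuousLinearMap.det]
  have m1 : matNorm (ContinuousLinearMap.id ℝ E3) < 2 := by
    unfold matNorm
    rw [Real.sqrt_lt' (by norm_num)]
    simp
    norm_num
  have e1 := hdet.eventually_const_lt (show (1 / 2 : ℝ) < |(ContinuousLinearMap.id ℝ E3).det| by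
    rw [d1]; norm_num)
  have e2 := hdet.eventually_lt_const (show |(ContinuousLinearMap.id ℝ E3).det| < (2 : ℝ) by
    rw [d1]; norm_num)
  have e3 := hmat.eventually_lt_const m1
  obtain ⟨r, hr, h⟩ := Metric.eventually_nhds_iff.1 ((e1.and e2).and e3)
  refine ⟨min (r / 2) (1 / 2), by positivity, min_le_right _ _, fun S hS => ?_⟩
  obtain ⟨⟨h1, h2⟩, h3⟩ := @h S (by
    rw [dist_eq_norm]
    have := min_le_left (r / 2) (1 / 2)
    linarith)
  exact ⟨⟨h1.le, h2.le⟩, h3.le⟩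

lemma matNorm_smul (c : ℝ) (S : E3 →L[ℝ] E3) : matNorm (c • S) = |c| * matNorm S := by
  unfold matNorm
  rw [← Real.sqrt_sq_eq_abs, ← Real.sqrt_mul (sq_nonneg c), Finset.mul_sum]
  congr 1
  refine Finset.sum_congr rfl fun i _ => ?_
  simp [norm_smul, mul_pow]

lemma det_smul_E3 (c : ℝ) (S : E3 →L[ℝ] E3) : (c • S).det = c ^ 3 * S.det := by
  simp [ContinuousLinearMap.det]

namespace IsVlasovFlow

variable {T L A α : ℝ} {φ : ℝ → E3 → ℝ} {X V : ℝ → ℝ → E3 → E3 → E3}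

lemma exists_jacobian (h : IsVlasovFlow T L A α φ X V) :
    ∃ J : ℝ → ℝ → E3 × E3 → E3 × E3 →L[ℝ] E3 × E3,
      (∀ t ∈ Icc 0 T, ∀ z δ,
        IsCaratheodoryFlow.IsVariation T (vlasovDeriv φ) (phaseFlow X V) t z δ fun τ => J τ t z δ) ∧
      ∀ t ∈ Icc 0 T, ∀ τ ∈ Icc 0 T, ∀ z, HasFDerivAt (phaseFlow X V τ t) (J τ t z) z :=
  h.isCaratheodoryFlow.exists_jacobian

end IsVlasovFlow

section Blocks

variable {X V : ℝ → ℝ → E3 → E3 → E3} {t τ : ℝ} {S : E3 × E3 →L[ℝ] E3 × E3} {z : E3 × E3}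

lemma hasFDerivAt_position (h : HasFDerivAt (phaseFlow X V τ t) S z) :
    HasFDerivAt (fun y => X τ t y z.2)
      (ContinuousLinearMap.fst ℝ E3 E3 ∘L S ∘L ContinuousLinearMap.inl ℝ E3 E3) z.1 := by
  have h1 : HasFDerivAt (fun z => (phaseFlow X V τ t z).1) (ContinuousLinearMap.fst ℝ E3 E3 ∘L S)
    (z.1, z.2) := hasFDerivAt_fst.comp z h
  have h2 : HasFDerivAt (fun y => (y, z.2)) (ContinuousLinearMap.inl ℝ E3 E3) z.1 :=
    hasFDerivAt_prodMk_left z.1 z.2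
  exact HasFDerivAt.comp z.1 h1 h2

lemma derivX_position (h : HasFDerivAt (phaseFlow X V τ t) S z) : derivX X τ t z.1 z.2 =
    ContinuousLinearMap.fst ℝ E3 E3 ∘L S ∘L ContinuousLinearMap.inl ℝ E3 E3 :=
  (hasFDerivAt_position h).fderiv

lemma derivV_position (h : HasFDerivAt (phaseFlow X V τ t) S z) : derivV X τ t z.1 z.2 =
    ContinuousLinearMap.fst ℝ E3 E3 ∘L S ∘L ContinuousLinearMap.inr ℝ E3 E3 := by
  have h1 : HasFDerivAt (fun z => (phaseFlow X V τ t z).1) (ContinuousLinearMap.fst ℝ E3 E3 ∘L S)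
    (z.1, z.2) := hasFDerivAt_fst.comp z h
  exact (h1.comp z.2 (hasFDerivAt_prodMk_right z.1 z.2)).fderiv

lemma derivV_velocity (h : HasFDerivAt (phaseFlow X V τ t) S z) : derivV V τ t z.1 z.2 =
    ContinuousLinearMap.snd ℝ E3 E3 ∘L S ∘L ContinuousLinearMap.inr ℝ E3 E3 := by
  have h1 : HasFDerivAt (fun z => (phaseFlow X V τ t z).2) (ContinuousLinearMap.snd ℝ E3 E3 ∘L S)
    (z.1, z.2) := hasFDerivAt_snd.comp z h
  exact (h1.comp z.2 (hasFDerivAt_prodMk_right z.1 z.2)).fderiv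

end Blocks

/-- Blocks of a linear map of a product space are dominated by the map. -/
lemma norm_block_le (p : E3 × E3 →L[ℝ] E3) (i : E3 →L[ℝ] E3 × E3) (hp : ∀ z, ‖p z‖ ≤ ‖z‖)
    (hi : ∀ x, ‖i x‖ ≤ ‖x‖) (S : E3 × E3 →L[ℝ] E3 × E3) : ‖p ∘L S ∘L i‖ ≤ ‖S‖ :=
  ContinuousLinearMap.opNorm_le_bound _ (norm_nonneg _) fun x =>
    (hp _).trans ((S.le_opNorm _).trans (mul_le_mul_of_nonneg_left (hi x) (norm_nonneg _)))

lemma norm_block_sub_id_le (p : E3 × E3 →L[ℝ] E3) (i : E3 →L[ℝ] E3 × E3) (hp : ∀ z, ‖p z‖ ≤ ‖z‖)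
    (hi : ∀ x, ‖i x‖ ≤ ‖x‖) (hpi : ∀ x, p (i x) = x) (S : E3 × E3 →L[ℝ] E3 × E3) :
    ‖p ∘L S ∘L i - ContinuousLinearMap.id ℝ E3‖ ≤ ‖S - ContinuousLinearMap.id ℝ (E3 × E3)‖ := by
  refine le_of_eq_of_le ?_ (norm_block_le p i hp hi _)
  congr 1
  ext1 x
  simp [hpi]

lemma norm_inl_le (x : E3) : ‖ContinuousLinearMap.inl ℝ E3 E3 x‖ ≤ ‖x‖ := by simp

lemma norm_inr_le (x : E3) : ‖ContinuousLinearMap.inr ℝ E3 E3 x‖ ≤ ‖x‖ := by simp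

lemma norm_fst_block_le (S : E3 × E3 →L[ℝ] E3 × E3) :
    ‖ContinuousLinearMap.fst ℝ E3 E3 ∘L S ∘L ContinuousLinearMap.inl ℝ E3 E3‖ ≤ ‖S‖ := by
  apply norm_block_le
  · exact fun z => norm_fst_le z
  · exact norm_inl_le

lemma norm_fst_block_inr_le (S : E3 × E3 →L[ℝ] E3 × E3) :
    ‖ContinuousLinearMap.fst ℝ E3 E3 ∘L S ∘L ContinuousLinearMap.inr ℝ E3 E3‖ ≤ ‖S‖ := by
  apply norm_block_le
  · exact fun z => norm_fst_le z
  · exact norm_inr_le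

lemma norm_snd_block_le (S : E3 × E3 →L[ℝ] E3 × E3) :
    ‖ContinuousLinearMap.snd ℝ E3 E3 ∘L S ∘L ContinuousLinearMap.inr ℝ E3 E3‖ ≤ ‖S‖ := by
  apply norm_block_le
  · exact fun z => norm_snd_le z
  · exact norm_inr_le

lemma norm_fst_block_sub_id_le (S : E3 × E3 →L[ℝ] E3 × E3) :
    ‖ContinuousLinearMap.fst ℝ E3 E3 ∘L S ∘L ContinuousLinearMap.inl ℝ E3 E3 -
      ContinuousLinearMap.id ℝ E3‖ ≤ ‖S - ContinuousLinearMap.id ℝ (E3 × E3)‖ := by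
  apply norm_block_sub_id_le
  · exact fun z => norm_fst_le z
  · exact norm_inl_le
  · exact fun x => by simp

lemma norm_snd_block_sub_id_le (S : E3 × E3 →L[ℝ] E3 × E3) :
    ‖ContinuousLinearMap.snd ℝ E3 E3 ∘L S ∘L ContinuousLinearMap.inr ℝ E3 E3 -
      ContinuousLinearMap.id ℝ E3‖ ≤ ‖S - ContinuousLinearMap.id ℝ (E3 × E3)‖ := by
  apply norm_block_sub_id_le
  · exact fun z => norm_snd_le z
  · exact norm_inr_le
  · exact fun x => by simp

namespace IsVlasovFlow

variable {T L A α : ℝ} {φ : ℝ → E3 → ℝ} {X V : ℝ → ℝ → E3 → E3 → E3}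

lemma contDiff_phaseFlow (h : IsVlasovFlow T L A α φ X V) {t τ : ℝ} (ht : t ∈ Icc 0 T)
    (hτ : τ ∈ Icc 0 T) : ContDiff ℝ 1 (phaseFlow X V τ t) := by
  obtain ⟨J, hJ, hd⟩ := h.exists_jacobian
  have hfd : fderiv ℝ (phaseFlow X V τ t) = J τ t := funext fun z => (hd t ht τ hτ z).fderiv
  rw [contDiff_one_iff_fderiv]
  refine ⟨fun z => (hd t ht τ hτ z).differentiableAt, ?_⟩
  rw [hfd]
  exact h.isCaratheodoryFlow.continuous_jacobian hJ ht hτ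

/-- `∂ₓX`, `∂ᵥX` and `∂ᵥV` are blocks of one solution of the linearised equation, which is bounded and
close to the identity for short times. -/
lemma exists_jacobian_blocks (h : IsVlasovFlow T L A α φ X V) {t : ℝ} (ht : t ∈ Icc 0 T) (x v : E3) :
    ∃ S : ℝ → E3 × E3 →L[ℝ] E3 × E3,
      (∀ δ, IsCaratheodoryFlow.IsVariation T (vlasovDeriv φ) (phaseFlow X V) t (x, v) δ
        fun τ => S τ δ) ∧
      (∀ τ ∈ Icc 0 T, ‖S τ - ContinuousLinearMap.id ℝ (E3 × E3)‖ ≤ L * T * Real.exp (L * T)) ∧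
      (∀ τ ∈ Icc 0 T, ‖S τ‖ ≤ Real.exp (L * T)) ∧
      ∀ τ ∈ Icc 0 T,
        derivX X τ t x v =
          ContinuousLinearMap.fst ℝ E3 E3 ∘L S τ ∘L ContinuousLinearMap.inl ℝ E3 E3 ∧
        derivV X τ t x v =
          ContinuousLinearMap.fst ℝ E3 E3 ∘L S τ ∘L ContinuousLinearMap.inr ℝ E3 E3 ∧
        derivV V τ t x v =
          ContinuousLinearMap.snd ℝ E3 E3 ∘L S τ ∘L ContinuousLinearMap.inr ℝ E3 E3 := by
  obtain ⟨J, hJ, hd⟩ := h.exists_jacobian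
  refine ⟨fun τ => J τ t (x, v), hJ t ht (x, v),
    fun τ hτ => h.isCaratheodoryFlow.norm_jacobian_sub_id_le hJ ht hτ (x, v),
    fun τ hτ => (h.isCaratheodoryFlow.norm_jacobian_le hJ ht hτ (x, v)).trans
      (h.isCaratheodoryFlow.exp_le ht hτ), fun τ hτ => ?_⟩
  have hz := hd t ht τ hτ (x, v)
  exact ⟨derivX_position hz, derivV_position hz, derivV_velocity hz⟩

lemma norm_derivX_le (h : IsVlasovFlow T L A α φ X V) {t τ : ℝ} (ht : t ∈ Icc 0 T)
    (hτ : τ ∈ Icc 0 T) (x v : E3) : ‖derivX X τ t x v‖ ≤ Real.exp (L * T) ∧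
      ‖derivV V τ t x v‖ ≤ Real.exp (L * T) := by
  obtain ⟨S, -, -, hn, hb⟩ := h.exists_jacobian_blocks ht x v
  rw [(hb τ hτ).1, (hb τ hτ).2.2]
  exact ⟨(norm_fst_block_le _).trans (hn τ hτ), (norm_snd_block_le _).trans (hn τ hτ)⟩

/-- `∂ᵥX(τ) = ∫ₜ^τ ∂ᵥV(s) ds`. -/
lemma derivV_position_eq_integral (h : IsVlasovFlow T L A α φ X V) {t τ : ℝ} (ht : t ∈ Icc 0 T)
    (hτ : τ ∈ Icc 0 T) (x v δ : E3) : ContinuousOn (fun s => derivV V s t x v δ) (Icc 0 T) ∧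
      derivV X τ t x v δ = ∫ s in t..τ, derivV V s t x v δ := by
  obtain ⟨S, hS, -, -, hb⟩ := h.exists_jacobian_blocks ht x v
  obtain ⟨hc, he⟩ := hS (0, δ)
  have hVs : ∀ s ∈ Icc 0 T, derivV V s t x v δ = (S s (0, δ)).2 := fun s hs => by
    rw [(hb s hs).2.2]
    rfl
  refine ⟨(continuous_snd.comp_continuousOn hc).congr hVs, ?_⟩
  rw [(hb τ hτ).2.1]
  have i3 : IntervalIntegrable (fun s => vlasovDeriv φ s (phaseFlow X V s t (x, v))
      (S s (0, δ))) volume t τ := IsCaratheodoryFlow.intervalIntegrable_of_mem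
    (h.isCaratheodoryFlow.integrableOn_deriv ht (x, v) hc) ht hτ
  have f1 := (ContinuousLinearMap.fst ℝ E3 E3).intervalIntegral_comp_comm i3
  have e2 : (S τ (0, δ)).1 = 0 + (∫ s in t..τ, vlasovDeriv φ s (phaseFlow X V s t (x, v))
      (S s (0, δ))).1 := congrArg Prod.fst (he τ hτ)
  change (S τ (0, δ)).1 = _
  rw [e2, zero_add]
  refine f1.symm.trans (intervalIntegral.integral_congr fun s hs => ?_)
  exact (hVs s (uIcc_subset_Icc ht hτ hs)).symm

/-- For short times `∂ₓX` and `∂ᵥV` are close to the identity. -/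
lemma derivX_derivV_near_id (h : IsVlasovFlow T L A α φ X V) {r : ℝ}
    (hr : L * T * Real.exp (L * T) ≤ r) {t τ : ℝ} (ht : t ∈ Icc 0 T) (hτ : τ ∈ Icc 0 T) (x v : E3) :
    ‖derivX X τ t x v - ContinuousLinearMap.id ℝ E3‖ ≤ r ∧
    ‖derivV V τ t x v - ContinuousLinearMap.id ℝ E3‖ ≤ r := by
  obtain ⟨S, -, hn, -, hb⟩ := h.exists_jacobian_blocks ht x v
  rw [(hb τ hτ).1, (hb τ hτ).2.2]
  exact ⟨(norm_fst_block_sub_id_le _).trans ((hn τ hτ).trans hr),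
    (norm_snd_block_sub_id_le _).trans ((hn τ hτ).trans hr)⟩

/-- For short times `∂ᵥX` is `τ - t` times a matrix close to the identity. -/
lemma derivV_position_near (h : IsVlasovFlow T L A α φ X V) {r : ℝ} (hr0 : 0 ≤ r)
    (hr : L * T * Real.exp (L * T) ≤ r) {t τ : ℝ} (ht : t ∈ Icc 0 T) (hτ : τ ∈ Icc 0 T) (x v : E3) :
    ∃ S : E3 →L[ℝ] E3, ‖S - ContinuousLinearMap.id ℝ E3‖ ≤ r ∧ derivV X τ t x v = (τ - t) • S := by
  have hint := h.derivV_position_eq_integral ht hτ x v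
  have hV : ∀ s ∈ Icc 0 T, ‖derivV V s t x v - ContinuousLinearMap.id ℝ E3‖ ≤ r := fun s hs =>
    (h.derivX_derivV_near_id hr ht hs x v).2
  by_cases hτt : τ = t
  · refine ⟨ContinuousLinearMap.id ℝ E3, by simpa using hr0, ?_⟩
    ext1 δ
    rw [(hint δ).2, hτt]
    simp
  · have hne : τ - t ≠ 0 := sub_ne_zero.2 hτt
    refine ⟨(τ - t)⁻¹ • derivV X τ t x v, ?_, by rw [smul_smul, mul_inv_cancel₀ hne, one_smul]⟩
    refine ContinuousLinearMap.opNorm_le_bound _ hr0 fun δ => ?_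
    have i1 : IntervalIntegrable (fun s => derivV V s t x v δ) volume t τ :=
      ((hint δ).1.mono (uIcc_subset_Icc ht hτ)).intervalIntegrable
    have e1 : ((τ - t)⁻¹ • derivV X τ t x v - ContinuousLinearMap.id ℝ E3) δ
        = (τ - t)⁻¹ • ∫ s in t..τ, (derivV V s t x v δ - δ) := by
      rw [intervalIntegral.integral_sub i1 intervalIntegrable_const, ← (hint δ).2,
        intervalIntegral.integral_const, smul_sub, smul_smul, inv_mul_cancel₀ hne, one_smul]
      rfl
    have e2 : ‖∫ s in t..τ, (derivV V s t x v δ - δ)‖ ≤ r * ‖δ‖ * |τ - t| :=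
      intervalIntegral.norm_integral_le_of_norm_le_const fun s hs =>
        ContinuousLinearMap.le_of_opNorm_le _
          (hV s (uIcc_subset_Icc ht hτ (uIoc_subset_uIcc hs))) δ
    rw [e1, norm_smul, norm_inv, Real.norm_eq_abs, inv_mul_le_iff₀ (abs_pos.2 hne)]
    linarith

end IsVlasovFlow

/-! ### Composition of second derivatives with maps close to the identity -/

/-- Cauchy–Schwarz for the product with the constant function. -/
lemma sq_lintegral_le {S : Type*} [MeasurableSpace S] {μ : Measure S} {f : S → ℝ≥0∞}
    (hf : AEMeasurable f μ) : (∫⁻ s, f s ∂μ) ^ 2 ≤ μ univ * ∫⁻ s, f s ^ 2 ∂μ := by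
  have h := ENNReal.lintegral_mul_le_Lp_mul_Lq μ Real.HolderConjugate.two_two hf
    (g := fun _ => 1) aemeasurable_const
  simp only [Pi.mul_apply, mul_one, ENNReal.one_rpow, lintegral_const, one_mul] at h
  calc (∫⁻ s, f s ∂μ) ^ 2
      ≤ ((∫⁻ s, f s ^ (2 : ℝ) ∂μ) ^ (1 / 2 : ℝ) * μ univ ^ (1 / 2 : ℝ)) ^ 2 :=
        pow_le_pow_left₀ zero_le h 2
    _ = μ univ * ∫⁻ s, f s ^ 2 ∂μ := by
        rw [mul_pow, ← ENNReal.rpow_natCast, ← ENNReal.rpow_natCast, ← ENNReal.rpow_mul,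
          ← ENNReal.rpow_mul, mul_comm]
        simp

section NearIdentity

variable {r : ℝ} {γ : E3 → E3} {γ' : E3 → E3 →L[ℝ] E3}

lemma norm_sub_sub_le_of_near_id (hγ : ∀ x, HasFDerivAt γ (γ' x) x)
    (hr : ∀ x, ‖γ' x - ContinuousLinearMap.id ℝ E3‖ ≤ r) (x y : E3) :
    ‖γ x - γ y - (x - y)‖ ≤ r * ‖x - y‖ := by
  have := Convex.norm_image_sub_le_of_norm_hasFDerivWithin_le (s := univ)
    (f := fun x => γ x - x) (fun z _ => ((hγ z).sub (hasFDerivAt_id z)).hasFDerivWithinAt)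
    (fun z _ => hr z) convex_univ (mem_univ y) (mem_univ x)
  rwa [sub_sub_sub_comm] at this

/-- Change of variables for a map whose derivative is close to the identity. -/
lemma lintegral_comp_le_of_near_id (hr0 : r ≤ 1 / 2)
    (hdet : ∀ S : E3 →L[ℝ] E3, ‖S - ContinuousLinearMap.id ℝ E3‖ ≤ r → 1 / 2 ≤ |S.det|)
    (hγ : ∀ x, HasFDerivAt γ (γ' x) x) (hr : ∀ x, ‖γ' x - ContinuousLinearMap.id ℝ E3‖ ≤ r)
    (G : E3 → ℝ≥0∞) (x₀ : E3) (N : ℝ) :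
    ∫⁻ x in Metric.closedBall x₀ N, G (γ x) ≤ 2 * ∫⁻ y in Metric.closedBall (γ x₀) (2 * N), G y := by
  have hlip := norm_sub_sub_le_of_near_id hγ hr
  have hinj : InjOn γ (Metric.closedBall x₀ N) := by
    intro x _ y _ hxy
    have h1 := hlip x y
    rw [hxy, sub_self, zero_sub, norm_neg] at h1
    have h2 := norm_nonneg (x - y)
    exact sub_eq_zero.1 (norm_eq_zero.1 (by nlinarith))
  have hsub : γ '' Metric.closedBall x₀ N ⊆ Metric.closedBall (γ x₀) (2 * N) := by
    rintro _ ⟨x, hx, rfl⟩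
    rw [mem_closedBall_iff_norm] at hx ⊢
    have h1 := hlip x x₀
    have h2 := norm_nonneg (x - x₀)
    have h3 : ‖γ x - γ x₀‖ ≤ ‖γ x - γ x₀ - (x - x₀)‖ + ‖x - x₀‖ := by
      simpa using norm_add_le (γ x - γ x₀ - (x - x₀)) (x - x₀)
    nlinarith
  have hcv := lintegral_image_eq_lintegral_abs_det_fderiv_mul volume
    (Metric.isClosed_closedBall (x := x₀) (ε := N)).measurableSet
    (fun x _ => (hγ x).hasFDerivWithinAt) hinj G
  calc ∫⁻ x in Metric.closedBall x₀ N, G (γ x)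
      ≤ ∫⁻ x in Metric.closedBall x₀ N, 2 * (ENNReal.ofReal |(γ' x).det| * G (γ x)) := by
        refine lintegral_mono fun x => ?_
        have h1 : 1 ≤ 2 * ENNReal.ofReal |(γ' x).det| := by
          have h2 : (1 : ℝ≥0∞) ≤ ENNReal.ofReal (2 * |(γ' x).det|) := by
            rw [ENNReal.one_le_ofReal]
            linarith [hdet _ (hr x)]
          rwa [ENNReal.ofReal_mul (by norm_num), ENNReal.ofReal_ofNat] at h2
        rw [← mul_assoc]
        exact le_mul_of_one_le_left zero_le h1
    _ = 2 * ∫⁻ y in γ '' Metric.closedBall x₀ N, G y := by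
        rw [lintegral_const_mul' _ _ (by simp), hcv]
    _ ≤ _ := by
        gcongr

/-- Composition with two nearby maps close to the identity: the difference is controlled in `L²` by
the derivative. -/
lemma lintegral_comp_sub_comp_le (hr0 : r ≤ 1 / 2)
    (hdet : ∀ S : E3 →L[ℝ] E3, ‖S - ContinuousLinearMap.id ℝ E3‖ ≤ r → 1 / 2 ≤ |S.det|)
    {a b : E3 → E3} {a' b' : E3 → E3 →L[ℝ] E3}
    (ha : ∀ x, HasFDerivAt a (a' x) x) (ha' : ∀ x, ‖a' x - ContinuousLinearMap.id ℝ E3‖ ≤ r)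
    (hb : ∀ x, HasFDerivAt b (b' x) x) (hb' : ∀ x, ‖b' x - ContinuousLinearMap.id ℝ E3‖ ≤ r)
    {d : ℝ} (hd : ∀ x, ‖b x - a x‖ ≤ d) {g : E3 → ℝ} (hg : ContDiff ℝ 1 g) {C N : ℝ}
    (hC : ∀ y, ∫⁻ x in Metric.closedBall y (2 * N), ‖fderiv ℝ g x‖ₑ ^ 2 ≤ ENNReal.ofReal C)
    (x₀ : E3) :
    ∫⁻ x in Metric.closedBall x₀ N, ‖g (b x) - g (a x)‖ₑ ^ 2 ≤
      ENNReal.ofReal d ^ 2 * (2 * ENNReal.ofReal C) := by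
  have hac : Continuous a := continuous_iff_continuousAt.2 fun x => (ha x).continuousAt
  have hbc : Continuous b := continuous_iff_continuousAt.2 fun x => (hb x).continuousAt
  have hgc : Continuous (fderiv ℝ g) := hg.continuous_fderiv (by norm_num)
  -- `g (b x) - g (a x)` is the integral of the derivative along the segment from `a x` to `b x`
  have hpt : ∀ x, ‖g (b x) - g (a x)‖ₑ ^ 2 ≤ ENNReal.ofReal d ^ 2 *
      ∫⁻ θ in Icc (0 : ℝ) 1, ‖fderiv ℝ g (a x + θ • (b x - a x))‖ₑ ^ 2 := by
    intro x
    have hcθ : Continuous fun θ : ℝ => fderiv ℝ g (a x + θ • (b x - a x)) (b x - a x) := by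
      fun_prop
    have hftc : ∫ θ in (0 : ℝ)..1, fderiv ℝ g (a x + θ • (b x - a x)) (b x - a x)
        = g (b x) - g (a x) := by
      have hder : ∀ θ ∈ uIcc (0 : ℝ) 1, HasDerivAt (fun θ : ℝ => g (a x + θ • (b x - a x)))
          (fderiv ℝ g (a x + θ • (b x - a x)) (b x - a x)) θ := fun θ _ => by
        have h1 : HasDerivAt (fun θ : ℝ => a x + θ • (b x - a x)) (b x - a x) θ := by
          simpa using ((hasDerivAt_id θ).smul_const (b x - a x)).const_add (a x)
        exact ((hg.differentiable (by norm_num) _).hasFDerivAt).comp_hasDerivAt θ h1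
      rw [intervalIntegral.integral_eq_sub_of_hasDerivAt hder (hcθ.intervalIntegrable _ _)]
      simp
    have h2 : ‖g (b x) - g (a x)‖ₑ ≤ ENNReal.ofReal d *
        ∫⁻ θ in Icc (0 : ℝ) 1, ‖fderiv ℝ g (a x + θ • (b x - a x))‖ₑ := by
      rw [← hftc, intervalIntegral.integral_of_le zero_le_one, ← integral_Icc_eq_integral_Ioc,
        ← lintegral_const_mul' _ _ ENNReal.ofReal_ne_top]
      refine (enorm_integral_le_lintegral_enorm _).trans (lintegral_mono fun θ => ?_)
      refine (ContinuousLinearMap.le_opENorm _ _).trans ?_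
      rw [mul_comm]
      refine mul_le_mul_left ?_ _
      rw [← ofReal_norm]
      exact ENNReal.ofReal_le_ofReal (hd x)
    have h3 := sq_lintegral_le (μ := volume.restrict (Icc (0 : ℝ) 1))
      (f := fun θ => ‖fderiv ℝ g (a x + θ • (b x - a x))‖ₑ) (by
        refine Continuous.aemeasurable ?_
        fun_prop)
    rw [Measure.restrict_apply_univ, Real.volume_Icc, sub_zero, ENNReal.ofReal_one, one_mul] at h3
    calc _ ≤ (ENNReal.ofReal d *
          ∫⁻ θ in Icc (0 : ℝ) 1, ‖fderiv ℝ g (a x + θ • (b x - a x))‖ₑ) ^ 2 :=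
          pow_le_pow_left₀ zero_le h2 2
      _ ≤ _ := by
          rw [mul_pow]
          gcongr
  have hin : ∀ θ ∈ Icc (0 : ℝ) 1, ∫⁻ x in Metric.closedBall x₀ N,
      ‖fderiv ℝ g (a x + θ • (b x - a x))‖ₑ ^ 2 ≤ 2 * ENNReal.ofReal C := by
    intro θ hθ
    have hγ : ∀ x, HasFDerivAt (fun x => a x + θ • (b x - a x)) (a' x + θ • (b' x - a' x)) x :=
      fun x => (ha x).add (((hb x).sub (ha x)).const_smul θ)
    refine (lintegral_comp_le_of_near_id hr0 hdet hγ (fun x => ?_)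
      (fun y => ‖fderiv ℝ g y‖ₑ ^ 2) x₀ N).trans (mul_le_mul_right (hC _) _)
    have e1 : a' x + θ • (b' x - a' x) - ContinuousLinearMap.id ℝ E3 =
        (1 - θ) • (a' x - ContinuousLinearMap.id ℝ E3) +
          θ • (b' x - ContinuousLinearMap.id ℝ E3) := by
      module
    rw [e1]
    refine (norm_add_le _ _).trans ?_
    rw [norm_smul, norm_smul, Real.norm_of_nonneg hθ.1, Real.norm_of_nonneg (sub_nonneg.2 hθ.2)]
    nlinarith [ha' x, hb' x, hθ.1, hθ.2]
  have hmeas : Measurable fun p : E3 × ℝ => ‖fderiv ℝ g (a p.1 + p.2 • (b p.1 - a p.1))‖ₑ ^ 2 := by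
    refine Continuous.measurable ?_
    fun_prop
  calc ∫⁻ x in Metric.closedBall x₀ N, ‖g (b x) - g (a x)‖ₑ ^ 2
      ≤ ∫⁻ x in Metric.closedBall x₀ N, ENNReal.ofReal d ^ 2 *
        ∫⁻ θ in Icc (0 : ℝ) 1, ‖fderiv ℝ g (a x + θ • (b x - a x))‖ₑ ^ 2 := lintegral_mono hpt
    _ = ENNReal.ofReal d ^ 2 * ∫⁻ θ in Icc (0 : ℝ) 1, ∫⁻ x in Metric.closedBall x₀ N,
        ‖fderiv ℝ g (a x + θ • (b x - a x))‖ₑ ^ 2 := by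
        rw [lintegral_const_mul' _ _ (by finiteness), lintegral_lintegral_swap hmeas.aemeasurable]
    _ ≤ ENNReal.ofReal d ^ 2 * ∫⁻ _ in Icc (0 : ℝ) 1, 2 * ENNReal.ofReal C :=
        mul_le_mul_right (setLIntegral_mono measurable_const hin) _
    _ = _ := by simp

lemma norm_hessian_le_sum (l : E3 →L[ℝ] E3 →L[ℝ] ℝ) :
    ‖l‖ ≤ ∑ i, ∑ k, |l (stdVec i) (stdVec k)| :=
  (norm_le_of_stdVec l).trans (Finset.sum_le_sum fun _ _ => norm_le_of_stdVec _)

/-- The second derivatives of the potential, which are merely in `H¹` locally, composed with two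
nearby maps close to the identity. -/
lemma exists_lintegral_hessian_comp_le (A N : ℝ) : ∃ C : ℝ, 0 ≤ C ∧ ∀ φ : E3 → ℝ, ContDiff ℝ 2 φ →
    (∀ x, ‖fderiv ℝ φ x‖ ≤ A) → (∀ x, ‖fderiv ℝ (fderiv ℝ φ) x‖ ≤ A) →
    (∀ x y, |Laplacian.laplacian φ x - Laplacian.laplacian φ y| ≤ A * ‖x - y‖) →
    ∀ r : ℝ, r ≤ 1 / 2 →
    (∀ S : E3 →L[ℝ] E3, ‖S - ContinuousLinearMap.id ℝ E3‖ ≤ r → 1 / 2 ≤ |S.det|) →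
    ∀ (a b : E3 → E3) (a' b' : E3 → E3 →L[ℝ] E3),
    (∀ x, HasFDerivAt a (a' x) x) → (∀ x, ‖a' x - ContinuousLinearMap.id ℝ E3‖ ≤ r) →
    (∀ x, HasFDerivAt b (b' x) x) → (∀ x, ‖b' x - ContinuousLinearMap.id ℝ E3‖ ≤ r) →
    ∀ d : ℝ, (∀ x, ‖b x - a x‖ ≤ d) → ∀ x₀,
    ∫⁻ x in Metric.closedBall x₀ N,
      ‖fderiv ℝ (fderiv ℝ φ) (b x) - fderiv ℝ (fderiv ℝ φ) (a x)‖ₑ ^ 2 ≤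
        ENNReal.ofReal d ^ 2 * ENNReal.ofReal C := by
  obtain ⟨C, hC⟩ := exists_hessian_approx (2 * N) A
  refine ⟨162 * max C 0, by positivity, ?_⟩
  intro φ hφ h1 h2 h3 r hr0 hdet a b a' b' ha ha' hb hb' d hd x₀
  have hac : Continuous a := continuous_iff_continuousAt.2 fun x => (ha x).continuousAt
  have hbc : Continuous b := continuous_iff_continuousAt.2 fun x => (hb x).continuousAt
  have hHc : Continuous (fderiv ℝ (fderiv ℝ φ)) :=
    (hφ.fderiv_right (m := 1) (by norm_num)).continuous_fderiv (by norm_num)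
  set D : E3 → E3 →L[ℝ] E3 →L[ℝ] ℝ := fun x =>
    fderiv ℝ (fderiv ℝ φ) (b x) - fderiv ℝ (fderiv ℝ φ) (a x) with hD
  have hDc : Continuous D := (hHc.comp hbc).sub (hHc.comp hac)
  have hcomp : ∀ i k : Fin 3, ∫⁻ x in Metric.closedBall x₀ N, ‖D x (stdVec i) (stdVec k)‖ₑ ^ 2 ≤
      ENNReal.ofReal d ^ 2 * (2 * ENNReal.ofReal C) := by
    intro i k
    obtain ⟨g, hg1, hg2, hg3⟩ := hC φ hφ h1 h2 h3 i k
    have hlim : ∀ x, ‖D x (stdVec i) (stdVec k)‖ₑ ^ 2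
        = liminf (fun n => ‖g n (b x) - g n (a x)‖ₑ ^ 2) atTop := fun x =>
      (Tendsto.liminf_eq ((ENNReal.continuous_pow 2).continuousAt.tendsto.comp
        (((hg2 (b x)).sub (hg2 (a x))).enorm))).symm
    simp only [hlim]
    refine (lintegral_liminf_le fun n => ?_).trans ?_
    · have := (hg1 n).continuous
      refine Continuous.measurable ?_
      fun_prop
    · refine liminf_le_of_le (by isBoundedDefault) fun c hc => ?_
      obtain ⟨n, hn⟩ := hc.exists
      exact hn.trans (lintegral_comp_sub_comp_le hr0 hdet ha ha' hb hb' hd (hg1 n) (hg3 n) x₀)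
  have hsum : ∀ x, ‖D x‖ₑ ^ 2 ≤ 9 * ∑ q : Fin 3 × Fin 3, ‖D x (stdVec q.1) (stdVec q.2)‖ₑ ^ 2 := by
    intro x
    have e1 : ‖D x‖ ^ 2 ≤ 9 * ∑ q : Fin 3 × Fin 3, |D x (stdVec q.1) (stdVec q.2)| ^ 2 := by
      have := norm_hessian_le_sum (D x)
      rw [← Fintype.sum_prod_type'] at this
      refine (pow_le_pow_left₀ (norm_nonneg (D x)) this 2).trans ?_
      refine (sq_sum_le_card_mul_sum_sq (s := Finset.univ)).trans (le_of_eq ?_)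
      norm_num
    have e2 := ENNReal.ofReal_le_ofReal e1
    rw [ENNReal.ofReal_mul (by norm_num), ENNReal.ofReal_sum_of_nonneg fun _ _ => by positivity,
      ENNReal.ofReal_pow (norm_nonneg (D x)), ofReal_norm, ENNReal.ofReal_ofNat] at e2
    refine e2.trans (le_of_eq ?_)
    congr 1
    refine Finset.sum_congr rfl fun q _ => ?_
    rw [ENNReal.ofReal_pow (abs_nonneg _), ← Real.norm_eq_abs, ofReal_norm]
  calc ∫⁻ x in Metric.closedBall x₀ N, ‖D x‖ₑ ^ 2
      ≤ ∫⁻ x in Metric.closedBall x₀ N,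
        9 * ∑ q : Fin 3 × Fin 3, ‖D x (stdVec q.1) (stdVec q.2)‖ₑ ^ 2 := lintegral_mono hsum
    _ = 9 * ∑ q : Fin 3 × Fin 3, ∫⁻ x in Metric.closedBall x₀ N,
        ‖D x (stdVec q.1) (stdVec q.2)‖ₑ ^ 2 := by
        rw [lintegral_const_mul' _ _ (by simp), lintegral_finsetSum]
        intro q _
        refine Continuous.measurable ?_
        fun_prop
    _ ≤ 9 * ∑ _q : Fin 3 × Fin 3, ENNReal.ofReal d ^ 2 * (2 * ENNReal.ofReal C) := by
        gcongr with q
        exact hcomp q.1 q.2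
    _ = ENNReal.ofReal d ^ 2 * ENNReal.ofReal (162 * max C 0) := by
        rw [ENNReal.ofReal_mul (by norm_num), Finset.sum_const]
        simp only [Finset.card_univ, Fintype.card_prod, Fintype.card_fin, nsmul_eq_mul,
          ENNReal.ofReal_max, ENNReal.ofReal_zero, ENNReal.ofReal_ofNat]
        rw [max_eq_left zero_le]
        push_cast
        ring

end NearIdentity

/-! ### Second derivatives of the characteristics -/

namespace IsVlasovFlow

variable {T L A α : ℝ} {φ : ℝ → E3 → ℝ} {X V : ℝ → ℝ → E3 → E3 → E3}

lemma hasFDerivAt_position (h : IsVlasovFlow T L A α φ X V) {t τ : ℝ} (ht : t ∈ Icc 0 T)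
    (hτ : τ ∈ Icc 0 T) (x v : E3) :
    HasFDerivAt (fun y => X τ t y v) (derivX X τ t x v) x := by
  obtain ⟨J, -, hd⟩ := h.exists_jacobian
  exact (_root_.hasFDerivAt_position (hd t ht τ hτ (x, v))).differentiableAt.hasFDerivAt

lemma continuous_derivV (h : IsVlasovFlow T L A α φ X V) {t τ : ℝ} (ht : t ∈ Icc 0 T)
    (hτ : τ ∈ Icc 0 T) : Continuous fun p : E3 × E3 => derivV X τ t p.1 p.2 := by
  obtain ⟨J, hJ, hd⟩ := h.exists_jacobian
  have hc := h.isCaratheodoryFlow.continuous_jacobian hJ ht hτ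
  have he : (fun p : E3 × E3 => derivV X τ t p.1 p.2) = fun p =>
      ContinuousLinearMap.fst ℝ E3 E3 ∘L J τ t p ∘L ContinuousLinearMap.inr ℝ E3 E3 :=
    funext fun p => derivV_position (hd t ht τ hτ p)
  rw [he]
  exact continuous_const.clm_comp (hc.clm_comp continuous_const)

/-- Increments of `∂ᵥX` are controlled by those of the second derivatives of the potential along the
characteristics. -/
lemma enorm_derivV_sub_le (h : IsVlasovFlow T L A α φ X V) {t τ : ℝ} (ht : t ∈ Icc 0 T)
    (hτ : τ ∈ Icc 0 T) (p q : E3 × E3) :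
    ‖derivV X τ t p.1 p.2 - derivV X τ t q.1 q.2‖ₑ ≤ ENNReal.ofReal (Real.exp (L * T) ^ 2) *
      ∫⁻ s in Icc 0 T, ‖vlasovDeriv φ s (phaseFlow X V s t p) -
        vlasovDeriv φ s (phaseFlow X V s t q)‖ₑ := by
  obtain ⟨J, hJ, hd⟩ := h.exists_jacobian
  have hC := h.isCaratheodoryFlow
  have h1 : ‖derivV X τ t p.1 p.2 - derivV X τ t q.1 q.2‖ ≤ ‖J τ t p - J τ t q‖ := by
    rw [derivV_position (hd t ht τ hτ p), derivV_position (hd t ht τ hτ q)]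
    refine le_of_eq_of_le ?_ (norm_fst_block_inr_le (J τ t p - J τ t q))
    congr 1
  have h2 := h1.trans (hC.norm_jacobian_sub_le hJ ht hτ p q)
  have hm : AEStronglyMeasurable (fun s => vlasovDeriv φ s (phaseFlow X V s t p) -
      vlasovDeriv φ s (phaseFlow X V s t q)) (volume.restrict (Icc 0 T)) :=
    (hC.aestronglyMeasurable_deriv ht p).sub (hC.aestronglyMeasurable_deriv ht q)
  rw [← ofReal_norm]
  refine (ENNReal.ofReal_le_ofReal h2).trans ?_
  rw [ENNReal.ofReal_mul (by positivity)]
  refine mul_le_mul_right ?_ _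
  rw [integral_norm_eq_lintegral_enorm hm]
  exact ENNReal.ofReal_toReal_le

/-- The increments of `x ↦ D²φ(X(s;t,x,v))` in `L²` of a ball. -/
lemma lintegral_vlasovDeriv_sub_le (h : IsVlasovFlow T L A α φ X V) {r C N : ℝ}
    (hr : L * T * Real.exp (L * T) ≤ r)
    (hC : ∀ s ∈ Icc 0 T, ∀ (a b : E3 → E3) (a' b' : E3 → E3 →L[ℝ] E3),
      (∀ x, HasFDerivAt a (a' x) x) → (∀ x, ‖a' x - ContinuousLinearMap.id ℝ E3‖ ≤ r) →
      (∀ x, HasFDerivAt b (b' x) x) → (∀ x, ‖b' x - ContinuousLinearMap.id ℝ E3‖ ≤ r) →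
      ∀ d : ℝ, (∀ x, ‖b x - a x‖ ≤ d) → ∀ x₀, ∫⁻ x in Metric.closedBall x₀ N,
        ‖fderiv ℝ (fderiv ℝ (φ s)) (b x) - fderiv ℝ (fderiv ℝ (φ s)) (a x)‖ₑ ^ 2 ≤
          ENNReal.ofReal d ^ 2 * ENNReal.ofReal C)
    {t s : ℝ} (ht : t ∈ Icc 0 T) (hs : s ∈ Icc 0 T) (x₀ v : E3) (e : E3 × E3) :
    ∫⁻ x in Metric.closedBall x₀ N, ‖vlasovDeriv φ s (phaseFlow X V s t ((x, v) + e)) -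
      vlasovDeriv φ s (phaseFlow X V s t (x, v))‖ₑ ^ 2 ≤
        ENNReal.ofReal (Real.exp (L * T) * ‖e‖) ^ 2 * ENNReal.ofReal C := by
  have hb : ∀ x, HasFDerivAt (fun x => X s t (x + e.1) (v + e.2))
      (derivX X s t (x + e.1) (v + e.2)) x := fun x => by
    have h1 := h.hasFDerivAt_position ht hs (x + e.1) (v + e.2)
    have h2 : HasFDerivAt (fun x => x + e.1) (ContinuousLinearMap.id ℝ E3) x :=
      (hasFDerivAt_id x).add_const e.1
    have h3 := HasFDerivAt.comp x h1 h2
    rwa [ContinuousLinearMap.comp_id] at h3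
  have hd : ∀ x, ‖X s t (x + e.1) (v + e.2) - X s t x v‖ ≤ Real.exp (L * T) * ‖e‖ := fun x => by
    have h1 := h.isCaratheodoryFlow.norm_sub_le ht hs ((x, v) + e) (x, v)
    rw [add_sub_cancel_left] at h1
    exact (norm_fst_le (phaseFlow X V s t ((x, v) + e) - phaseFlow X V s t (x, v))).trans h1
  refine le_trans (lintegral_mono fun x => ?_) (hC s hs _ _ _ _
    (fun x => h.hasFDerivAt_position ht hs x v)
    (fun x => (h.derivX_derivV_near_id hr ht hs x v).1) hb
    (fun x => (h.derivX_derivV_near_id hr ht hs (x + e.1) (v + e.2)).1) _ hd x₀)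
  refine pow_le_pow_left₀ zero_le ?_ 2
  exact enorm_le_iff_norm_le.2 (norm_vlasovDeriv_sub_le φ s (phaseFlow X V s t ((x, v) + e))
    (phaseFlow X V s t (x, v)))

lemma aestronglyMeasurable_deriv_increment (h : IsVlasovFlow T L A α φ X V) {t : ℝ}
    (ht : t ∈ Icc 0 T) (v : E3) (e : E3 × E3) (ν : Measure E3) [SFinite ν] :
    AEStronglyMeasurable (Function.uncurry fun s x =>
      vlasovDeriv φ s (phaseFlow X V s t ((x, v) + e)) -
        vlasovDeriv φ s (phaseFlow X V s t (x, v))) ((volume.restrict (Icc 0 T)).prod ν) := by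
  have hC := h.isCaratheodoryFlow
  refine aestronglyMeasurable_uncurry_caratheodory
    ((ae_restrict_mem measurableSet_Icc).mono fun s hs => ?_) fun x =>
      (hC.aestronglyMeasurable_deriv ht _).sub (hC.aestronglyMeasurable_deriv ht _)
  have h1 := (hC.continuous_deriv hs).comp (h.contDiff_phaseFlow ht hs).continuous
  exact (h1.comp (by fun_prop : Continuous fun x : E3 => ((x, v) : E3 × E3) + e)).sub
    (h1.comp (by fun_prop : Continuous fun x : E3 => ((x, v) : E3 × E3)))

end IsVlasovFlow

/-- Translates of `∂ᵥX` in `L²` of the balls of a slice, with uniform constants. -/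
lemma exists_lintegral_derivV_sub_le (L Tstar N : ℝ) : ∃ c : ℝ, 0 ≤ c ∧
    ∀ (T A α r : ℝ) (φ : ℝ → E3 → ℝ) (X V : ℝ → ℝ → E3 → E3 → E3), IsVlasovFlow T L A α φ X V →
    T ≤ Tstar → (∀ t ∈ Icc 0 T, ∀ x y,
      |Laplacian.laplacian (φ t) x - Laplacian.laplacian (φ t) y| ≤ L * ‖x - y‖) →
    r ≤ 1 / 2 → L * T * Real.exp (L * T) ≤ r →
    (∀ S : E3 →L[ℝ] E3, ‖S - ContinuousLinearMap.id ℝ E3‖ ≤ r → 1 / 2 ≤ |S.det|) →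
    ∀ t ∈ Icc 0 T, ∀ τ ∈ Icc 0 T, ∀ (x₀ v : E3) (e : E3 × E3),
    ∫⁻ x in Metric.closedBall x₀ N,
      ‖derivV X τ t ((x, v) + e).1 ((x, v) + e).2 - derivV X τ t x v‖ₑ ^ 2 ≤
        ENNReal.ofReal (c * ‖e‖ ^ 2) := by
  obtain ⟨C, hC0, hC⟩ := exists_lintegral_hessian_comp_le L N
  set M := Real.exp (L * Tstar) with hM
  refine ⟨M ^ 4 * (Tstar ^ 2 * (M ^ 2 * C)), by positivity, ?_⟩
  intro T A α r φ X V h hT hlap hr0 hr hdet t ht τ hτ x₀ v e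
  have hT0 : 0 ≤ T := ht.1.trans ht.2
  have hMT : Real.exp (L * T) ≤ M :=
    Real.exp_le_exp.2 (mul_le_mul_of_nonneg_left hT (by linarith [h.one_le]))
  have hB : ∀ s ∈ Icc 0 T, ∫⁻ x in Metric.closedBall x₀ N,
      ‖vlasovDeriv φ s (phaseFlow X V s t ((x, v) + e)) -
        vlasovDeriv φ s (phaseFlow X V s t (x, v))‖ₑ ^ 2 ≤
        ENNReal.ofReal (Real.exp (L * T) * ‖e‖) ^ 2 * ENNReal.ofReal C := fun s hs =>
    h.lintegral_vlasovDeriv_sub_le hr (fun s hs => hC (φ s) (h.contDiff s hs) (h.norm_fderiv_le s hs)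
      (h.norm_hessian_le s hs) (hlap s hs) r hr0 hdet) ht hs x₀ v e
  have hmeas := (h.aestronglyMeasurable_deriv_increment ht v e
    (volume.restrict (Metric.closedBall x₀ N))).enorm
  set D : ℝ → E3 → ℝ≥0∞ := fun s x => ‖vlasovDeriv φ s (phaseFlow X V s t ((x, v) + e)) -
        vlasovDeriv φ s (phaseFlow X V s t (x, v))‖ₑ with hD
  have hDm : ∀ x, AEMeasurable (fun s => D s x) (volume.restrict (Icc 0 T)) := fun x =>
    ((h.isCaratheodoryFlow.aestronglyMeasurable_deriv ht _).sub
      (h.isCaratheodoryFlow.aestronglyMeasurable_deriv ht _)).enorm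
  have hpt : ∀ x, ‖derivV X τ t ((x, v) + e).1 ((x, v) + e).2 - derivV X τ t x v‖ₑ ^ 2 ≤
      ENNReal.ofReal (Real.exp (L * T) ^ 2) ^ 2 *
        (ENNReal.ofReal T * ∫⁻ s in Icc 0 T, D s x ^ 2) := fun x => by
    have h1 := sq_lintegral_le (hDm x)
    rw [Measure.restrict_apply_univ, Real.volume_Icc, sub_zero] at h1
    refine (pow_le_pow_left₀ zero_le (h.enorm_derivV_sub_le ht hτ ((x, v) + e) (x, v)) 2).trans ?_
    rw [mul_pow]
    exact mul_le_mul_right h1 _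
  calc ∫⁻ x in Metric.closedBall x₀ N,
      ‖derivV X τ t ((x, v) + e).1 ((x, v) + e).2 - derivV X τ t x v‖ₑ ^ 2
      ≤ ∫⁻ x in Metric.closedBall x₀ N, ENNReal.ofReal (Real.exp (L * T) ^ 2) ^ 2 *
        (ENNReal.ofReal T * ∫⁻ s in Icc 0 T, D s x ^ 2) := lintegral_mono hpt
    _ = ENNReal.ofReal (Real.exp (L * T) ^ 2) ^ 2 * (ENNReal.ofReal T *
        ∫⁻ s in Icc 0 T, ∫⁻ x in Metric.closedBall x₀ N, D s x ^ 2) := by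
        rw [lintegral_const_mul' _ _ (by finiteness), lintegral_const_mul' _ _ (by finiteness),
          lintegral_lintegral_swap (f := fun s x => D s x ^ 2) (hmeas.pow_const 2)]
    _ ≤ ENNReal.ofReal (Real.exp (L * T) ^ 2) ^ 2 * (ENNReal.ofReal T * ∫⁻ _ in Icc 0 T,
        ENNReal.ofReal (Real.exp (L * T) * ‖e‖) ^ 2 * ENNReal.ofReal C) :=
        mul_le_mul_right (mul_le_mul_right (setLIntegral_mono measurable_const hB) _) _
    _ = ENNReal.ofReal ((Real.exp (L * T) ^ 2) ^ 2 * (T *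
        (((Real.exp (L * T) * ‖e‖) ^ 2 * C) * T))) := by
        rw [setLIntegral_const, Real.volume_Icc, sub_zero, ← ENNReal.ofReal_pow (by positivity),
          ← ENNReal.ofReal_pow (by positivity), ← ENNReal.ofReal_mul (by positivity),
          ← ENNReal.ofReal_mul (by positivity), ← ENNReal.ofReal_mul (by positivity),
          ← ENNReal.ofReal_mul (by positivity)]
    _ ≤ ENNReal.ofReal (M ^ 4 * (Tstar ^ 2 * (M ^ 2 * C)) * ‖e‖ ^ 2) := by
        refine ENNReal.ofReal_le_ofReal ?_
        calc _ = Real.exp (L * T) ^ 4 * (T ^ 2 * (Real.exp (L * T) ^ 2 * C)) * ‖e‖ ^ 2 := by ring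
          _ ≤ _ := by gcongr

lemma norm_comp_inl_le {W : Type*} [NormedAddCommGroup W] [NormedSpace ℝ W] (S : E3 × E3 →L[ℝ] W) :
    ‖S ∘L ContinuousLinearMap.inl ℝ E3 E3‖ ≤ ‖S‖ :=
  ContinuousLinearMap.opNorm_le_bound _ (norm_nonneg _) fun x =>
    (S.le_opNorm _).trans (mul_le_mul_of_nonneg_left (norm_inl_le x) (norm_nonneg _))

lemma norm_comp_inr_le {W : Type*} [NormedAddCommGroup W] [NormedSpace ℝ W] (S : E3 × E3 →L[ℝ] W) :
    ‖S ∘L ContinuousLinearMap.inr ℝ E3 E3‖ ≤ ‖S‖ :=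
  ContinuousLinearMap.opNorm_le_bound _ (norm_nonneg _) fun x =>
    (S.le_opNorm _).trans (mul_le_mul_of_nonneg_left (norm_inr_le x) (norm_nonneg _))

theorem lemma4p1 (k : ℕ) (hk : 1 ≤ k) (K θM β m M : ℝ) (hK : 0 < K) (hθM : 0 < θM)
    (hβ : 7 / 2 ≤ β) (hm : 0 < m) (hm' : m < 1 / 2) :
    ∃ ε₀ Tstar C : ℝ, ∃ CN : ℝ → ℝ, 0 < ε₀ ∧ 0 < Tstar ∧
      ∀ (ε T : ℝ), 0 < ε → ε < ε₀ → 0 ≤ T → T ≤ ε ^ (-m) →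
      -- the coefficients; the leading one is a local Maxwellian
      ∀ (ρ₀ : ℝ → E3 → ℝ) (u₀ : ℝ → E3 → E3) (F : ℕ → ℝ → E3 → E3 → ℝ),
      (∀ t ∈ Icc 0 T, ∀ x, 0 < ρ₀ t x ∧
        θM ≤ K * ρ₀ t x ^ (2 / 3 : ℝ) ∧ K * ρ₀ t x ^ (2 / 3 : ℝ) ≤ 2 * θM) →
      (∀ t ∈ Icc 0 T, ∀ x v,
        F 0 t x v = maxwellian (ρ₀ t x) (K * ρ₀ t x ^ (2 / 3 : ℝ)) (u₀ t x) v) →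
      (∀ i < 2 * k, ∀ t ∈ Icc 0 T, ∀ᵐ x : E3, Integrable (F i t x)) →
      coeffSize k F T ≤ ENNReal.ofReal M →
      -- the remainder
      ∀ (R : ℝ → E3 → E3 → ℝ),
      (∀ t ∈ Icc 0 T, ENNReal.ofReal (ε ^ k) * w1InfNorm (weightedRemainder β θM (R t)) ≤
        ENNReal.ofReal (Real.sqrt ε)) →
      -- the potential
      ∀ (α : ℝ) (φ : ℝ → E3 → ℝ), 0 < α → α < 1 →
      (∃ A, ∀ t ∈ Icc 0 T, C2HolderBound α A (φ t)) →
      (∀ x, AEStronglyMeasurable (fun t => φ t x) (volume.restrict (Icc 0 T))) →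
      (∀ t ∈ Icc 0 T, ∀ᵐ x : E3,
        Laplacian.laplacian (φ t) x =
          Real.exp (φ t x) - ∫ v, truncatedExpansion k ε F R t x v) →
      -- its characteristics
      ∀ (X V : ℝ → ℝ → E3 → E3 → E3), IsCharacteristics T φ X V →
      -- first derivatives exist, are continuous, and are bounded on `[0,T]`
      (∀ t ∈ Icc 0 T, ∀ τ ∈ Icc 0 T,
        ContDiff ℝ 1 (fun p : E3 × E3 => X τ t p.1 p.2) ∧
        ContDiff ℝ 1 (fun p : E3 × E3 => V τ t p.1 p.2) ∧
        ∀ x v, ‖derivX X τ t x v‖ ≤ C * Real.exp (C * T) ∧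
          ‖derivV V τ t x v‖ ≤ C * Real.exp (C * T)) ∧
      -- short times: Jacobian bounds
      (∀ t τ, 0 ≤ τ → τ ≤ t → t ≤ min T Tstar → ∀ x v,
        (1 / 2 * |t - τ| ^ 3 ≤ |(derivV X τ t x v).det| ∧
          |(derivV X τ t x v).det| ≤ 2 * |t - τ| ^ 3) ∧
        matNorm (derivV X τ t x v) ≤ 2 * |t - τ| ∧
        (1 / 2 ≤ |(derivV V τ t x v).det| ∧ |(derivV V τ t x v).det| ≤ 2) ∧
        (1 / 2 ≤ |(derivX X τ t x v).det| ∧ |(derivX X τ t x v).det| ≤ 2)) ∧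
      -- short times: the weak second derivatives `∂ₓ∂ᵥX = Gx` and `∂ᵥ∂ᵥX = Gv`
      (∀ t ∈ Icc 0 (min T Tstar), ∀ τ ∈ Icc 0 (min T Tstar),
        ∃ Gx Gv : E3 × E3 → (E3 →L[ℝ] (E3 →L[ℝ] E3)),
          HasWeakDeriv (fun p : E3 × E3 => derivV X τ t p.1 p.2)
            (fun p => (Gx p).coprod (Gv p)) ∧
          ∀ N : ℝ, 1 ≤ N → ∀ x₀ v : E3, ‖v‖ ≤ N →
            (∫⁻ x in Metric.closedBall x₀ N, (‖Gx (x, v)‖ₑ ^ 2 + ‖Gv (x, v)‖ₑ ^ 2)) ^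
              (1 / 2 : ℝ) ≤ ENNReal.ofReal (CN N)) := by
  have hβ0 : 0 ≤ β := by linarith
  obtain ⟨ε₀, ρmin, ρmax, hε₀, hρmin, hρ⟩ :=
    exists_density_bounds k hk K θM β m M hK hθM hβ0 hm hm'
  obtain ⟨L, hL, hpot⟩ := exists_potential_bound hρmin ρmax
  obtain ⟨r, hr0, hr2, hr⟩ := exists_radius_near_id
  -- chosen so that `L * T * exp (L * T) ≤ r` for `T ≤ Tstar`, with `exp (L * T) ≤ 3`
  set Tstar : ℝ := r / (3 * L) with hTs
  have hTs0 : 0 < Tstar := by positivity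
  have hsmall : ∀ T, T ≤ Tstar → 0 ≤ T → L * T * Real.exp (L * T) ≤ r := by
    intro T hT hT0
    have h1 : L * T ≤ r / 3 := by
      have h2 := mul_le_mul_of_nonneg_left hT (show 0 ≤ L by linarith)
      have h3 : L * Tstar = r / 3 := by
        rw [hTs]
        field_simp
      linarith
    have h2 : Real.exp (L * T) ≤ 3 :=
      (Real.exp_le_exp.2 (by linarith : L * T ≤ 1)).trans (by linarith [Real.exp_one_lt_d9])
    have h3 : 0 ≤ L * T := by positivity
    nlinarith
  choose c hc0 hc using fun N : ℕ => exists_lintegral_derivV_sub_le L Tstar N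
  obtain ⟨κ, hκ⟩ := exists_hasWeakDeriv_slices (E3 →L[ℝ] E3)
  refine ⟨ε₀, Tstar, L, fun N => (2 * (max κ 0 * c (⌈N⌉₊ + 1))) ^ (1 / 2 : ℝ), hε₀, hTs0, ?_⟩
  intro ε T hε hεε hT0 hT ρ₀ u₀ F hF1 hF2 hF3 hF4 R hR α φ hα hα1 hφ hφm hlap X V hXV
  obtain ⟨A, hA⟩ := hφ
  have hbd := fun t (ht : t ∈ Icc 0 T) => by
    obtain ⟨h1, h2⟩ := hρ ε T hε hεε hT ρ₀ u₀ F (fun t ht x => ⟨(hF1 t ht x).1, (hF1 t ht x).2.1⟩)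
      hF2 hF3 hF4 R hR t ht
    exact hpot (φ t) _ (hA t ht).1 ⟨A, (hA t ht).2.1⟩ h1 h2 (hlap t ht)
  have hflow : IsVlasovFlow T L |A| α φ X V := by
    refine ⟨hL, abs_nonneg A, hα, fun t ht => (hA t ht).1, fun t ht => (hbd t ht).1,
      fun t ht => (hbd t ht).2.1, fun t ht x y => ((hA t ht).2.2.2.2 x y).trans ?_, hφm, hXV⟩
    exact mul_le_mul_of_nonneg_right (le_abs_self A) (by positivity)
  have hshort : IsVlasovFlow (min T Tstar) L |A| α φ X V := hflow.mono (min_le_left _ _)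
  have hs := hsmall (min T Tstar) (min_le_right _ _) (le_min hT0 hTs0.le)
  refine ⟨fun t ht τ hτ => ?_, fun t τ h0 hτt ht x v => ?_, fun t ht τ hτ => ?_⟩
  · have hcd := hflow.contDiff_phaseFlow ht hτ
    refine ⟨contDiff_fst.comp hcd, contDiff_snd.comp hcd, fun x v => ?_⟩
    obtain ⟨h1, h2⟩ := hflow.norm_derivX_le ht hτ x v
    have h3 := le_mul_of_one_le_left (Real.exp_pos (L * T)).le hL
    exact ⟨h1.trans h3, h2.trans h3⟩
  · have ht' : t ∈ Icc 0 (min T Tstar) := ⟨h0.trans hτt, ht⟩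
    have hτ' : τ ∈ Icc 0 (min T Tstar) := ⟨h0, hτt.trans ht⟩
    obtain ⟨h1, h2⟩ := hshort.derivX_derivV_near_id hs ht' hτ' x v
    obtain ⟨S, hS, hXS⟩ := hshort.derivV_position_near hr0.le hs ht' hτ' x v
    obtain ⟨⟨d1, d2⟩, d3⟩ := hr S hS
    have hp : 0 ≤ |t - τ| ^ 3 := by positivity
    refine ⟨?_, ?_, (hr _ h2).1, (hr _ h1).1⟩
    · rw [hXS, det_smul_E3, abs_mul, abs_pow, abs_sub_comm τ t]
      constructor <;> nlinarith
    · rw [hXS, matNorm_smul, abs_sub_comm τ t]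
      nlinarith [abs_nonneg (t - τ)]
  · obtain ⟨G, hG, hGb⟩ := hκ (fun p => derivV X τ t p.1 p.2) c (hshort.continuous_derivV ht hτ) hc0
      fun N x₀ v e _ => hc N (min T Tstar) |A| α r φ X V hshort (min_le_right _ _)
        (fun t ht => (hbd t (Icc_subset_Icc_right (min_le_left _ _) ht)).2.2) hr2 hs
        (fun S hS => (hr S hS).1.1) t ht τ hτ x₀ v e
    refine ⟨fun p => G p ∘L ContinuousLinearMap.inl ℝ E3 E3,
      fun p => G p ∘L ContinuousLinearMap.inr ℝ E3 E3, ?_, fun N hN x₀ v _ => ?_⟩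
    · have : (fun p => (G p ∘L ContinuousLinearMap.inl ℝ E3 E3).coprod
          (G p ∘L ContinuousLinearMap.inr ℝ E3 E3)) = G := by
        funext p
        exact ContinuousLinearMap.coprod_comp_inl_inr (G p)
      rwa [this]
    · have hle : ∀ p, ‖G p ∘L ContinuousLinearMap.inl ℝ E3 E3‖ₑ ^ 2 +
          ‖G p ∘L ContinuousLinearMap.inr ℝ E3 E3‖ₑ ^ 2 ≤ 2 * ‖G p‖ₑ ^ 2 := by
        intro p
        have g1 := (enorm_le_iff_norm_le.2 (norm_comp_inl_le (G p)))
        have g2 := (enorm_le_iff_norm_le.2 (norm_comp_inr_le (G p)))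
        rw [two_mul]
        exact add_le_add (pow_le_pow_left₀ zero_le g1 2) (pow_le_pow_left₀ zero_le g2 2)
      have hN' : N ≤ (⌈N⌉₊ : ℝ) := Nat.le_ceil N
      have hκ0 : 0 ≤ max κ 0 * c (⌈N⌉₊ + 1) := mul_nonneg (le_max_right _ _) (hc0 _)
      rw [← ENNReal.ofReal_rpow_of_nonneg (by positivity) (by norm_num)]
      refine ENNReal.rpow_le_rpow ?_ (by norm_num)
      calc _ ≤ ∫⁻ x in Metric.closedBall x₀ N, 2 * ‖G (x, v)‖ₑ ^ 2 :=
            lintegral_mono fun x => hle (x, v)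
        _ = 2 * ∫⁻ x in Metric.closedBall x₀ N, ‖G (x, v)‖ₑ ^ 2 :=
            lintegral_const_mul' _ _ (by simp)
        _ ≤ 2 * ∫⁻ x in Metric.closedBall x₀ (⌈N⌉₊ : ℝ), ‖G (x, v)‖ₑ ^ 2 := by
            gcongr
        _ ≤ 2 * ENNReal.ofReal (max κ 0 * c (⌈N⌉₊ + 1)) := by
            refine mul_le_mul_right ((hGb _ x₀ v).trans (ENNReal.ofReal_le_ofReal ?_)) _
            exact mul_le_mul_of_nonneg_right (le_max_left _ _) (hc0 _)
        _ = _ := by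
            rw [ENNReal.ofReal_mul zero_le_two, ENNReal.ofReal_ofNat]
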